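/- **Setting.** Let $\Lambda>0$, $a>0$ and $M,e\in\mathbb R$ be such that $$\Delta_r(r)=(r^2+a^2)\Bigl(1-\frac{\Lambda}{3}r^2\Bigr)-2Mr+e^2$$ has four real roots $r_n<0<r_-<r_+<r_c$ (subextremal Kerr–Newman–de Sitter parameters), and fix $r_0\in(r_-,r_+)$. Put $\Delta_\theta=1+\frac{\Lambda}{3}a^2\cos^2\theta$, $$\hat P(\theta,\lambda)=a\sqrt{\lambda\Delta_\theta-\sin^2\theta},\qquad \hat Q(r,\lambda)=\sqrt{(r^2+a^2)^2-a^2\lambda\Delta_r},$$ $P(\theta,\theta_\star)=\hat P(\theta,\sin^2\theta_\star)$, $Q(r,\theta_\star)=\hat Q(r,\sin^2\theta_\star)$, and $$F(r,\theta,\theta_\star)=\int_{\theta_\star}^{\theta}\frac{d\theta'}{P(\theta',\theta_\star)}+\int_r^{r_+}\frac{dr'}{Q(r',\theta_\star)} .$$ For $r\in(r_-,r_+)$ and $\theta\in(0,\frac\pi2)$ let $\theta_\star(r,\theta)\in[\theta,\frac\pi2)$ be the solution of $F(r,\theta,\theta_\star)=0$, and let $r_\star(r,\theta)=\varrho(r,\theta,\sin^2\theta_\star(r,\theta))$,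 where $$\varrho(r,\theta,\lambda)=\int_{r_0}^r\frac{r'^2+a^2}{\Delta_{r'}}dr'+\int_r^{r_+}\frac{r'^2+a^2-\hat Q(r',\lambda)}{\Delta_{r'}}dr'+\int_0^\theta\frac{\hat P(\theta',\lambda)}{\Delta_{\theta'}}d\theta'+\frac{a^2}{2}f(\lambda),$$ $$f(\lambda)=-\int_0^\lambda\int_0^{\arcsin\sqrt\mu}\frac{d\theta'}{\hat P(\theta',\mu)}\,d\mu .$$ The map $(r,\theta)\mapsto(r_\star,\theta_\star)$ is a bijection of $(r_-,r_+)\times(0,\frac\pi2)$ onto $\mathbb R\times(0,\frac\pi2)$; its inverse makes $r$ and $\theta$ functions of $(r_\star,\theta_\star)$. Let $L=-GPQ$ with $G=\partial_{\theta_\star}F(r,\theta,\theta_\star)$, also regarded as a function of $(r_\star,\theta_\star)$. Write $T=\frac{1}{\sin(2\theta_\star)}\partial_{\theta_\star}$. A function on $\mathbb R\times(0,\frac\pi2)$ is called $C^\infty$ if it has derivatives of all orders with respect to $\partial_{r_\star}$ and $T$, taken in any order, and each of them is continuous and extends continuously to $\theta_\star=0$ and $\theta_\star=\frac\pi2$.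 **Lemma A.6.** The functions $r$, $\frac{\partial\theta}{\partial\theta_\star}$ and $L$ are $C^\infty$ functions of $(r_\star,\theta_\star)$, and $\theta$ has a first derivative with respect to $\theta_\star$ and derivatives of all orders with respect to $r_\star$. For every $k\ge 2$ there is a constant $C$, depending only on $\Lambda,M,a,e$ and $k$, such that on $\mathbb R\times(0,\frac\pi2)$ $$\sum_{1\le k_1+k_2\le k}\bigl|\partial_{r_\star}^{k_1}T^{k_2}r\bigr|\le C|\Delta_r|,$$ $$\sum_{1\le k_1\le k}\bigl|\partial_{r_\star}^{k_1}\theta\bigr|\le C|\Delta_r|\sin(2\theta_\star),$$ $$\sum_{0\le k_1\le k-1}\Bigl|T^{k_1}\frac{\partial\theta}{\partial\theta_\star}\Bigr|\le C,\qquad \sum_{\substack{1\le k_1+k_2\le k-1\\ k_1\ge1}}\Bigl|\partial_{r_\star}^{k_1}T^{k_2}\frac{\partial\theta}{\partial\theta_\star}\Bigr|\le C|\Delta_r|,$$ $$\sum_{0\le k_1\le k-1}\bigl|T^{k_1}L\bigr|\le C,\qquad \sum_{\substack{1\le k_1+k_2\le k-1\\ k_1\ge1}}\bigl|\partial_{r_\star}^{k_1}T^{k_2}L\bigr|\le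 C|\Delta_r| .$$ Here $k_1,k_2\ge0$ are integers and $\Delta_r$ is evaluated at $r=r(r_\star,\theta_\star)$. -/

import Mathlib

noncomputable section

/-- The parameters of a Kerr--Newman--de Sitter metric (cosmological constant `Λ`, mass `M`,
angular momentum `a`, charge `e`) together with the radii `rm` (of the Cauchy horizon) and
`rp` (of the event horizon).  This is bare data; see `KNdS.Subextremal`. -/
structure KNdS where
  Λ : ℝ
  M : ℝ
  a : ℝ
  e : ℝ
  rm : ℝ
  rp : ℝ

namespace KNdS

/-- The polynomial `Δ_r`. -/
def deltaR (p : KNdS) (r : ℝ) : ℝ :=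
  (r ^ 2 + p.a ^ 2) * (1 - p.Λ / 3 * r ^ 2) - 2 * p.M * r + p.e ^ 2

/-- The function `Δ_θ`. -/
def deltaTheta (p : KNdS) (θ : ℝ) : ℝ :=
  1 + p.Λ / 3 * p.a ^ 2 * Real.cos θ ^ 2

/-- Subextremality: `Δ_r` has four distinct real roots `rn < 0 < rm < rp < rc`
(with `Λ > 0` and `a > 0`).  The four roots are determined by `Λ, M, a, e`. -/
def Subextremal (p : KNdS) : Prop :=
  0 < p.Λ ∧ 0 < p.a ∧ 0 < p.rm ∧ p.rm < p.rp ∧ p.deltaR p.rm = 0 ∧ p.deltaR p.rp = 0 ∧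
    ∃ rn rc : ℝ, rn < 0 ∧ p.rp < rc ∧ p.deltaR rn = 0 ∧ p.deltaR rc = 0

/-- `P̂(θ, l)`, where `l` stands for `sin² θ⋆`. -/
def Phat (p : KNdS) (θ l : ℝ) : ℝ :=
  p.a * Real.sqrt (l * p.deltaTheta θ - Real.sin θ ^ 2)

/-- `Q̂(r, l)`, where `l` stands for `sin² θ⋆`. -/
def Qhat (p : KNdS) (r l : ℝ) : ℝ :=
  Real.sqrt ((r ^ 2 + p.a ^ 2) ^ 2 - p.a ^ 2 * l * p.deltaR r)

/-- `P(θ, θ⋆)`. -/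
def P (p : KNdS) (θ ϑ : ℝ) : ℝ := p.Phat θ (Real.sin ϑ ^ 2)

/-- `Q(r, θ⋆)`. -/
def Q (p : KNdS) (r ϑ : ℝ) : ℝ := p.Qhat r (Real.sin ϑ ^ 2)

/-- The function `F(r, θ, θ⋆)` whose zero in the last variable defines `θ⋆`. -/
def F (p : KNdS) (r θ ϑ : ℝ) : ℝ :=
  (∫ x in ϑ..θ, 1 / p.P x ϑ) + ∫ s in r..p.rp, 1 / p.Q s ϑ

/-- The derivative `f'` of the function `f` below. -/
def fPrime (p : KNdS) (l : ℝ) : ℝ :=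
  -∫ x in (0 : ℝ)..Real.arcsin (Real.sqrt l), 1 / p.Phat x l

/-- The function `f` with `f(0) = 0` and derivative `fPrime`. -/
def f (p : KNdS) (l : ℝ) : ℝ := ∫ m in (0 : ℝ)..l, p.fPrime m

/-- The function `ϱ(r, θ, l)`, with base point `r0 ∈ (rm, rp)`. -/
def varrho (p : KNdS) (r0 r θ l : ℝ) : ℝ :=
  (∫ s in r0..r, (s ^ 2 + p.a ^ 2) / p.deltaR s) +
    (∫ s in r..p.rp, ((s ^ 2 + p.a ^ 2) - p.Qhat s l) / p.deltaR s) +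
    (∫ x in (0 : ℝ)..θ, p.Phat x l / p.deltaTheta x) + p.a ^ 2 / 2 * p.f l

/-- `θ⋆(r, θ)`: the solution `θ⋆ ∈ [θ, π/2)` of `F(r, θ, θ⋆) = 0`, for `θ ∈ (0, π/2)`. -/
def thetaStar (p : KNdS) (r θ : ℝ) : ℝ :=
  Classical.epsilon fun ϑ : ℝ => ϑ ∈ Set.Ico θ (Real.pi / 2) ∧ p.F r θ ϑ = 0

/-- `r⋆(r, θ) = ϱ(r, θ, sin² θ⋆(r, θ))`. -/
def rStar (p : KNdS) (r0 r θ : ℝ) : ℝ :=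
  p.varrho r0 r θ (Real.sin (p.thetaStar r θ) ^ 2)

/-- The change of coordinates `(r, θ) ↦ (r⋆, θ⋆)`. -/
def starMap (p : KNdS) (r0 : ℝ) (z : ℝ × ℝ) : ℝ × ℝ :=
  (p.rStar r0 z.1 z.2, p.thetaStar z.1 z.2)

/-- The inverse `(r⋆, θ⋆) ↦ (r, θ)` of the change of coordinates on `(rm, rp) × (0, π/2)`. -/
def starInv (p : KNdS) (r0 : ℝ) : ℝ × ℝ → ℝ × ℝ :=
  Function.invFunOn (p.starMap r0) (Set.Ioo p.rm p.rp ×ˢ Set.Ioo 0 (Real.pi / 2))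

/-- `r` as a function of `(r⋆, θ⋆)`. -/
def rOf (p : KNdS) (r0 x y : ℝ) : ℝ := (p.starInv r0 (x, y)).1

/-- `θ` as a function of `(r⋆, θ⋆)`. -/
def thetaOf (p : KNdS) (r0 x y : ℝ) : ℝ := (p.starInv r0 (x, y)).2

/-- `∂θ/∂θ⋆` as a function of `(r⋆, θ⋆)`. -/
def dthetaOf (p : KNdS) (r0 x y : ℝ) : ℝ := deriv (fun t => p.thetaOf r0 x t) y

/-- `G = ∂F/∂θ⋆`. -/
def G (p : KNdS) (r θ ϑ : ℝ) : ℝ := deriv (fun t => p.F r θ t) ϑ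

/-- `L = - G P Q` as a function of `(r, θ, θ⋆)`. -/
def L (p : KNdS) (r θ ϑ : ℝ) : ℝ := -(p.G r θ ϑ * p.P θ ϑ * p.Q r ϑ)

/-- `L` as a function of `(r⋆, θ⋆)`. -/
def LOf (p : KNdS) (r0 x y : ℝ) : ℝ := p.L (p.rOf r0 x y) (p.thetaOf r0 x y) y

/-- The operator `∂_{r⋆}`. -/
def dR (g : ℝ → ℝ → ℝ) : ℝ → ℝ → ℝ := fun x y => deriv (fun t => g t y) x

/-- The operator `(1 / sin 2θ⋆) ∂_{θ⋆}`. -/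
def dT (g : ℝ → ℝ → ℝ) : ℝ → ℝ → ℝ :=
  fun x y => 1 / Real.sin (2 * y) * deriv (fun t => g x t) y

/-- `g`, given on `ℝ × (0, π/2)`, is continuous there and has a continuous extension to
`ℝ × [0, π/2]`. -/
def ContinuousUpToBoundary (g : ℝ → ℝ → ℝ) : Prop :=
  ∃ h : ℝ × ℝ → ℝ, ContinuousOn h (Set.univ ×ˢ Set.Icc 0 (Real.pi / 2)) ∧
    ∀ x : ℝ, ∀ y ∈ Set.Ioo 0 (Real.pi / 2), h (x, y) = g x y

/-- `g` has all derivatives of order at most `n` with respect to `∂_{r⋆}` and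
`(1 / sin 2θ⋆) ∂_{θ⋆}`, taken in any order, on `ℝ × (0, π/2)`, and they are continuous up to
`θ⋆ = 0` and `θ⋆ = π/2` (where the second operator is understood as a limit). -/
def IsStarC : ℕ → (ℝ → ℝ → ℝ) → Prop
  | 0, g => ContinuousUpToBoundary g
  | n + 1, g => ContinuousUpToBoundary g ∧
      (∀ x : ℝ, ∀ y ∈ Set.Ioo 0 (Real.pi / 2),
        DifferentiableAt ℝ (fun t => g t y) x ∧ DifferentiableAt ℝ (fun t => g x t) y) ∧
      IsStarC n (dR g) ∧ IsStarC n (dT g)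

/-- `C^∞` with respect to `∂_{r⋆}` and `(1 / sin 2θ⋆) ∂_{θ⋆}`. -/
def IsStarSmooth (g : ℝ → ℝ → ℝ) : Prop := ∀ n : ℕ, IsStarC n g

/-- The mixed derivative `(∂_{r⋆})^{k₁} ((1 / sin 2θ⋆) ∂_{θ⋆})^{k₂} g`. -/
def starDeriv (k₁ k₂ : ℕ) (g : ℝ → ℝ → ℝ) : ℝ → ℝ → ℝ := dR^[k₁] (dT^[k₂] g)

end KNdS

end

section

open Filter Topology MeasureTheory Set
open scoped ContDiff Interval

/-! ### Partial derivatives of functions of two real variables -/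

/-! Everything is expressed through r and l = sin² θ⋆ on the compact rectangle [rm, rp] × [0, 1].
The functions in the claim are singular-looking at θ⋆ = 0 and θ⋆ = π/2, but the substitution u = tan
θ' / tan θ⋆ turns ∫ dθ'/P into (1/a) ∫ ker(u, l) du from τ = tan θ / tan θ⋆ to 1
(`integral_inv_Phat`). The kernel is smooth for u in (0, 1] and l in [0, 1]. Hence F = 0 reads
`ellInt`(τ, l) = a · `radialInt`(r, l).

This equation has a solution τ bounded away from 0. By monotonicity it suffices to look at r = rm, l
= 0, where both sides are elementary: the claim becomes arctan(rp/a) − arctan(rm/a) < arctan(1/√κ)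
with κ = Λa²/3, and it follows from Λ rp² < 3, which the relations between the roots of Δ_r give
(`radialInt_rm_zero_lt`). The implicit function theorem makes τ smooth in a full neighbourhood of
the rectangle (`smoothOnRegion_ratio`).

At fixed θ⋆ one finds ∂r⋆/∂r = S/Δ_r with S smooth and positive (`partialFst_starR`). The term f in
ϱ is designed so that ∂ϱ/∂λ = (a²/2) F, which vanishes on F = 0. Thus ∂r⋆/∂θ⋆ is just (P/Δ_θ)
∂θ/∂θ⋆, which is sin 2θ⋆ times a smooth function of (r, l) (`partialSnd_starR`). Inverting, ∂r/∂r⋆ =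
Δ_r A and T r = Δ_r B with A, B smooth on the rectangle.

Consequently, if u = g(r, sin² θ⋆) with g smooth, then ∂_{r⋆} u and T u have the same form, with g
replaced by Δ_r A ∂₁g and by ∂₂g + Δ_r B ∂₁g. Since r, ∂θ/∂θ⋆ and L have this form, they are smooth,
and compactness bounds all derivatives. A final ∂_{r⋆} supplies the factor Δ_r. Pure T-derivatives
of r keep that factor because Δ_r does not depend on l. For θ itself one factors out sin 2θ⋆, a
constant for ∂_{r⋆}. -/

/-- Partial derivative in the first variable. -/
noncomputable def partialFst (f : ℝ × ℝ → ℝ) (z : ℝ × ℝ) : ℝ := fderiv ℝ f z (1, 0)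

/-- Partial derivative in the second variable. -/
noncomputable def partialSnd (f : ℝ × ℝ → ℝ) (z : ℝ × ℝ) : ℝ := fderiv ℝ f z (0, 1)

theorem fderiv_apply_eq_partial (f : ℝ × ℝ → ℝ) (z : ℝ × ℝ) (u v : ℝ) :
    fderiv ℝ f z (u, v) = partialFst f z * u + partialSnd f z * v := by
  have h : ((u, v) : ℝ × ℝ) = u • ((1, 0) : ℝ × ℝ) + v • ((0, 1) : ℝ × ℝ) := by
    ext <;> simp
  rw [h, map_add, map_smul, map_smul, partialFst, partialSnd]
  simp [mul_comm]

theorem DifferentiableAt.hasDerivAt_comp₂ {f : ℝ × ℝ → ℝ} {u v : ℝ → ℝ} {u' v' t : ℝ}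
    (hf : DifferentiableAt ℝ f (u t, v t)) (hu : HasDerivAt u u' t) (hv : HasDerivAt v v' t) :
    HasDerivAt (fun s => f (u s, v s))
      (partialFst f (u t, v t) * u' + partialSnd f (u t, v t) * v') t := by
  have := hf.hasFDerivAt.comp_hasDerivAt t (hu.prodMk hv)
  rwa [fderiv_apply_eq_partial] at this

theorem DifferentiableAt.hasDerivAt_partialFst {f : ℝ × ℝ → ℝ} {x y : ℝ}
    (hf : DifferentiableAt ℝ f (x, y)) : HasDerivAt (fun t => f (t, y)) (partialFst f (x, y)) x := by
  simpa using DifferentiableAt.hasDerivAt_comp₂ (u := fun t => t) (v := fun _ => y) hf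
    (hasDerivAt_id x) (hasDerivAt_const x y)

theorem DifferentiableAt.hasDerivAt_partialSnd {f : ℝ × ℝ → ℝ} {x y : ℝ}
    (hf : DifferentiableAt ℝ f (x, y)) : HasDerivAt (fun t => f (x, t)) (partialSnd f (x, y)) y := by
  simpa using DifferentiableAt.hasDerivAt_comp₂ (u := fun _ => x) (v := fun t => t) hf
    (hasDerivAt_const y x) (hasDerivAt_id y)

theorem ContDiffAt.partialFst {f : ℝ × ℝ → ℝ} {z : ℝ × ℝ} {m n : WithTop ℕ∞}
    (hf : ContDiffAt ℝ n f z) (hmn : m + 1 ≤ n) : ContDiffAt ℝ m (partialFst f) z :=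
  (hf.fderiv_right hmn).clm_apply contDiffAt_const

theorem ContDiffAt.partialSnd {f : ℝ × ℝ → ℝ} {z : ℝ × ℝ} {m n : WithTop ℕ∞}
    (hf : ContDiffAt ℝ n f z) (hmn : m + 1 ≤ n) : ContDiffAt ℝ m (partialSnd f) z :=
  (hf.fderiv_right hmn).clm_apply contDiffAt_const

/-! ### Integrals depending on a parameter and on one end point -/

/-- A tube lemma with a moving end point: the segment from z.1 to b is parametrised by t in [0, 1],
and the compactness of [0, 1] does the rest. -/
theorem eventually_forall_uIcc {p : ℝ × ℝ → Prop} {a b l : ℝ}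
    (h : ∀ x ∈ uIcc a b, ∀ᶠ w in 𝓝 (x, l), p w) :
    ∀ᶠ z in 𝓝 (a, l), ∀ x ∈ uIcc z.1 b, p (x, z.2) := by
  have key : ∀ᶠ z : ℝ × ℝ in 𝓝 (a, l), ∀ t ∈ Icc (0 : ℝ) 1, p (z.1 + t * (b - z.1), z.2) := by
    apply isCompact_Icc.eventually_forall_of_forall_eventually
    intro t ht
    have hx : a + t * (b - a) ∈ uIcc a b := by
      rw [← segment_eq_uIcc, segment_eq_image']
      exact ⟨t, ht, by simp⟩
    have hc : ContinuousAt (fun q : (ℝ × ℝ) × ℝ => (q.1.1 + q.2 * (b - q.1.1), q.1.2))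
        ((a, l), t) := by fun_prop
    exact hc.eventually (h _ hx)
  filter_upwards [key] with z hz x hx
  rw [← segment_eq_uIcc, segment_eq_image'] at hx
  obtain ⟨t, ht, rfl⟩ := hx
  simpa using hz t ht

theorem eventually_forall_uIcc_nhds {p : ℝ × ℝ → Prop} {a b l : ℝ}
    (h : ∀ x ∈ uIcc a b, ∀ᶠ w in 𝓝 (x, l), p w) :
    ∀ᶠ z in 𝓝 (a, l), ∀ x ∈ uIcc z.1 b, ∀ᶠ w in 𝓝 (x, z.2), p w :=
  eventually_forall_uIcc (p := fun w => ∀ᶠ v in 𝓝 w, p v)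
    fun x hx => eventually_eventually_nhds.2 (h x hx)

theorem exists_eventually_bound_uIcc {k : ℝ × ℝ → ℝ} {a b l : ℝ}
    (h : ∀ x ∈ uIcc a b, ContinuousAt k (x, l)) :
    ∃ C, ∀ᶠ z in 𝓝 (a, l), ∀ x ∈ uIcc z.1 b, |k (x, z.2)| ≤ C := by
  have hc : ContinuousOn (fun x => k (x, l)) (uIcc a b) := fun x hx =>
    (ContinuousAt.comp (g := k) (f := fun x => (x, l)) (h x hx) (by fun_prop)).continuousWithinAt
  obtain ⟨C, hC⟩ := isCompact_uIcc.exists_bound_of_continuousOn hc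
  refine ⟨C + 1, eventually_forall_uIcc (p := fun w => |k w| ≤ C + 1) fun x hx => ?_⟩
  have h1 : |k (x, l)| < C + 1 := by linarith [hC x hx, Real.norm_eq_abs (k (x, l))]
  exact ((h x hx).abs.eventually_lt continuousAt_const h1).mono fun _ h => h.le

theorem continuousOn_slice {k : ℝ × ℝ → ℝ} {a b l : ℝ}
    (h : ∀ x ∈ uIcc a b, ContinuousAt k (x, l)) :
    ContinuousOn (fun x => k (x, l)) (uIcc a b) := fun x hx =>
  (ContinuousAt.comp (g := k) (f := fun x => (x, l)) (h x hx) (by fun_prop)).continuousWithinAt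

/-- `(a, l) ↦ ∫ x in a..b, k (x, l)`. -/
noncomputable def paramIntegral (b : ℝ) (k : ℝ × ℝ → ℝ) (z : ℝ × ℝ) : ℝ :=
  ∫ x in z.1..b, k (x, z.2)

/-- Rescaling to the fixed interval [0, 1] moves the variable end point into the integrand, so that
dominated convergence applies. -/
theorem paramIntegral_eq (b : ℝ) (k : ℝ × ℝ → ℝ) (z : ℝ × ℝ) :
    paramIntegral b k z =
      (b - z.1) * ∫ t in (0 : ℝ)..1, k (z.1 + t * (b - z.1), z.2) := by
  have := intervalIntegral.smul_integral_comp_add_mul (a := 0) (b := 1)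
    (fun x => k (x, z.2)) (b - z.1) z.1
  simp only [smul_eq_mul, mul_zero, add_zero, mul_one, add_sub_cancel] at this
  rw [paramIntegral, ← this]
  simp only [mul_comm]

theorem add_mul_sub_mem_uIcc {a b t : ℝ} (ht : t ∈ Icc (0 : ℝ) 1) :
    a + t * (b - a) ∈ uIcc a b := by
  rw [← segment_eq_uIcc, segment_eq_image']
  exact ⟨t, ht, by simp⟩

theorem continuousAt_paramIntegral {k : ℝ × ℝ → ℝ} {a b l : ℝ}
    (h : ∀ x ∈ uIcc a b, ∀ᶠ w in 𝓝 (x, l), ContinuousAt k w) :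
    ContinuousAt (paramIntegral b k) (a, l) := by
  have e : paramIntegral b k = fun z => (b - z.1) *
      ∫ t in (0 : ℝ)..1, k (z.1 + t * (b - z.1), z.2) := funext (paramIntegral_eq b k)
  rw [e]
  refine ContinuousAt.mul (by fun_prop) ?_
  obtain ⟨C, hC⟩ := exists_eventually_bound_uIcc fun x hx => (h x hx).self_of_nhds
  have hn := eventually_forall_uIcc h
  have hsub : ∀ t ∈ Ι (0 : ℝ) 1, t ∈ Icc (0 : ℝ) 1 := fun t ht => by
    rw [uIoc_of_le zero_le_one] at ht; exact Ioc_subset_Icc_self ht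
  refine intervalIntegral.continuousAt_of_dominated_interval (bound := fun _ => C) ?_ ?_
    (by simp) ?_
  · filter_upwards [hn] with z hz
    refine ContinuousOn.aestronglyMeasurable (fun t ht => ?_) measurableSet_uIoc
    have := hz _ (add_mul_sub_mem_uIcc (hsub t ht))
    exact (ContinuousAt.comp (g := k) (f := fun t => (z.1 + t * (b - z.1), z.2)) this
      (by fun_prop)).continuousWithinAt
  · filter_upwards [hC] with z hz
    exact ae_of_all _ fun t ht => hz _ (add_mul_sub_mem_uIcc (hsub t ht))
  · refine ae_of_all _ fun t ht => ?_
    have := (h _ (add_mul_sub_mem_uIcc (b := b) (hsub t ht))).self_of_nhds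
    exact ContinuousAt.comp (g := k) (f := fun z : ℝ × ℝ => (z.1 + t * (b - z.1), z.2)) this
      (by fun_prop)

theorem hasDerivAt_paramIntegral_fst {k : ℝ × ℝ → ℝ} {a b l : ℝ}
    (h : ∀ x ∈ uIcc a b, ∀ᶠ w in 𝓝 (x, l), ContinuousAt k w) :
    HasDerivAt (fun t => paramIntegral b k (t, l)) (-k (a, l)) a := by
  have hc := continuousOn_slice fun x hx => (h x hx).self_of_nhds
  have hs : ∀ᶠ t in 𝓝 a, ContinuousAt (fun x => k (x, l)) t := by
    have : ContinuousAt (fun t : ℝ => (t, l)) a := by fun_prop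
    filter_upwards [this.eventually (h a left_mem_uIcc)] with t ht
    exact ContinuousAt.comp (g := k) (f := fun t => (t, l)) ht (by fun_prop)
  obtain ⟨U, hU, hUo, ha⟩ := eventually_nhds_iff.1 hs
  exact intervalIntegral.integral_hasDerivAt_left hc.intervalIntegrable
    (ContinuousOn.stronglyMeasurableAtFilter hUo (fun t ht => (hU t ht).continuousWithinAt) a ha)
    hs.self_of_nhds

theorem hasDerivAt_paramIntegral_snd {k : ℝ × ℝ → ℝ} {a b l : ℝ}
    (h : ∀ x ∈ uIcc a b, ContDiffAt ℝ 1 k (x, l)) :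
    HasDerivAt (fun t => paramIntegral b k (a, t)) (paramIntegral b (partialSnd k) (a, l)) l := by
  have hp : ∀ x ∈ uIcc a b, ContinuousAt (partialSnd k) (x, l) := fun x hx =>
    ((h x hx).partialSnd (m := 0) (by simp)).continuousAt
  obtain ⟨C, hC⟩ := exists_eventually_bound_uIcc hp
  have hn := eventually_forall_uIcc fun x hx => (h x hx).eventually (by simp)
  have hi : ContinuousAt (fun t : ℝ => (a, t)) l := by fun_prop
  have hC' := hi.eventually hC
  have hn' := hi.eventually hn
  have hsub : ∀ x ∈ Ι a b, x ∈ uIcc a b := fun x hx => uIoc_subset_uIcc hx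
  have hcs : ∀ᶠ t in 𝓝 l, ContinuousOn (fun x => k (x, t)) (uIcc a b) := by
    filter_upwards [hn'] with t ht
    exact continuousOn_slice fun x hx => (ht x hx).continuousAt
  refine (intervalIntegral.hasDerivAt_integral_of_dominated_loc_of_deriv_le
    (F := fun t x => k (x, t)) (F' := fun t x => partialSnd k (x, t)) (bound := fun _ => C)
    (hC'.and hn') ?_ ?_ ?_ ?_ (by simp) ?_).2
  · filter_upwards [hcs] with t ht
    exact (ht.mono uIoc_subset_uIcc).aestronglyMeasurable measurableSet_uIoc
  · exact hcs.self_of_nhds.intervalIntegrable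
  · exact ((continuousOn_slice hp).mono uIoc_subset_uIcc).aestronglyMeasurable measurableSet_uIoc
  · exact ae_of_all _ fun x hx t ht => ht.1 x (hsub x hx)
  · exact ae_of_all _ fun x hx t ht =>
      ((ht.2 x (hsub x hx)).differentiableAt (by simp)).hasDerivAt_partialSnd

theorem hasFDerivAt_paramIntegral {k : ℝ × ℝ → ℝ} {a b l : ℝ}
    (h : ∀ x ∈ uIcc a b, ContDiffAt ℝ 1 k (x, l)) :
    HasFDerivAt (paramIntegral b k)
      ((-k (a, l)) • ContinuousLinearMap.fst ℝ ℝ ℝ +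
        (paramIntegral b (partialSnd k) (a, l)) • ContinuousLinearMap.snd ℝ ℝ ℝ) (a, l) := by
  have hn : ∀ x ∈ uIcc a b, ∀ᶠ w in 𝓝 (x, l), ContDiffAt ℝ 1 k w := fun x hx =>
    (h x hx).eventually (by simp)
  have hz := eventually_forall_uIcc_nhds hn
  have h1 : ∀ᶠ v : ℝ × ℝ in 𝓝 (a, l), HasFDerivAt (fun t => paramIntegral b k (t, v.2))
      (ContinuousLinearMap.toSpanSingleton ℝ (-k v)) v.1 := by
    filter_upwards [hz] with v hv
    exact (hasDerivAt_paramIntegral_fst fun x hx => (hv x hx).mono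
      fun w hw => hw.continuousAt).hasFDerivAt
  have h2 : ∀ᶠ v : ℝ × ℝ in 𝓝 (a, l), HasFDerivAt (fun t => paramIntegral b k (v.1, t))
      (ContinuousLinearMap.toSpanSingleton ℝ (paramIntegral b (partialSnd k) v)) v.2 := by
    filter_upwards [hz] with v hv
    exact (hasDerivAt_paramIntegral_snd fun x hx => (hv x hx).self_of_nhds).hasFDerivAt
  have hk : ContinuousAt k (a, l) := (h a left_mem_uIcc).continuousAt
  have hp : ContinuousAt (paramIntegral b (partialSnd k)) (a, l) :=
    continuousAt_paramIntegral fun x hx => (hn x hx).mono fun w hw =>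
      (hw.partialSnd (m := 0) (by simp)).continuousAt
  have hts : Continuous (fun c : ℝ => ContinuousLinearMap.toSpanSingleton ℝ c) := by
    have : (fun c : ℝ => ContinuousLinearMap.toSpanSingleton ℝ c) =
        fun c : ℝ => c • ContinuousLinearMap.id ℝ ℝ := by
      ext; simp
    rw [this]; fun_prop
  have := hasStrictFDerivAt_uncurry_coprod (u := (a, l))
    (f := fun s t => paramIntegral b k (s, t))
    (f₁ := fun s t => ContinuousLinearMap.toSpanSingleton ℝ (-k (s, t)))
    (f₂ := fun s t => ContinuousLinearMap.toSpanSingleton ℝ (paramIntegral b (partialSnd k) (s, t)))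
    h1 h2 (hts.continuousAt.comp hk.neg) (hts.continuousAt.comp hp)
  refine this.hasFDerivAt.congr_fderiv ?_
  ext <;> simp [Function.HasUncurry.uncurry]

/-- The differential is built from k and the parameter integral of ∂₂k, so induction on the order
applies to ∂₂k. Each step uses up one derivative of k; the spare one in the hypothesis provides
differentiability, hence continuity, in the base case. -/
theorem contDiffAt_paramIntegral_nat (n : ℕ) : ∀ {k : ℝ × ℝ → ℝ} {a b l : ℝ},
    (∀ x ∈ uIcc a b, ContDiffAt ℝ (n + 1) k (x, l)) →
      ContDiffAt ℝ n (paramIntegral b k) (a, l) := by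
  induction n with
  | zero =>
    intro k a b l h
    have hd : ∀ᶠ z in 𝓝 (a, l), HasFDerivAt (paramIntegral b k)
      ((-k z) • ContinuousLinearMap.fst ℝ ℝ ℝ +
        (paramIntegral b (partialSnd k) z) • ContinuousLinearMap.snd ℝ ℝ ℝ) z := by
      have hz := eventually_forall_uIcc fun x hx => (h x hx).eventually (by simp)
      filter_upwards [hz] with z hz
      exact hasFDerivAt_paramIntegral fun x hx => (hz x hx).of_le (by simp)
    rw [Nat.cast_zero, contDiffAt_zero]
    exact ⟨_, hd, fun z hz => hz.continuousAt.continuousWithinAt⟩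
  | succ n ih =>
    intro k a b l h
    have hz := eventually_forall_uIcc fun x hx => (h x hx).eventually (by
      exact_mod_cast WithTop.coe_ne_top)
    rw [Nat.cast_succ, contDiffAt_succ_iff_hasFDerivAt]
    refine ⟨fun z => (-k z) • ContinuousLinearMap.fst ℝ ℝ ℝ +
        (paramIntegral b (partialSnd k) z) • ContinuousLinearMap.snd ℝ ℝ ℝ,
      ⟨_, hz, fun z hz => hasFDerivAt_paramIntegral fun x hx => (hz x hx).of_le ?_⟩, ?_⟩
    · push_cast
      exact le_add_self
    · have h1 : ContDiffAt ℝ n k (a, l) := (h a left_mem_uIcc).of_le (by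
        norm_cast; omega)
      have h2 : ContDiffAt ℝ n (paramIntegral b (partialSnd k)) (a, l) :=
        ih fun x hx => (h x hx).partialSnd (by norm_cast)
      exact (h1.neg.smul contDiffAt_const).add (h2.smul contDiffAt_const)

theorem contDiffAt_paramIntegral {k : ℝ × ℝ → ℝ} {a b l : ℝ}
    (h : ∀ x ∈ uIcc a b, ContDiffAt ℝ ∞ k (x, l)) :
    ContDiffAt ℝ ∞ (paramIntegral b k) (a, l) :=
  contDiffAt_infty.2 fun n => contDiffAt_paramIntegral_nat n fun x hx =>
    (contDiffAt_infty.1 (h x hx) (n + 1))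

theorem partialFst_paramIntegral {k : ℝ × ℝ → ℝ} {a b l : ℝ}
    (h : ∀ x ∈ uIcc a b, ContDiffAt ℝ 1 k (x, l)) :
    partialFst (paramIntegral b k) (a, l) = -k (a, l) := by
  rw [partialFst, (hasFDerivAt_paramIntegral h).fderiv]; simp

theorem partialSnd_paramIntegral {k : ℝ × ℝ → ℝ} {a b l : ℝ}
    (h : ∀ x ∈ uIcc a b, ContDiffAt ℝ 1 k (x, l)) :
    partialSnd (paramIntegral b k) (a, l) = paramIntegral b (partialSnd k) (a, l) := by
  rw [partialSnd, (hasFDerivAt_paramIntegral h).fderiv]; simp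

/-! ### Implicit functions -/

/-- If locally `Φ (t, w.2) = ψ w` forces `g w = t`, then `g` is as smooth as `Φ` and `ψ`. -/
theorem contDiffAt_of_implicit {Φ ψ g : ℝ × ℝ → ℝ} {z : ℝ × ℝ} {t : ℝ} {n : WithTop ℕ∞}
    (hn : n ≠ 0) (hΦ : ContDiffAt ℝ n Φ (t, z.2)) (hψ : ContDiffAt ℝ n ψ z)
    (hz : Φ (t, z.2) = ψ z) (hd : partialFst Φ (t, z.2) ≠ 0)
    (hg : ∀ᶠ v : (ℝ × ℝ) × ℝ in 𝓝 (z, t), Φ (v.2, v.1.2) = ψ v.1 → g v.1 = v.2) :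
    ContDiffAt ℝ n g z := by
  set H : (ℝ × ℝ) × ℝ → ℝ := fun v => Φ (v.2, v.1.2) - ψ v.1 with hH
  have hHc : ContDiffAt ℝ n H (z, t) := by
    refine ContDiffAt.sub ?_ ?_
    · exact ContDiffAt.comp (g := Φ) (f := fun v : (ℝ × ℝ) × ℝ => (v.2, v.1.2)) (z, t) hΦ
        (by fun_prop)
    · exact ContDiffAt.comp (g := ψ) (f := fun v : (ℝ × ℝ) × ℝ => v.1) (z, t) hψ (by fun_prop)
  have hHd : HasDerivAt (fun s => H (z, s)) (partialFst Φ (t, z.2)) t :=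
    ((hΦ.differentiableAt hn).hasDerivAt_partialFst).sub_const (ψ z)
  have hHf : HasDerivAt (fun s => H (z, s)) (fderiv ℝ H (z, t) (0, 1)) t :=
    (hHc.differentiableAt hn).hasFDerivAt.comp_hasDerivAt t
      ((hasDerivAt_const t z).prodMk (hasDerivAt_id t))
  have he := hHd.unique hHf
  have hinv : (fderiv ℝ H (z, t) ∘L .inr ℝ (ℝ × ℝ) ℝ).IsInvertible := by
    refine ⟨ContinuousLinearEquiv.unitsEquivAut ℝ (Units.mk0 _ hd), ?_⟩
    ext
    simp [he]
  have hcd := hHc.contDiffAt_implicitFunction hn hinv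
  refine hcd.congr_of_eventuallyEq ?_
  have h1 := hHc.eventually_apply_implicitFunction hn hinv
  have h2 := hHc.implicitFunction_apply_self hn hinv
  have h3 : ContinuousAt (fun w => (w, hHc.implicitFunction hn hinv w)) z :=
    continuousAt_id.prodMk hcd.continuousAt
  -- No continuity of `g` is assumed. The implicit function is continuous and solves the equation,
  -- and `hg` then identifies it with `g`.
  have h4 := h3.eventually (p := fun v => Φ (v.2, v.1.2) = ψ v.1 → g v.1 = v.2) (by
    simpa only [show hHc.implicitFunction hn hinv z = t from h2] using hg)
  filter_upwards [h1, h4] with w hw1 hw2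
  apply hw2
  have : H (z, t) = 0 := by simp [hH, hz]
  rw [this] at hw1
  exact sub_eq_zero.1 hw1

namespace KNdS

/-! ### The polynomial `Δ_r` -/

/-- Newton's divided differences at the known roots: each division by a nonzero difference lowers
the degree. Since Δ_r has no cubic term, the third difference says that the roots sum to zero; the
second one is the relation in the conclusion. -/
theorem Subextremal.root_relations {p : KNdS} (hp : p.Subextremal) : ∃ rn rc : ℝ, rn < 0 ∧
    p.rp < rc ∧ (∀ r, p.deltaR r = -(p.Λ / 3) * (r - rn) * (r - p.rm) * (r - p.rp) * (r - rc)) ∧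
    p.Λ / 3 * (p.rm ^ 2 + p.rp ^ 2 + rc ^ 2 + p.rm * p.rp + p.rm * rc + p.rp * rc) =
      1 - p.Λ / 3 * p.a ^ 2 := by
  obtain ⟨hΛ, ha, hm, hmp, h1, h2, rn, rc, hn, hc, h3, h4⟩ := hp
  refine ⟨rn, rc, hn, hc, ?_⟩
  unfold deltaR at *
  set x := p.rm
  set y := p.rp
  set Λ := p.Λ
  set a := p.a
  have cancel : ∀ {u v w : ℝ}, u ≠ v → (u - v) * w = 0 → w = 0 := fun h hw =>
    (mul_eq_zero.1 hw).resolve_left (sub_ne_zero.2 h)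
  have exy : -(Λ / 3) * (x ^ 3 + x ^ 2 * y + x * y ^ 2 + y ^ 3) +
      (1 - Λ / 3 * a ^ 2) * (x + y) - 2 * p.M = 0 :=
    cancel hmp.ne (by linear_combination h1 - h2)
  have exc : -(Λ / 3) * (x ^ 3 + x ^ 2 * rc + x * rc ^ 2 + rc ^ 3) +
      (1 - Λ / 3 * a ^ 2) * (x + rc) - 2 * p.M = 0 :=
    cancel (hmp.trans hc).ne (by linear_combination h1 - h4)
  have exn : -(Λ / 3) * (x ^ 3 + x ^ 2 * rn + x * rn ^ 2 + rn ^ 3) +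
      (1 - Λ / 3 * a ^ 2) * (x + rn) - 2 * p.M = 0 :=
    cancel (hn.trans hm).ne' (by linear_combination h1 - h3)
  have eyc : -(Λ / 3) * (x ^ 2 + y ^ 2 + rc ^ 2 + x * y + x * rc + y * rc) +
      (1 - Λ / 3 * a ^ 2) = 0 := cancel hc.ne (by linear_combination exy - exc)
  have eyn : -(Λ / 3) * (x ^ 2 + y ^ 2 + rn ^ 2 + x * y + x * rn + y * rn) +
      (1 - Λ / 3 * a ^ 2) = 0 :=
    cancel ((hn.trans hm).trans hmp).ne' (by linear_combination exy - exn)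
  have es : -(Λ / 3) * (x + y + rn + rc) = 0 :=
    cancel (((hn.trans hm).trans hmp).trans hc).ne' (by linear_combination eyc - eyn)
  have hs : rn = -(x + y + rc) := by
    have : -(Λ / 3) ≠ 0 := by linarith
    linarith [(mul_eq_zero.1 es).resolve_left this]
  refine ⟨fun r => ?_, by linarith⟩
  subst hs
  linear_combination h1 + (r - x) * exy + (r - x) * (r - y) * eyc

theorem Subextremal.deltaR_neg {p : KNdS} (hp : p.Subextremal) {r : ℝ}
    (hr : r ∈ Ioo p.rm p.rp) : p.deltaR r < 0 := by
  obtain ⟨rn, rc, hn, hc, h, -⟩ := hp.root_relations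
  obtain ⟨hΛ, ha, hm, -⟩ := hp
  have h1 : 0 < r - rn := by linarith [hr.1]
  have h2 : 0 < r - p.rm := by linarith [hr.1]
  have h3 : 0 < p.rp - r := by linarith [hr.2]
  have h4 : 0 < rc - r := by linarith [hr.2]
  have : 0 < p.Λ / 3 * (r - rn) * (r - p.rm) * (p.rp - r) * (rc - r) := by positivity
  rw [h]; linarith

theorem Subextremal.deltaR_nonpos {p : KNdS} (hp : p.Subextremal) {r : ℝ}
    (hr : r ∈ Icc p.rm p.rp) : p.deltaR r ≤ 0 := by
  rcases hr.1.eq_or_lt with h | h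
  · rw [← h, hp.2.2.2.2.1]
  rcases hr.2.eq_or_lt with h' | h'
  · rw [h', hp.2.2.2.2.2.1]
  · exact (hp.deltaR_neg ⟨h, h'⟩).le

/-- At most linear vanishing at both ends of [rm, rp] is what makes r⋆ diverge logarithmically
there. -/
theorem Subextremal.exists_abs_deltaR_le {p : KNdS} (hp : p.Subextremal) : ∃ C, 0 < C ∧
    ∀ r ∈ Icc p.rm p.rp, |p.deltaR r| ≤ C * (r - p.rm) ∧ |p.deltaR r| ≤ C * (p.rp - r) := by
  obtain ⟨rn, rc, hn, hc, h, -⟩ := hp.root_relations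
  obtain ⟨hΛ, ha, hm, hmp, -⟩ := hp
  have hc0 : 0 < rc := by linarith
  have hw : 0 < p.rp - rn := by linarith
  refine ⟨p.Λ / 3 * (p.rp - rn) * p.rp * rc, by have := hm.trans hmp; positivity, fun r hr => ?_⟩
  have h1 : 0 ≤ r - rn := by linarith [hr.1]
  have h2 : 0 ≤ r - p.rm := by linarith [hr.1]
  have h3 : 0 ≤ p.rp - r := by linarith [hr.2]
  have h4 : 0 ≤ rc - r := by linarith [hr.2]
  have e : |p.deltaR r| = p.Λ / 3 * (r - rn) * (r - p.rm) * (p.rp - r) * (rc - r) := by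
    have : p.deltaR r = -(p.Λ / 3 * (r - rn) * (r - p.rm) * (p.rp - r) * (rc - r)) := by
      rw [h]; ring
    rw [this, abs_neg, abs_of_nonneg (by positivity)]
  have hr0 : 0 < p.rp := hm.trans hmp
  constructor
  · calc |p.deltaR r| = p.Λ / 3 * (r - rn) * (p.rp - r) * (rc - r) * (r - p.rm) := by rw [e]; ring
      _ ≤ p.Λ / 3 * (p.rp - rn) * p.rp * rc * (r - p.rm) := by
        gcongr <;> linarith [hr.1, hr.2]
  · calc |p.deltaR r| = p.Λ / 3 * (r - rn) * (r - p.rm) * (rc - r) * (p.rp - r) := by rw [e]; ring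
      _ ≤ p.Λ / 3 * (p.rp - rn) * p.rp * rc * (p.rp - r) := by
        gcongr <;> linarith [hr.1, hr.2]

/-- The constant `κ = Λ a² / 3`. -/
noncomputable def kap (p : KNdS) : ℝ := p.Λ / 3 * p.a ^ 2

theorem Subextremal.kap_pos {p : KNdS} (hp : p.Subextremal) : 0 < p.kap := by
  have := hp.1; have := hp.2.1; unfold kap; positivity

/-- Equivalent to Λ rp² < 3, that is, to rp/a < 1/√κ; this is the inequality behind
`radialInt_rm_zero_lt`. -/
theorem Subextremal.kap_mul_sq_lt {p : KNdS} (hp : p.Subextremal) :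
    p.kap * p.rp ^ 2 < p.a ^ 2 := by
  obtain ⟨rn, rc, hn, hc, -, h⟩ := hp.root_relations
  obtain ⟨hΛ, ha, hm, hmp, -⟩ := hp
  have h0 : 0 < p.rp := hm.trans hmp
  have h1 : 0 < rc := h0.trans hc
  have h2 : p.Λ / 3 * p.rp ^ 2 < 1 := by
    have : 0 ≤ p.Λ / 3 * (p.rm ^ 2 + rc ^ 2 + p.rm * p.rp + p.rm * rc + p.rp * rc) := by positivity
    have : 0 < p.Λ / 3 * p.a ^ 2 := by positivity
    linarith
  have : 0 < p.a ^ 2 := by positivity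
  unfold kap
  nlinarith

/-- The compact set `[rm, rp] × [0, 1]` of the variables `(r, sin² θ⋆)`. -/
def region (p : KNdS) : Set (ℝ × ℝ) := Icc p.rm p.rp ×ˢ Icc 0 1

/-- Smoothness near `[rm, rp] × [0, 1]`. -/
def SmoothOnRegion (p : KNdS) (g : ℝ × ℝ → ℝ) : Prop := ∀ z ∈ p.region, ContDiffAt ℝ ∞ g z

theorem isCompact_region (p : KNdS) : IsCompact p.region := isCompact_Icc.prod isCompact_Icc

theorem contDiff_deltaR (p : KNdS) : ContDiff ℝ ∞ p.deltaR := by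
  unfold deltaR; fun_prop

/-! ### The elliptic integrals -/

/-- The argument of the square root in `Q̂` is positive. -/
theorem Subextremal.qArg_pos {p : KNdS} (hp : p.Subextremal) {s l : ℝ}
    (hs : s ∈ Icc p.rm p.rp) (hl : 0 ≤ l) :
    0 < (s ^ 2 + p.a ^ 2) ^ 2 - p.a ^ 2 * l * p.deltaR s := by
  have h1 := hp.deltaR_nonpos hs
  have ha := hp.2.1
  have : 0 ≤ p.a ^ 2 * l * -p.deltaR s := mul_nonneg (by positivity) (by linarith)
  have : 0 < (s ^ 2 + p.a ^ 2) ^ 2 := by positivity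
  linarith

theorem Subextremal.Qhat_pos {p : KNdS} (hp : p.Subextremal) {s l : ℝ}
    (hs : s ∈ Icc p.rm p.rp) (hl : 0 ≤ l) : 0 < p.Qhat s l := Real.sqrt_pos.2 (hp.qArg_pos hs hl)

theorem Subextremal.Qhat_sq {p : KNdS} (hp : p.Subextremal) {s l : ℝ}
    (hs : s ∈ Icc p.rm p.rp) (hl : 0 ≤ l) :
    p.Qhat s l ^ 2 = (s ^ 2 + p.a ^ 2) ^ 2 - p.a ^ 2 * l * p.deltaR s :=
  Real.sq_sqrt (hp.qArg_pos hs hl).le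

theorem Subextremal.contDiffAt_Qhat {p : KNdS} (hp : p.Subextremal) {s l : ℝ}
    (hs : s ∈ Icc p.rm p.rp) (hl : 0 ≤ l) :
    ContDiffAt ℝ ∞ (fun z : ℝ × ℝ => p.Qhat z.1 z.2) (s, l) := by
  unfold Qhat
  refine ContDiffAt.sqrt ?_ (hp.qArg_pos hs hl).ne'
  have := p.contDiff_deltaR
  fun_prop

/-- `1 / Q̂` as a function of two variables. -/
noncomputable def invQ (p : KNdS) (z : ℝ × ℝ) : ℝ := 1 / p.Qhat z.1 z.2

theorem Subextremal.contDiffAt_invQ {p : KNdS} (hp : p.Subextremal) {s l : ℝ}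
    (hs : s ∈ Icc p.rm p.rp) (hl : 0 ≤ l) : ContDiffAt ℝ ∞ p.invQ (s, l) :=
  contDiffAt_const.div (hp.contDiffAt_Qhat hs hl) (hp.Qhat_pos hs hl).ne'

/-- `∫_r^{rp} dr' / Q̂(r', l)`. -/
noncomputable def radialInt (p : KNdS) : ℝ × ℝ → ℝ := paramIntegral p.rp p.invQ

theorem uIcc_subset_of_mem {p : KNdS} {r : ℝ} (hr : r ∈ Icc p.rm p.rp) :
    uIcc r p.rp ⊆ Icc p.rm p.rp := by
  rw [uIcc_of_le hr.2]; exact Icc_subset_Icc_left hr.1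

theorem Subextremal.smoothOnRegion_radialInt {p : KNdS} (hp : p.Subextremal) :
    p.SmoothOnRegion p.radialInt := fun z hz =>
  contDiffAt_paramIntegral (a := z.1) (l := z.2) fun _ hx =>
    hp.contDiffAt_invQ (uIcc_subset_of_mem hz.1 hx) hz.2.1

theorem Subextremal.partialFst_radialInt {p : KNdS} (hp : p.Subextremal) {z : ℝ × ℝ}
    (hz : z ∈ p.region) : partialFst p.radialInt z = -(1 / p.Qhat z.1 z.2) :=
  partialFst_paramIntegral (a := z.1) (l := z.2) fun _ hx =>
    (hp.contDiffAt_invQ (uIcc_subset_of_mem hz.1 hx) hz.2.1).of_le (by simp)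

theorem Subextremal.continuousOn_invQ {p : KNdS} (hp : p.Subextremal) {l : ℝ} (hl : 0 ≤ l) :
    ContinuousOn (fun s => p.invQ (s, l)) (Icc p.rm p.rp) := fun s hs =>
  (ContinuousAt.comp (g := p.invQ) (f := fun s => (s, l)) (hp.contDiffAt_invQ hs hl).continuousAt
    (by fun_prop)).continuousWithinAt

theorem Subextremal.intervalIntegrable_invQ {p : KNdS} (hp : p.Subextremal) {l r s : ℝ}
    (hl : 0 ≤ l) (hr : r ∈ Icc p.rm p.rp) (hs : s ∈ Icc p.rm p.rp) :
    IntervalIntegrable (fun x => p.invQ (x, l)) volume r s :=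
  ((hp.continuousOn_invQ hl).mono (ordConnected_Icc.uIcc_subset hr hs)).intervalIntegrable

theorem Subextremal.radialInt_nonneg {p : KNdS} (hp : p.Subextremal) {z : ℝ × ℝ}
    (hz : z ∈ p.region) : 0 ≤ p.radialInt z :=
  intervalIntegral.integral_nonneg hz.1.2 fun _ hs =>
    one_div_nonneg.2 (hp.Qhat_pos ⟨hz.1.1.trans hs.1, hs.2⟩ hz.2.1).le

theorem Subextremal.radialInt_pos {p : KNdS} (hp : p.Subextremal) {r l : ℝ}
    (hr : r ∈ Ico p.rm p.rp) (hl : 0 ≤ l) : 0 < p.radialInt (r, l) :=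
  intervalIntegral.intervalIntegral_pos_of_pos_on
    (hp.intervalIntegrable_invQ hl ⟨hr.1, hr.2.le⟩ ⟨hr.1.trans hr.2.le, le_rfl⟩)
    (fun _ hs => one_div_pos.2 (hp.Qhat_pos ⟨hr.1.trans hs.1.le, hs.2.le⟩ hl)) hr.2

/-- Between the horizons Δ_r ≤ 0, so Q̂ is nondecreasing in l. -/
theorem Subextremal.radialInt_anti_snd {p : KNdS} (hp : p.Subextremal) {r l m : ℝ}
    (hr : r ∈ Icc p.rm p.rp) (hl : 0 ≤ l) (hlm : l ≤ m) :
    p.radialInt (r, m) ≤ p.radialInt (r, l) := by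
  have hp' : p.rp ∈ Icc p.rm p.rp := ⟨hr.1.trans hr.2, le_rfl⟩
  refine intervalIntegral.integral_mono_on hr.2 (hp.intervalIntegrable_invQ (hl.trans hlm) hr hp')
    (hp.intervalIntegrable_invQ hl hr hp') fun s hs => ?_
  have hs' : s ∈ Icc p.rm p.rp := ⟨hr.1.trans hs.1, hs.2⟩
  refine one_div_le_one_div_of_le (hp.Qhat_pos hs' hl) (Real.sqrt_le_sqrt ?_)
  have := hp.deltaR_nonpos hs'
  have h2 : 0 ≤ p.a ^ 2 * (m - l) * -p.deltaR s :=
    mul_nonneg (mul_nonneg (sq_nonneg _) (by linarith)) (by linarith)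
  nlinarith

theorem Subextremal.radialInt_anti_fst {p : KNdS} (hp : p.Subextremal) {r s l : ℝ}
    (hr : r ∈ Icc p.rm p.rp) (hs : s ∈ Icc p.rm p.rp) (hrs : r ≤ s) (hl : 0 ≤ l) :
    p.radialInt (s, l) ≤ p.radialInt (r, l) := by
  have hp' : p.rp ∈ Icc p.rm p.rp := ⟨hr.1.trans hr.2, le_rfl⟩
  have := intervalIntegral.integral_add_adjacent_intervals
    (hp.intervalIntegrable_invQ hl hr hs) (hp.intervalIntegrable_invQ hl hs hp')
  have h0 : 0 ≤ ∫ x in r..s, p.invQ (x, l) := intervalIntegral.integral_nonneg hrs fun x hx =>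
    one_div_nonneg.2 (hp.Qhat_pos ⟨hr.1.trans hx.1, hx.2.trans hs.2⟩ hl).le
  unfold radialInt paramIntegral
  dsimp only
  linarith

/-- The integrand of the angular elliptic integral in the variable `tan θ / tan θ⋆`. -/
noncomputable def ker (p : KNdS) (z : ℝ × ℝ) : ℝ :=
  1 / (Real.sqrt (1 - z.2 + z.2 * z.1 ^ 2) * Real.sqrt (1 + p.kap - z.1 ^ 2))

/-- The set on which `ker` is smooth. -/
def kerDom (p : KNdS) : Set (ℝ × ℝ) :=
  {z | z.1 ^ 2 < 1 + p.kap ∧ 0 < 1 - z.2 + z.2 * z.1 ^ 2}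

theorem isOpen_kerDom (p : KNdS) : IsOpen p.kerDom :=
  (isOpen_lt (f := fun z : ℝ × ℝ => z.1 ^ 2) (g := fun _ => 1 + p.kap) (by fun_prop)
    (by fun_prop)).inter (isOpen_lt (f := fun _ : ℝ × ℝ => (0 : ℝ))
      (g := fun z => 1 - z.2 + z.2 * z.1 ^ 2) (by fun_prop) (by fun_prop))

theorem ker_pos {p : KNdS} {z : ℝ × ℝ} (hz : z ∈ p.kerDom) : 0 < p.ker z :=
  one_div_pos.2 (mul_pos (Real.sqrt_pos.2 hz.2) (Real.sqrt_pos.2 (sub_pos.2 hz.1)))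

theorem contDiffAt_ker {p : KNdS} {z : ℝ × ℝ} (hz : z ∈ p.kerDom) : ContDiffAt ℝ ∞ p.ker z := by
  refine contDiffAt_const.div (ContDiffAt.mul (ContDiffAt.sqrt (by fun_prop) hz.2.ne')
    (ContDiffAt.sqrt (by fun_prop) (sub_pos.2 hz.1).ne')) ?_
  exact (mul_pos (Real.sqrt_pos.2 hz.2) (Real.sqrt_pos.2 (sub_pos.2 hz.1))).ne'

/-- The second condition is affine in x², so it holds between two points where it holds; the sign of
l decides which end point is the worse one. -/
theorem mem_kerDom_of_mem_Icc {p : KNdS} {t s x l : ℝ} (ht0 : 0 ≤ t) (ht : (t, l) ∈ p.kerDom)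
    (hs : (s, l) ∈ p.kerDom) (hx : x ∈ Icc t s) : (x, l) ∈ p.kerDom := by
  have h1 : t ^ 2 ≤ x ^ 2 := pow_le_pow_left₀ ht0 hx.1 2
  have h2 : x ^ 2 ≤ s ^ 2 := pow_le_pow_left₀ (ht0.trans hx.1) hx.2 2
  refine ⟨lt_of_le_of_lt h2 hs.1, ?_⟩
  have e1 := ht.2
  have e2 := hs.2
  dsimp only at *
  rcases le_total 0 l with h | h
  · nlinarith [mul_le_mul_of_nonneg_left h1 h]
  · nlinarith [mul_le_mul_of_nonpos_left h2 h]

theorem mem_kerDom_of_mem_uIcc {p : KNdS} {t s x l : ℝ} (ht0 : 0 ≤ t) (hs0 : 0 ≤ s)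
    (ht : (t, l) ∈ p.kerDom) (hs : (s, l) ∈ p.kerDom) (hx : x ∈ uIcc t s) :
    (x, l) ∈ p.kerDom := by
  rcases le_total t s with h | h
  · rw [uIcc_of_le h] at hx; exact mem_kerDom_of_mem_Icc ht0 ht hs hx
  · rw [uIcc_of_ge h] at hx; exact mem_kerDom_of_mem_Icc hs0 hs ht hx

theorem Subextremal.one_mem_kerDom {p : KNdS} (hp : p.Subextremal) (l : ℝ) :
    ((1 : ℝ), l) ∈ p.kerDom := ⟨by have := hp.kap_pos; simp [this], by simp⟩

/-- At l = 1 the second condition is t² > 0. This is why τ must stay away from 0 if smoothness is to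
reach θ⋆ = π/2. -/
theorem Subextremal.mem_kerDom {p : KNdS} (hp : p.Subextremal) {t l : ℝ}
    (ht : t ∈ Ioc (0 : ℝ) 1) (hl : l ≤ 1) : (t, l) ∈ p.kerDom := by
  have h1 : t ^ 2 ≤ 1 := pow_le_one₀ ht.1.le ht.2
  have h2 : 0 < t ^ 2 := pow_pos ht.1 2
  refine ⟨by have := hp.kap_pos; dsimp only; linarith, ?_⟩
  dsimp only
  rcases le_total 0 l with h | h
  · nlinarith
  · nlinarith

theorem Subextremal.zero_mem_kerDom {p : KNdS} (hp : p.Subextremal) {l : ℝ} (hl : l < 1) :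
    ((0 : ℝ), l) ∈ p.kerDom := by
  refine ⟨by have := hp.kap_pos; simp; linarith, by simpa using hl⟩

/-- The elliptic integral `∫_τ^1 ker(x, l) dx`. -/
noncomputable def ellInt (p : KNdS) : ℝ × ℝ → ℝ := paramIntegral 1 p.ker

theorem Subextremal.contDiffAt_ellInt {p : KNdS} (hp : p.Subextremal) {t l : ℝ} (ht : 0 ≤ t)
    (h : (t, l) ∈ p.kerDom) : ContDiffAt ℝ ∞ p.ellInt (t, l) :=
  contDiffAt_paramIntegral fun _ hx =>
    contDiffAt_ker (mem_kerDom_of_mem_uIcc ht zero_le_one h (hp.one_mem_kerDom l) hx)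

theorem Subextremal.partialFst_ellInt {p : KNdS} (hp : p.Subextremal) {t l : ℝ} (ht : 0 ≤ t)
    (h : (t, l) ∈ p.kerDom) : partialFst p.ellInt (t, l) = -p.ker (t, l) :=
  partialFst_paramIntegral fun _ hx => (contDiffAt_ker
    (mem_kerDom_of_mem_uIcc ht zero_le_one h (hp.one_mem_kerDom l) hx)).of_le (by simp)

theorem intervalIntegrable_ker {p : KNdS} {t s l : ℝ} (ht0 : 0 ≤ t) (hs0 : 0 ≤ s)
    (ht : (t, l) ∈ p.kerDom) (hs : (s, l) ∈ p.kerDom) :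
    IntervalIntegrable (fun x => p.ker (x, l)) volume t s :=
  (continuousOn_slice fun _ hx =>
    (contDiffAt_ker (mem_kerDom_of_mem_uIcc ht0 hs0 ht hs hx)).continuousAt).intervalIntegrable

theorem Subextremal.ellInt_lt {p : KNdS} (hp : p.Subextremal) {t s l : ℝ} (ht0 : 0 ≤ t)
    (hts : t < s) (ht : (t, l) ∈ p.kerDom) (hs : (s, l) ∈ p.kerDom) :
    p.ellInt (s, l) < p.ellInt (t, l) := by
  have hs0 := ht0.trans hts.le
  have := intervalIntegral.integral_add_adjacent_intervals
    (intervalIntegrable_ker ht0 hs0 ht hs)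
    (intervalIntegrable_ker hs0 zero_le_one hs (hp.one_mem_kerDom l))
  have h0 : 0 < ∫ x in t..s, p.ker (x, l) :=
    intervalIntegral.intervalIntegral_pos_of_pos_on (intervalIntegrable_ker ht0 hs0 ht hs)
      (fun x hx => ker_pos (mem_kerDom_of_mem_Icc ht0 ht hs ⟨hx.1.le, hx.2.le⟩)) hts
  unfold ellInt paramIntegral
  dsimp only
  linarith

theorem Subextremal.ellInt_inj {p : KNdS} (hp : p.Subextremal) {t s l : ℝ} (ht0 : 0 ≤ t)
    (hs0 : 0 ≤ s) (ht : (t, l) ∈ p.kerDom) (hs : (s, l) ∈ p.kerDom)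
    (h : p.ellInt (t, l) = p.ellInt (s, l)) : t = s := by
  rcases lt_trichotomy t s with h' | h' | h'
  · exact absurd h (hp.ellInt_lt ht0 h' ht hs).ne'
  · exact h'
  · exact absurd h (hp.ellInt_lt hs0 h' hs ht).ne

theorem ellInt_one (p : KNdS) (l : ℝ) : p.ellInt (1, l) = 0 := by
  simp [ellInt, paramIntegral]

/-- For x ≤ 1 the expression 1 − l(1 − x²) decreases in l, so the kernel increases. -/
theorem Subextremal.ellInt_mono_snd {p : KNdS} (hp : p.Subextremal) {t l m : ℝ}
    (ht : t ∈ Ioc (0 : ℝ) 1) (hlm : l ≤ m) (hm : m ≤ 1) :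
    p.ellInt (t, l) ≤ p.ellInt (t, m) := by
  refine intervalIntegral.integral_mono_on ht.2
    (intervalIntegrable_ker ht.1.le zero_le_one (hp.mem_kerDom ht (hlm.trans hm))
      (hp.one_mem_kerDom l))
    (intervalIntegrable_ker ht.1.le zero_le_one (hp.mem_kerDom ht hm)
      (hp.one_mem_kerDom m)) fun x hx => ?_
  have hx' : x ∈ Ioc (0 : ℝ) 1 := ⟨ht.1.trans_le hx.1, hx.2⟩
  have h1 := hp.mem_kerDom hx' (hlm.trans hm)
  have h2 := hp.mem_kerDom hx' hm
  refine one_div_le_one_div_of_le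
    (mul_pos (Real.sqrt_pos.2 h2.2) (Real.sqrt_pos.2 (sub_pos.2 h2.1))) ?_
  refine mul_le_mul_of_nonneg_right (Real.sqrt_le_sqrt ?_) (Real.sqrt_nonneg _)
  have : x ^ 2 ≤ 1 := pow_le_one₀ hx'.1.le hx'.2
  dsimp only
  nlinarith

/-- At l = 0 the kernel is 1/√(1 + κ − x²), with primitive arcsin(x/√(1 + κ)). The value is also
arctan(1/√κ). -/
theorem Subextremal.ellInt_zero_zero {p : KNdS} (hp : p.Subextremal) :
    p.ellInt (0, 0) = Real.arcsin (1 / Real.sqrt (1 + p.kap)) := by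
  have hk := hp.kap_pos
  have hc : 0 < Real.sqrt (1 + p.kap) := Real.sqrt_pos.2 (by linarith)
  have hc2 : Real.sqrt (1 + p.kap) ^ 2 = 1 + p.kap := Real.sq_sqrt (by linarith)
  have hc1 : 1 < Real.sqrt (1 + p.kap) := by nlinarith
  have key := intervalIntegral.integral_eq_sub_of_hasDerivAt (a := 0) (b := 1)
    (f := fun x => Real.arcsin (x / Real.sqrt (1 + p.kap))) (f' := fun x => p.ker (x, 0))
    (fun x hx => ?_) (intervalIntegrable_ker le_rfl zero_le_one (hp.zero_mem_kerDom one_pos)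
      (hp.one_mem_kerDom 0))
  · simpa [ellInt, paramIntegral] using key
  · rw [uIcc_of_le zero_le_one] at hx
    have hlt : x / Real.sqrt (1 + p.kap) < 1 := by
      rw [div_lt_one hc]; linarith [hx.2]
    have hge : 0 ≤ x / Real.sqrt (1 + p.kap) := div_nonneg hx.1 hc.le
    have h := (Real.hasDerivAt_arcsin (x := x / Real.sqrt (1 + p.kap)) (by linarith) hlt.ne).comp x
      ((hasDerivAt_id x).div_const (Real.sqrt (1 + p.kap)))
    refine h.congr_deriv ?_
    have e : 1 - (x / Real.sqrt (1 + p.kap)) ^ 2 = (1 + p.kap - x ^ 2) / (1 + p.kap) := by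
      rw [div_pow, hc2]; field_simp
    rw [e, Real.sqrt_div' _ (by linarith), ker]
    simp only [sub_zero, zero_mul, add_zero, Real.sqrt_one, one_mul]
    field_simp

/-- At l = 0 one has Q̂ = s² + a², so the left side is arctan(rp/a) − arctan(rm/a). Strictness comes
from rm > 0, and arctan(rp/a) is controlled by κ rp² < a². -/
theorem Subextremal.radialInt_rm_zero_lt {p : KNdS} (hp : p.Subextremal) :
    p.a * p.radialInt (p.rm, 0) < p.ellInt (0, 0) := by
  have hk := hp.kap_pos
  have hkr := hp.kap_mul_sq_lt
  have ha := hp.2.1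
  have hm := hp.2.2.1
  have hmp := hp.2.2.2.1
  have key := intervalIntegral.integral_eq_sub_of_hasDerivAt (a := p.rm) (b := p.rp)
    (f := fun s => Real.arctan (s / p.a) / p.a) (f' := fun s => p.invQ (s, 0))
    (fun s hs => ?_) (hp.intervalIntegrable_invQ le_rfl ⟨le_rfl, hmp.le⟩ ⟨hmp.le, le_rfl⟩)
  · have e : p.a * p.radialInt (p.rm, 0) =
        Real.arctan (p.rp / p.a) - Real.arctan (p.rm / p.a) := by
      rw [radialInt, paramIntegral, key]; field_simp
    have h0 : 0 < Real.arctan (p.rm / p.a) := by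
      rw [Real.arctan_pos]; positivity
    rw [e, hp.ellInt_zero_zero]
    have h1 : Real.arctan (p.rp / p.a) ≤ Real.arcsin (1 / Real.sqrt (1 + p.kap)) := by
      rw [Real.arctan_eq_arcsin]
      apply Real.arcsin_le_arcsin
      have hr : 0 < p.rp := hm.trans hmp
      have hs1 : 0 < Real.sqrt (1 + (p.rp / p.a) ^ 2) := Real.sqrt_pos.2 (by positivity)
      have hs2 : 0 < Real.sqrt (1 + p.kap) := Real.sqrt_pos.2 (by positivity)
      rw [div_le_div_iff₀ hs1 hs2, one_mul]
      apply Real.le_sqrt_of_sq_le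
      rw [mul_pow, Real.sq_sqrt (by positivity), div_pow]
      have : p.rp ^ 2 / p.a ^ 2 * p.kap < 1 := by
        rw [div_mul_eq_mul_div, div_lt_one (by positivity)]; linarith
      linarith
    linarith
  · have h := ((Real.hasDerivAt_arctan (s / p.a)).comp s
      ((hasDerivAt_id s).div_const p.a)).div_const p.a
    refine h.congr_deriv ?_
    have : Real.sqrt ((s ^ 2 + p.a ^ 2) ^ 2) = s ^ 2 + p.a ^ 2 := Real.sqrt_sq (by positivity)
    simp only [invQ, Qhat, mul_zero, zero_mul, sub_zero, this]
    field_simp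
    ring

/-! ### The ratio `tan θ / tan θ⋆` -/

/-- Continuity at τ = 0 turns the strict inequality there into one at some t0 > 0; this t0 is the
uniform lower bound for τ. -/
theorem Subextremal.exists_ratio_lower_bound {p : KNdS} (hp : p.Subextremal) :
    ∃ t0 ∈ Ioo (0 : ℝ) 1, p.a * p.radialInt (p.rm, 0) < p.ellInt (t0, 0) := by
  have hc : ContinuousAt (fun t => p.ellInt (t, 0)) 0 :=
    ContinuousAt.comp (g := p.ellInt) (f := fun t => (t, 0))
      (hp.contDiffAt_ellInt le_rfl (hp.zero_mem_kerDom one_pos)).continuousAt (by fun_prop)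
  have h1 : ∀ᶠ t in 𝓝[>] (0 : ℝ), p.a * p.radialInt (p.rm, 0) < p.ellInt (t, 0) :=
    (hc.eventually (lt_mem_nhds hp.radialInt_rm_zero_lt)).filter_mono nhdsWithin_le_nhds
  obtain ⟨t, ht1, ht2⟩ := (h1.and (Ioo_mem_nhdsGT one_pos)).exists
  exact ⟨t, ht2, ht1⟩

/-- The equation that defines `tan θ / tan θ⋆` has a solution, bounded away from zero. -/
theorem Subextremal.exists_ratio {p : KNdS} (hp : p.Subextremal) : ∃ t0 ∈ Ioo (0 : ℝ) 1,
    ∀ z ∈ p.region, ∃ t ∈ Icc t0 1, p.ellInt (t, z.2) = p.a * p.radialInt z := by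
  obtain ⟨t0, ht0, h⟩ := hp.exists_ratio_lower_bound
  refine ⟨t0, ht0, fun z hz => ?_⟩
  have hrm : p.rm ∈ Icc p.rm p.rp := ⟨le_rfl, hp.2.2.2.1.le⟩
  have ha := hp.2.1
  -- The monotonicity properties reduce every point of the rectangle to the extremal one (rm, 0).
  have h1 : p.a * p.radialInt z ≤ p.ellInt (t0, z.2) := by
    calc p.a * p.radialInt z ≤ p.a * p.radialInt (z.1, 0) :=
          mul_le_mul_of_nonneg_left (hp.radialInt_anti_snd hz.1 le_rfl hz.2.1) ha.le
      _ ≤ p.a * p.radialInt (p.rm, 0) :=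
          mul_le_mul_of_nonneg_left (hp.radialInt_anti_fst hrm hz.1 hz.1.1 le_rfl) ha.le
      _ ≤ p.ellInt (t0, 0) := h.le
      _ ≤ p.ellInt (t0, z.2) := hp.ellInt_mono_snd ⟨ht0.1, ht0.2.le⟩ hz.2.1 hz.2.2
  have hc : ContinuousOn (fun t => p.ellInt (t, z.2)) (Icc t0 1) := fun t ht =>
    (ContinuousAt.comp (g := p.ellInt) (f := fun t => (t, z.2))
      (hp.contDiffAt_ellInt (ht0.1.le.trans ht.1)
        (hp.mem_kerDom ⟨ht0.1.trans_le ht.1, ht.2⟩ hz.2.2)).continuousAt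
      (by fun_prop)).continuousWithinAt
  obtain ⟨t, ht, e⟩ := intermediate_value_Icc' ht0.2.le hc
    (show p.a * p.radialInt z ∈ Icc _ _ from
      ⟨by rw [ellInt_one]; exact mul_nonneg ha.le (hp.radialInt_nonneg hz), h1⟩)
  exact ⟨t, ht, e⟩

/-- The ratio `τ = tan θ / tan θ⋆` as a function of `(r, sin² θ⋆)`. -/
noncomputable def ratio (p : KNdS) (z : ℝ × ℝ) : ℝ :=
  Classical.epsilon fun t : ℝ =>
    0 < t ∧ (t, z.2) ∈ p.kerDom ∧ p.ellInt (t, z.2) = p.a * p.radialInt z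

/-- Uniqueness holds among all t > 0 in the open set `kerDom`, not only in (0, 1]. Hence `ratio` is
determined by the equation also near boundary points of the rectangle, for instance at r = rp, where
τ = 1. -/
theorem Subextremal.ratio_eq {p : KNdS} (hp : p.Subextremal) {z : ℝ × ℝ} {t : ℝ} (ht : 0 < t)
    (hd : (t, z.2) ∈ p.kerDom) (h : p.ellInt (t, z.2) = p.a * p.radialInt z) : p.ratio z = t := by
  have := Classical.epsilon_spec (p := fun t : ℝ =>
    0 < t ∧ (t, z.2) ∈ p.kerDom ∧ p.ellInt (t, z.2) = p.a * p.radialInt z) ⟨t, ht, hd, h⟩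
  exact hp.ellInt_inj this.1.le ht.le this.2.1 hd (this.2.2.trans h.symm)

theorem Subextremal.exists_ratio_mem {p : KNdS} (hp : p.Subextremal) : ∃ t0 ∈ Ioo (0 : ℝ) 1,
    ∀ z ∈ p.region, p.ratio z ∈ Icc t0 1 := by
  obtain ⟨t0, ht0, h⟩ := hp.exists_ratio
  refine ⟨t0, ht0, fun z hz => ?_⟩
  obtain ⟨t, ht, e⟩ := h z hz
  rwa [hp.ratio_eq (ht0.1.trans_le ht.1) (hp.mem_kerDom ⟨ht0.1.trans_le ht.1, ht.2⟩ hz.2.2) e]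

theorem Subextremal.ratio_mem {p : KNdS} (hp : p.Subextremal) {z : ℝ × ℝ} (hz : z ∈ p.region) :
    p.ratio z ∈ Ioc (0 : ℝ) 1 := by
  obtain ⟨t0, ht0, h⟩ := hp.exists_ratio_mem
  exact ⟨ht0.1.trans_le (h z hz).1, (h z hz).2⟩

theorem Subextremal.ratio_mem_kerDom {p : KNdS} (hp : p.Subextremal) {z : ℝ × ℝ}
    (hz : z ∈ p.region) : (p.ratio z, z.2) ∈ p.kerDom :=
  hp.mem_kerDom (hp.ratio_mem hz) hz.2.2

theorem Subextremal.ellInt_ratio {p : KNdS} (hp : p.Subextremal) {z : ℝ × ℝ}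
    (hz : z ∈ p.region) : p.ellInt (p.ratio z, z.2) = p.a * p.radialInt z := by
  obtain ⟨t0, ht0, h⟩ := hp.exists_ratio
  obtain ⟨t, ht, e⟩ := h z hz
  rwa [hp.ratio_eq (ht0.1.trans_le ht.1) (hp.mem_kerDom ⟨ht0.1.trans_le ht.1, ht.2⟩ hz.2.2) e]

/-- The implicit function theorem applies because the τ-derivative of `ellInt` is −`ker`, which does
not vanish. -/
theorem Subextremal.smoothOnRegion_ratio {p : KNdS} (hp : p.Subextremal) :
    p.SmoothOnRegion p.ratio := by
  intro z hz
  have h1 := hp.ratio_mem hz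
  have h2 := hp.ratio_mem_kerDom hz
  refine contDiffAt_of_implicit (Φ := p.ellInt) (ψ := fun z => p.a * p.radialInt z) (by simp)
    (hp.contDiffAt_ellInt h1.1.le h2) (contDiffAt_const.mul (hp.smoothOnRegion_radialInt z hz))
    (hp.ellInt_ratio hz) ?_ ?_
  · rw [hp.partialFst_ellInt h1.1.le h2]
    exact neg_ne_zero.2 (ker_pos h2).ne'
  · have c1 : ContinuousAt (fun v : (ℝ × ℝ) × ℝ => (v.2, v.1.2)) (z, p.ratio z) := by fun_prop
    have c2 : ContinuousAt (fun v : (ℝ × ℝ) × ℝ => v.2) (z, p.ratio z) := by fun_prop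
    filter_upwards [c1.eventually (p.isOpen_kerDom.mem_nhds h2), c2.eventually (lt_mem_nhds h1.1)]
      with v hv1 hv2 hv
    exact hp.ratio_eq hv2 hv1 hv

/-! ### Trigonometric identities for `tan θ = τ tan θ⋆` -/

theorem cos_pos_of_mem {y : ℝ} (hy : y ∈ Ico 0 (Real.pi / 2)) : 0 < Real.cos y :=
  Real.cos_pos_of_mem_Ioo ⟨by linarith [hy.1, Real.pi_pos], hy.2⟩

theorem sin_pos_of_mem {y : ℝ} (hy : y ∈ Ioo 0 (Real.pi / 2)) : 0 < Real.sin y :=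
  Real.sin_pos_of_pos_of_lt_pi hy.1 (by linarith [hy.2, Real.pi_pos])

theorem sin_two_mul_pos {y : ℝ} (hy : y ∈ Ioo 0 (Real.pi / 2)) : 0 < Real.sin (2 * y) :=
  Real.sin_pos_of_pos_of_lt_pi (by linarith [hy.1]) (by linarith [hy.2])

theorem sin_sq_mem_Ioo {y : ℝ} (hy : y ∈ Ioo 0 (Real.pi / 2)) :
    Real.sin y ^ 2 ∈ Ioo (0 : ℝ) 1 := by
  have h1 := sin_pos_of_mem hy
  have h2 := cos_pos_of_mem ⟨hy.1.le, hy.2⟩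
  have h3 := Real.sin_sq_add_cos_sq y
  exact ⟨by positivity, by nlinarith⟩

theorem cos_sq_of_tan_eq {x y t : ℝ} (hx : Real.cos x ≠ 0) (hy : Real.cos y ≠ 0)
    (h : Real.tan x = t * Real.tan y) :
    Real.cos x ^ 2 * (1 - Real.sin y ^ 2 + Real.sin y ^ 2 * t ^ 2) = Real.cos y ^ 2 := by
  rw [Real.tan_eq_sin_div_cos, Real.tan_eq_sin_div_cos] at h
  field_simp at h
  have h1 := Real.sin_sq_add_cos_sq x
  have h2 := Real.sin_sq_add_cos_sq y
  have h3 : (Real.sin x * Real.cos y) ^ 2 = (Real.cos x * t * Real.sin y) ^ 2 := by rw [h]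
  linear_combination -Real.cos x ^ 2 * h2 + Real.cos y ^ 2 * h1 - h3

theorem sin_sq_of_tan_eq {x y t : ℝ} (hx : Real.cos x ≠ 0) (hy : Real.cos y ≠ 0)
    (h : Real.tan x = t * Real.tan y) :
    Real.sin x ^ 2 * (1 - Real.sin y ^ 2 + Real.sin y ^ 2 * t ^ 2) = Real.sin y ^ 2 * t ^ 2 := by
  have h1 := cos_sq_of_tan_eq hx hy h
  have h2 := Real.sin_sq_add_cos_sq x
  have h3 := Real.sin_sq_add_cos_sq y
  linear_combination (1 - Real.sin y ^ 2 + Real.sin y ^ 2 * t ^ 2) * h2 - h1 - h3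

/-- `P = sin 2θ⋆ · amp(τ, sin² θ⋆)` where `τ = tan θ / tan θ⋆`. -/
noncomputable def amp (p : KNdS) (z : ℝ × ℝ) : ℝ :=
  p.a / 2 * Real.sqrt (1 + p.kap - z.1 ^ 2) / Real.sqrt (1 - z.2 + z.2 * z.1 ^ 2)

/-- The factor (sin θ⋆ cos θ⋆)² splits off and the rest depends on θ⋆ only through τ and sin² θ⋆.
This is the origin of every sin 2θ⋆ carried by P. -/
theorem Phat_arg_eq (p : KNdS) {x y t : ℝ} (hx : Real.cos x ≠ 0) (hy : Real.cos y ≠ 0)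
    (h : Real.tan x = t * Real.tan y) (hd : (t, Real.sin y ^ 2) ∈ p.kerDom) :
    Real.sin y ^ 2 * p.deltaTheta x - Real.sin x ^ 2 =
      (Real.sin y * Real.cos y) ^ 2 * (1 + p.kap - t ^ 2) /
        (1 - Real.sin y ^ 2 + Real.sin y ^ 2 * t ^ 2) := by
  rw [eq_div_iff hd.2.ne']
  have h1 := cos_sq_of_tan_eq hx hy h
  have h2 := sin_sq_of_tan_eq hx hy h
  have h3 := Real.sin_sq_add_cos_sq y
  unfold deltaTheta kap
  linear_combination Real.sin y ^ 2 * (p.Λ / 3 * p.a ^ 2) * h1 - h2 +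
    (Real.sin y ^ 2 * t ^ 2 - Real.sin y ^ 2) * h3

theorem Phat_eq_amp (p : KNdS) {x y t : ℝ} (hx : Real.cos x ≠ 0) (hy : y ∈ Ioo 0 (Real.pi / 2))
    (h : Real.tan x = t * Real.tan y) (hd : (t, Real.sin y ^ 2) ∈ p.kerDom) :
    p.Phat x (Real.sin y ^ 2) = Real.sin (2 * y) * p.amp (t, Real.sin y ^ 2) := by
  have hs := sin_pos_of_mem hy
  have hc := cos_pos_of_mem ⟨hy.1.le, hy.2⟩
  rw [Phat, Phat_arg_eq p hx hc.ne' h hd, Real.sqrt_div' _ hd.2.le,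
    Real.sqrt_mul (sq_nonneg _), Real.sqrt_sq (by positivity), Real.sin_two_mul, amp]
  ring

theorem amp_pos {p : KNdS} (ha : 0 < p.a) {z : ℝ × ℝ} (hz : z ∈ p.kerDom) : 0 < p.amp z :=
  div_pos (mul_pos (by linarith) (Real.sqrt_pos.2 (sub_pos.2 hz.1))) (Real.sqrt_pos.2 hz.2)

theorem contDiffAt_amp {p : KNdS} {z : ℝ × ℝ} (hz : z ∈ p.kerDom) : ContDiffAt ℝ ∞ p.amp z :=
  ContDiffAt.div (contDiffAt_const.mul (ContDiffAt.sqrt (by fun_prop) (sub_pos.2 hz.1).ne'))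
    (ContDiffAt.sqrt (by fun_prop) hz.2.ne') (Real.sqrt_pos.2 hz.2).ne'

theorem amp_mul_ker (p : KNdS) {z : ℝ × ℝ} (hz : z ∈ p.kerDom) :
    p.amp z * p.ker z * (1 - z.2 + z.2 * z.1 ^ 2) = p.a / 2 := by
  have h1 := Real.sqrt_pos.2 hz.2
  have h2 := Real.sqrt_pos.2 (sub_pos.2 hz.1)
  have h3 := Real.sq_sqrt hz.2.le
  rw [amp, ker]
  generalize 1 - z.2 + z.2 * z.1 ^ 2 = w at *
  nth_rewrite 3 [← h3]
  field_simp

/-! ### The substitution `u = tan θ / tan θ⋆` -/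

theorem tan_div_mem_Icc {x y : ℝ} (hx : x ∈ Icc 0 y) (hy : y ∈ Ioo 0 (Real.pi / 2)) :
    Real.tan x / Real.tan y ∈ Icc (0 : ℝ) 1 := by
  have h := Real.tan_pos_of_pos_of_lt_pi_div_two hy.1 hy.2
  refine ⟨div_nonneg (Real.tan_nonneg_of_nonneg_of_le_pi_div_two hx.1 (hx.2.trans hy.2.le)) h.le,
    (div_le_one h).2 ?_⟩
  exact Real.strictMonoOn_tan.monotoneOn ⟨by linarith [hx.1, Real.pi_pos], hx.2.trans_lt hy.2⟩
    ⟨by linarith [hy.1, Real.pi_pos], hy.2⟩ hx.2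

theorem Subextremal.mem_kerDom_Icc {p : KNdS} (hp : p.Subextremal) {t l : ℝ}
    (ht : t ∈ Icc (0 : ℝ) 1) (hl : l < 1) : (t, l) ∈ p.kerDom :=
  mem_kerDom_of_mem_Icc le_rfl (hp.zero_mem_kerDom hl) (hp.one_mem_kerDom l) ht

theorem Subextremal.Phat_pos {p : KNdS} (hp : p.Subextremal) {x y : ℝ} (hx : x ∈ Icc 0 y)
    (hy : y ∈ Ioo 0 (Real.pi / 2)) : 0 < p.Phat x (Real.sin y ^ 2) := by
  have ht := Real.tan_pos_of_pos_of_lt_pi_div_two hy.1 hy.2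
  have hd := hp.mem_kerDom_Icc (tan_div_mem_Icc hx hy) (sin_sq_mem_Ioo hy).2
  rw [Phat_eq_amp p (cos_pos_of_mem ⟨hx.1, hx.2.trans_lt hy.2⟩).ne' hy
    (div_mul_cancel₀ _ ht.ne').symm hd]
  exact mul_pos (sin_two_mul_pos hy) (amp_pos hp.2.1 hd)

theorem Subextremal.Phat_arg_pos {p : KNdS} (hp : p.Subextremal) {x y : ℝ} (hx : x ∈ Icc 0 y)
    (hy : y ∈ Ioo 0 (Real.pi / 2)) :
    0 < Real.sin y ^ 2 * p.deltaTheta x - Real.sin x ^ 2 := by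
  have := hp.Phat_pos hx hy
  exact Real.sqrt_pos.1 (pos_of_mul_pos_right this hp.2.1.le)

theorem Subextremal.contDiffAt_Phat {p : KNdS} (hp : p.Subextremal) {x y : ℝ} (hx : x ∈ Icc 0 y)
    (hy : y ∈ Ioo 0 (Real.pi / 2)) :
    ContDiffAt ℝ ∞ (fun z : ℝ × ℝ => p.Phat z.1 z.2) (x, Real.sin y ^ 2) := by
  unfold Phat
  refine contDiffAt_const.mul (ContDiffAt.sqrt ?_ (hp.Phat_arg_pos hx hy).ne')
  unfold deltaTheta
  have h1 : ContDiff ℝ ∞ Real.sin := Real.contDiff_sin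
  have h2 : ContDiff ℝ ∞ Real.cos := Real.contDiff_cos
  fun_prop

theorem Subextremal.continuousOn_inv_Phat {p : KNdS} (hp : p.Subextremal) {y : ℝ}
    (hy : y ∈ Ioo 0 (Real.pi / 2)) :
    ContinuousOn (fun x => 1 / p.Phat x (Real.sin y ^ 2)) (Icc 0 y) := by
  refine ContinuousOn.div continuousOn_const (fun x hx => ?_) fun x hx => (hp.Phat_pos hx hy).ne'
  exact (ContinuousAt.comp (g := fun z : ℝ × ℝ => p.Phat z.1 z.2)
    (f := fun x => (x, Real.sin y ^ 2)) (hp.contDiffAt_Phat hx hy).continuousAt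
    (by fun_prop)).continuousWithinAt

/-- Substitute u = tan s / tan y, so du = ds / (cos² s tan y). The factor sin 2y in P̂ cancels
against the Jacobian, which leaves a kernel regular at both ends of the range of θ⋆. -/
theorem Subextremal.integral_inv_Phat {p : KNdS} (hp : p.Subextremal) {x y : ℝ}
    (hx : x ∈ Icc 0 y) (hy : y ∈ Ioo 0 (Real.pi / 2)) :
    ∫ s in x..y, 1 / p.Phat s (Real.sin y ^ 2) =
      p.ellInt (Real.tan x / Real.tan y, Real.sin y ^ 2) / p.a := by
  have ha := hp.2.1
  have ht := Real.tan_pos_of_pos_of_lt_pi_div_two hy.1 hy.2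
  have hs := sin_pos_of_mem hy
  have hc := cos_pos_of_mem ⟨hy.1.le, hy.2⟩
  have hsub : ∀ s ∈ uIcc x y, s ∈ Icc 0 y := fun s hs => by
    rw [uIcc_of_le hx.2] at hs; exact ⟨hx.1.trans hs.1, hs.2⟩
  have hcos : ∀ s ∈ uIcc x y, Real.cos s ≠ 0 := fun s hs =>
    (cos_pos_of_mem ⟨(hsub s hs).1, (hsub s hs).2.trans_lt hy.2⟩).ne'
  have key := intervalIntegral.integral_comp_mul_deriv' (a := x) (b := y)
    (f := fun s => Real.tan s / Real.tan y) (f' := fun s => 1 / Real.cos s ^ 2 / Real.tan y)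
    (g := fun u => p.ker (u, Real.sin y ^ 2))
    (fun s hs => (Real.hasDerivAt_tan (hcos s hs)).div_const _)
    (ContinuousOn.div_const (ContinuousOn.div continuousOn_const
      (Real.continuous_cos.pow 2).continuousOn fun s hs => pow_ne_zero 2 (hcos s hs)) _) ?_
  · rw [div_self ht.ne'] at key
    rw [ellInt, paramIntegral, ← key, ← intervalIntegral.integral_div]
    refine intervalIntegral.integral_congr fun s hs' => ?_
    have hd := hp.mem_kerDom_Icc (tan_div_mem_Icc (hsub s hs') hy) (sin_sq_mem_Ioo hy).2
    have htan : Real.tan s = Real.tan s / Real.tan y * Real.tan y := (div_mul_cancel₀ _ ht.ne').symm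
    have e1 := amp_mul_ker p hd
    have e2 := cos_sq_of_tan_eq (hcos s hs') hc.ne' htan
    have hA := amp_pos ha hd
    dsimp only at e1 ⊢
    rw [Phat_eq_amp p (hcos s hs') hy htan hd, Function.comp_apply, Real.sin_two_mul]
    have hc' := hcos s hs'
    set A := p.amp (Real.tan s / Real.tan y, Real.sin y ^ 2)
    set k := p.ker (Real.tan s / Real.tan y, Real.sin y ^ 2)
    set w := 1 - Real.sin y ^ 2 + Real.sin y ^ 2 * (Real.tan s / Real.tan y) ^ 2
    have e3 : A * k * Real.cos y ^ 2 = p.a / 2 * Real.cos s ^ 2 := by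
      rw [← e2, ← e1]; ring
    rw [Real.tan_eq_sin_div_cos y]
    field_simp
    linear_combination (-2) * e3
  · rintro _ ⟨s, hs', rfl⟩
    have hd := hp.mem_kerDom_Icc (tan_div_mem_Icc (hsub s hs') hy) (sin_sq_mem_Ioo hy).2
    exact (ContinuousAt.comp (g := p.ker) (f := fun u => (u, Real.sin y ^ 2))
      (contDiffAt_ker hd).continuousAt (by fun_prop)).continuousWithinAt

theorem Subextremal.F_eq {p : KNdS} (hp : p.Subextremal) (r : ℝ) {x y : ℝ}
    (hx : x ∈ Icc 0 y) (hy : y ∈ Ioo 0 (Real.pi / 2)) :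
    p.F r x y = p.radialInt (r, Real.sin y ^ 2) -
      p.ellInt (Real.tan x / Real.tan y, Real.sin y ^ 2) / p.a := by
  rw [← hp.integral_inv_Phat hx hy, intervalIntegral.integral_symm]
  simp only [F, P, Q, radialInt, paramIntegral, invQ]
  ring

theorem Subextremal.fPrime_eq {p : KNdS} (hp : p.Subextremal) {l : ℝ} (hl : l ∈ Ioo (0 : ℝ) 1) :
    p.fPrime l = -(p.ellInt (0, l) / p.a) := by
  set y := Real.arcsin (Real.sqrt l) with hy
  have h0 : 0 < Real.sqrt l := Real.sqrt_pos.2 hl.1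
  have h1 : Real.sqrt l < 1 := by rw [Real.sqrt_lt' one_pos]; simpa using hl.2
  have hs : Real.sin y ^ 2 = l := by
    rw [hy, Real.sin_arcsin (by linarith) h1.le, Real.sq_sqrt hl.1.le]
  have hy' : y ∈ Ioo 0 (Real.pi / 2) :=
    ⟨Real.arcsin_pos.2 h0, Real.arcsin_lt_pi_div_two.2 h1⟩
  have := hp.integral_inv_Phat ⟨le_rfl, hy'.1.le⟩ hy'
  rw [hs, Real.tan_zero, zero_div] at this
  rw [fPrime, ← hy, this]

/-! ### The function `θ⋆` -/

theorem mk_mem_region {p : KNdS} {r y : ℝ} (hr : r ∈ Icc p.rm p.rp)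
    (hy : y ∈ Ioo 0 (Real.pi / 2)) : (r, Real.sin y ^ 2) ∈ p.region :=
  ⟨hr, (sin_sq_mem_Ioo hy).1.le, (sin_sq_mem_Ioo hy).2.le⟩

theorem Subextremal.F_eq_zero_iff {p : KNdS} (hp : p.Subextremal) {r x y : ℝ}
    (hr : r ∈ Icc p.rm p.rp) (hx : x ∈ Ioc 0 y) (hy : y ∈ Ioo 0 (Real.pi / 2)) :
    p.F r x y = 0 ↔ Real.tan x = p.ratio (r, Real.sin y ^ 2) * Real.tan y := by
  have ht := Real.tan_pos_of_pos_of_lt_pi_div_two hy.1 hy.2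
  have ht' := Real.tan_pos_of_pos_of_lt_pi_div_two hx.1 (hx.2.trans_lt hy.2)
  have hz := mk_mem_region hr hy
  have hd := hp.mem_kerDom_Icc (tan_div_mem_Icc ⟨hx.1.le, hx.2⟩ hy) (sin_sq_mem_Ioo hy).2
  have ha := hp.2.1
  rw [hp.F_eq r ⟨hx.1.le, hx.2⟩ hy, ← div_eq_iff ht.ne', sub_eq_zero]
  constructor
  · intro h
    refine (hp.ratio_eq (div_pos ht' ht) hd ?_).symm
    rw [h]; field_simp
  · intro h
    rw [h, hp.ellInt_ratio hz]
    field_simp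

/-- All effects of raising θ⋆ have the same sign: the radial integral does not grow, the lower limit
tan x / tan θ⋆ drops, and the elliptic kernel does not decrease with l. This gives uniqueness of θ⋆.
-/
theorem Subextremal.F_lt_F {p : KNdS} (hp : p.Subextremal) {r x y₁ y₂ : ℝ}
    (hr : r ∈ Icc p.rm p.rp) (hx : 0 < x) (hxy : x ≤ y₁) (h12 : y₁ < y₂)
    (hy : y₂ < Real.pi / 2) : p.F r x y₂ < p.F r x y₁ := by
  have hy₁ : y₁ ∈ Ioo 0 (Real.pi / 2) := ⟨hx.trans_le hxy, h12.trans hy⟩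
  have hy₂ : y₂ ∈ Ioo 0 (Real.pi / 2) := ⟨hy₁.1.trans h12, hy⟩
  have ha := hp.2.1
  have hx1 : x ∈ Icc 0 y₁ := ⟨hx.le, hxy⟩
  have hx2 : x ∈ Icc 0 y₂ := ⟨hx.le, hxy.trans h12.le⟩
  rw [hp.F_eq r hx1 hy₁, hp.F_eq r hx2 hy₂]
  have hl : Real.sin y₁ ^ 2 ≤ Real.sin y₂ ^ 2 := by
    have := Real.sin_lt_sin_of_lt_of_le_pi_div_two (by linarith [hy₁.1, Real.pi_pos]) hy.le h12
    exact pow_le_pow_left₀ (sin_pos_of_mem hy₁).le this.le 2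
  have hJ := hp.radialInt_anti_snd hr (sq_nonneg (Real.sin y₁)) hl
  have ht1 := Real.tan_pos_of_pos_of_lt_pi_div_two hy₁.1 hy₁.2
  have ht2 := Real.tan_pos_of_pos_of_lt_pi_div_two hy₂.1 hy₂.2
  have htx := Real.tan_pos_of_pos_of_lt_pi_div_two hx (hxy.trans_lt hy₁.2)
  have htt := Real.tan_lt_tan_of_nonneg_of_lt_pi_div_two hy₁.1.le hy h12
  have hq : Real.tan x / Real.tan y₂ < Real.tan x / Real.tan y₁ :=
    div_lt_div_of_pos_left htx ht1 htt
  have m1 := tan_div_mem_Icc hx1 hy₁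
  have m2 := tan_div_mem_Icc hx2 hy₂
  have h1 := hp.ellInt_mono_snd (t := Real.tan x / Real.tan y₁) ⟨div_pos htx ht1, m1.2⟩ hl
    (sin_sq_mem_Ioo hy₂).2.le
  have h2 := hp.ellInt_lt m2.1 hq (hp.mem_kerDom_Icc m2 (sin_sq_mem_Ioo hy₂).2)
    (hp.mem_kerDom_Icc m1 (sin_sq_mem_Ioo hy₂).2)
  have := div_lt_div_of_pos_right (h1.trans_lt h2) ha
  linarith

theorem Subextremal.continuousAt_ratio_sin_sq {p : KNdS} (hp : p.Subextremal) {r y : ℝ}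
    (hr : r ∈ Icc p.rm p.rp) (hy : y ∈ Ioo 0 (Real.pi / 2)) :
    ContinuousAt (fun y => p.ratio (r, Real.sin y ^ 2)) y :=
  ContinuousAt.comp (g := p.ratio) (f := fun y => (r, Real.sin y ^ 2))
    (hp.smoothOnRegion_ratio _ (mk_mem_region hr hy)).continuousAt (by fun_prop)

theorem Subextremal.exists_thetaStar {p : KNdS} (hp : p.Subextremal) {r x : ℝ}
    (hr : r ∈ Icc p.rm p.rp) (hx : x ∈ Ioo 0 (Real.pi / 2)) :
    ∃ y ∈ Ico x (Real.pi / 2), p.F r x y = 0 := by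
  obtain ⟨t0, ht0, hρ⟩ := hp.exists_ratio_mem
  have htx := Real.tan_pos_of_pos_of_lt_pi_div_two hx.1 hx.2
  -- Since τ ≥ t0, the function τ tan y has reached tan x by the time tan y = tan x / t0; this upper
  -- end stays below π/2.
  set Y := Real.arctan (Real.tan x / t0) with hYdef
  have hxY : x ≤ Y := by
    rw [hYdef, ← Real.arctan_tan (by linarith [hx.1, Real.pi_pos]) hx.2]
    apply Real.arctan_mono
    rw [Real.arctan_tan (by linarith [hx.1, Real.pi_pos]) hx.2]
    exact le_div_self htx.le ht0.1 ht0.2.le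
  have hY : Y < Real.pi / 2 := Real.arctan_lt_pi_div_two _
  have hsub : ∀ y ∈ Icc x Y, y ∈ Ioo 0 (Real.pi / 2) := fun y hy =>
    ⟨hx.1.trans_le hy.1, hy.2.trans_lt hY⟩
  have hc : ContinuousOn (fun y => p.ratio (r, Real.sin y ^ 2) * Real.tan y) (Icc x Y) :=
    fun y hy => ((hp.continuousAt_ratio_sin_sq hr (hsub y hy)).mul
      (Real.continuousAt_tan.2 (cos_pos_of_mem
        ⟨(hsub y hy).1.le, (hsub y hy).2⟩).ne')).continuousWithinAt
  have hmem : Real.tan x ∈ Icc (p.ratio (r, Real.sin x ^ 2) * Real.tan x)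
      (p.ratio (r, Real.sin Y ^ 2) * Real.tan Y) := by
    refine ⟨mul_le_of_le_one_left htx.le (hp.ratio_mem (mk_mem_region hr hx)).2, ?_⟩
    have h1 := (hρ _ (mk_mem_region hr (hsub Y ⟨hxY, le_rfl⟩))).1
    have h2 : t0 * Real.tan Y = Real.tan x := by
      rw [hYdef, Real.tan_arctan]; field_simp [ht0.1.ne']
    rw [← h2]
    exact mul_le_mul_of_nonneg_right h1
      (Real.tan_pos_of_pos_of_lt_pi_div_two (hx.1.trans_le hxY) hY).le
  obtain ⟨y, hy, e⟩ := intermediate_value_Icc hxY hc hmem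
  exact ⟨y, ⟨hy.1, hy.2.trans_lt hY⟩, (hp.F_eq_zero_iff hr ⟨hx.1, hy.1⟩ (hsub y hy)).2 e.symm⟩

theorem Subextremal.thetaStar_spec {p : KNdS} (hp : p.Subextremal) {r x : ℝ}
    (hr : r ∈ Icc p.rm p.rp) (hx : x ∈ Ioo 0 (Real.pi / 2)) :
    p.thetaStar r x ∈ Ico x (Real.pi / 2) ∧ p.F r x (p.thetaStar r x) = 0 :=
  Classical.epsilon_spec (p := fun y : ℝ => y ∈ Ico x (Real.pi / 2) ∧ p.F r x y = 0)
    (hp.exists_thetaStar hr hx)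

theorem Subextremal.thetaStar_eq_iff {p : KNdS} (hp : p.Subextremal) {r x y : ℝ}
    (hr : r ∈ Icc p.rm p.rp) (hx : x ∈ Ioo 0 (Real.pi / 2)) (hy : y ∈ Ioo 0 (Real.pi / 2)) :
    p.thetaStar r x = y ↔ Real.tan x = p.ratio (r, Real.sin y ^ 2) * Real.tan y := by
  obtain ⟨h1, h2⟩ := hp.thetaStar_spec hr hx
  constructor
  · rintro rfl
    exact (hp.F_eq_zero_iff hr ⟨hx.1, h1.1⟩ hy).1 h2
  · intro h
    have hty := Real.tan_pos_of_pos_of_lt_pi_div_two hy.1 hy.2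
    have hxy : x ≤ y := by
      have : Real.tan x ≤ Real.tan y := by
        rw [h]; exact mul_le_of_le_one_left hty.le (hp.ratio_mem (mk_mem_region hr hy)).2
      by_contra! hlt
      exact absurd (Real.tan_lt_tan_of_nonneg_of_lt_pi_div_two hy.1.le hx.2 hlt) this.not_gt
    have h3 := (hp.F_eq_zero_iff hr ⟨hx.1, hxy⟩ hy).2 h
    rcases lt_trichotomy (p.thetaStar r x) y with h' | h' | h'
    · have := hp.F_lt_F hr hx.1 h1.1 h' hy.2
      linarith
    · exact h'
    · have := hp.F_lt_F hr hx.1 hxy h' h1.2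
      linarith

/-- `θ` as a function of `(r, θ⋆)`. -/
noncomputable def ang (p : KNdS) (r y : ℝ) : ℝ :=
  Real.arctan (p.ratio (r, Real.sin y ^ 2) * Real.tan y)

theorem Subextremal.ang_mem {p : KNdS} (hp : p.Subextremal) {r y : ℝ}
    (hr : r ∈ Icc p.rm p.rp) (hy : y ∈ Ioo 0 (Real.pi / 2)) :
    p.ang r y ∈ Ioc 0 y := by
  have hty := Real.tan_pos_of_pos_of_lt_pi_div_two hy.1 hy.2
  have hρ := hp.ratio_mem (mk_mem_region hr hy)
  refine ⟨Real.arctan_pos.2 (mul_pos hρ.1 hty), ?_⟩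
  calc p.ang r y ≤ Real.arctan (Real.tan y) :=
        Real.arctan_mono (mul_le_of_le_one_left hty.le hρ.2)
    _ = y := Real.arctan_tan (by linarith [hy.1, Real.pi_pos]) hy.2

theorem tan_ang (p : KNdS) (r y : ℝ) :
    Real.tan (p.ang r y) = p.ratio (r, Real.sin y ^ 2) * Real.tan y := Real.tan_arctan _

theorem Subextremal.ang_mem' {p : KNdS} (hp : p.Subextremal) {r y : ℝ}
    (hr : r ∈ Icc p.rm p.rp) (hy : y ∈ Ioo 0 (Real.pi / 2)) :
    p.ang r y ∈ Ioo 0 (Real.pi / 2) :=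
  ⟨(hp.ang_mem hr hy).1, (hp.ang_mem hr hy).2.trans_lt hy.2⟩

theorem Subextremal.thetaStar_ang {p : KNdS} (hp : p.Subextremal) {r y : ℝ}
    (hr : r ∈ Icc p.rm p.rp) (hy : y ∈ Ioo 0 (Real.pi / 2)) :
    p.thetaStar r (p.ang r y) = y :=
  (hp.thetaStar_eq_iff hr (hp.ang_mem' hr hy) hy).2 (p.tan_ang r y)

theorem Subextremal.eq_ang_of_thetaStar {p : KNdS} (hp : p.Subextremal) {r x : ℝ}
    (hr : r ∈ Icc p.rm p.rp) (hx : x ∈ Ioo 0 (Real.pi / 2)) :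
    x = p.ang r (p.thetaStar r x) ∧ p.thetaStar r x ∈ Ioo 0 (Real.pi / 2) := by
  obtain ⟨h1, -⟩ := hp.thetaStar_spec hr hx
  have hy : p.thetaStar r x ∈ Ioo 0 (Real.pi / 2) := ⟨hx.1.trans_le h1.1, h1.2⟩
  refine ⟨?_, hy⟩
  rw [ang, ← (hp.thetaStar_eq_iff hr hx hy).1 rfl,
    Real.arctan_tan (by linarith [hx.1, Real.pi_pos]) hx.2]

/-! ### Coefficient functions of `(r, sin² θ⋆)` -/

/-- The denominator `1 - l + l τ²`, where `τ = tan θ / tan θ⋆`. -/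
noncomputable def ratioDen (p : KNdS) (z : ℝ × ℝ) : ℝ := 1 - z.2 + z.2 * p.ratio z ^ 2

/-- `sin² θ` as a function of `(r, sin² θ⋆)`. -/
noncomputable def sinSqTheta (p : KNdS) (z : ℝ × ℝ) : ℝ := z.2 * p.ratio z ^ 2 / p.ratioDen z

/-- `Δ_θ` as a function of `(r, sin² θ⋆)`. -/
noncomputable def deltaThetaOf (p : KNdS) (z : ℝ × ℝ) : ℝ :=
  1 + p.kap * ((1 - z.2) / p.ratioDen z)

/-- `P / sin 2θ⋆` as a function of `(r, sin² θ⋆)`. -/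
noncomputable def ampOf (p : KNdS) (z : ℝ × ℝ) : ℝ := p.amp (p.ratio z, z.2)

/-- `Δ_r ∂r⋆/∂r` (at constant `θ⋆`) as a function of `(r, sin² θ⋆)`. -/
noncomputable def radialSlope (p : KNdS) (z : ℝ × ℝ) : ℝ :=
  ((z.1 ^ 2 + p.a ^ 2) ^ 2 * p.deltaThetaOf z - p.a ^ 2 * p.sinSqTheta z * p.deltaR z.1) /
    (p.Qhat z.1 z.2 * p.deltaThetaOf z)

/-- `∂θ/∂θ⋆`, given the derivative `d` of `τ` with respect to `sin² θ⋆`. -/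
noncomputable def angSlope (p : KNdS) (d : ℝ) (z : ℝ × ℝ) : ℝ :=
  (2 * z.2 * (1 - z.2) * d + p.ratio z) / p.ratioDen z

/-- The function `A` in `∂r/∂r⋆ = Δ_r A`. -/
noncomputable def coefR (p : KNdS) (z : ℝ × ℝ) : ℝ := 1 / p.radialSlope z

/-- The function `B` in `T r = Δ_r B`. -/
noncomputable def coefT (p : KNdS) (z : ℝ × ℝ) : ℝ :=
  -(p.ampOf z * p.angSlope (partialSnd p.ratio z) z * p.coefR z / p.deltaThetaOf z)

theorem Subextremal.ratioDen_pos {p : KNdS} (hp : p.Subextremal) {z : ℝ × ℝ}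
    (hz : z ∈ p.region) : 0 < p.ratioDen z := (hp.ratio_mem_kerDom hz).2

theorem Subextremal.deltaThetaOf_pos {p : KNdS} (hp : p.Subextremal) {z : ℝ × ℝ}
    (hz : z ∈ p.region) : 0 < p.deltaThetaOf z := by
  have h1 := hp.ratioDen_pos hz
  have h2 : 0 ≤ 1 - z.2 := by linarith [hz.2.2]
  have := hp.kap_pos
  unfold deltaThetaOf; positivity

theorem Subextremal.ampOf_pos {p : KNdS} (hp : p.Subextremal) {z : ℝ × ℝ}
    (hz : z ∈ p.region) : 0 < p.ampOf z := amp_pos hp.2.1 (hp.ratio_mem_kerDom hz)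

/-- Because Δ_r ≤ 0 on [rm, rp], both terms of the numerator are nonnegative and the first is
positive, even at the horizons. -/
theorem Subextremal.radialSlope_pos {p : KNdS} (hp : p.Subextremal) {z : ℝ × ℝ}
    (hz : z ∈ p.region) : 0 < p.radialSlope z := by
  have h1 := hp.ratioDen_pos hz
  have h2 := hp.deltaThetaOf_pos hz
  have h3 := hp.Qhat_pos hz.1 hz.2.1
  have h4 := hp.deltaR_nonpos hz.1
  have h5 : 0 ≤ p.sinSqTheta z := div_nonneg (mul_nonneg hz.2.1 (sq_nonneg _)) h1.le
  have ha := hp.2.1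
  refine div_pos ?_ (mul_pos h3 h2)
  have h6 : 0 ≤ p.a ^ 2 * p.sinSqTheta z * -p.deltaR z.1 :=
    mul_nonneg (mul_nonneg (sq_nonneg _) h5) (by linarith)
  have h7 : 0 < (z.1 ^ 2 + p.a ^ 2) ^ 2 * p.deltaThetaOf z := by positivity
  linarith

theorem Subextremal.smoothOnRegion_ratioDen {p : KNdS} (hp : p.Subextremal) :
    p.SmoothOnRegion p.ratioDen := fun z hz => by
  have := hp.smoothOnRegion_ratio z hz
  unfold ratioDen
  fun_prop

theorem Subextremal.smoothOnRegion_sinSqTheta {p : KNdS} (hp : p.Subextremal) :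
    p.SmoothOnRegion p.sinSqTheta := fun z hz => by
  have := hp.smoothOnRegion_ratio z hz
  exact ContDiffAt.div (by fun_prop) (hp.smoothOnRegion_ratioDen z hz) (hp.ratioDen_pos hz).ne'

theorem Subextremal.smoothOnRegion_deltaThetaOf {p : KNdS} (hp : p.Subextremal) :
    p.SmoothOnRegion p.deltaThetaOf := fun z hz =>
  contDiffAt_const.add (contDiffAt_const.mul
    (ContDiffAt.div (by fun_prop) (hp.smoothOnRegion_ratioDen z hz) (hp.ratioDen_pos hz).ne'))

theorem Subextremal.smoothOnRegion_ampOf {p : KNdS} (hp : p.Subextremal) :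
    p.SmoothOnRegion p.ampOf := fun z hz =>
  ContDiffAt.comp (g := p.amp) (f := fun z => (p.ratio z, z.2)) z
    (contDiffAt_amp (hp.ratio_mem_kerDom hz)) ((hp.smoothOnRegion_ratio z hz).prodMk contDiffAt_snd)

theorem Subextremal.smoothOnRegion_Qhat {p : KNdS} (hp : p.Subextremal) :
    p.SmoothOnRegion fun z => p.Qhat z.1 z.2 := fun _ hz => hp.contDiffAt_Qhat hz.1 hz.2.1

theorem smoothOnRegion_deltaR (p : KNdS) : p.SmoothOnRegion fun z => p.deltaR z.1 := fun _ _ =>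
  (p.contDiff_deltaR.comp contDiff_fst).contDiffAt

theorem Subextremal.smoothOnRegion_radialSlope {p : KNdS} (hp : p.Subextremal) :
    p.SmoothOnRegion p.radialSlope := fun z hz => by
  have h1 := hp.smoothOnRegion_deltaThetaOf z hz
  have h2 := hp.smoothOnRegion_sinSqTheta z hz
  have h3 := p.smoothOnRegion_deltaR z hz
  have h4 := hp.smoothOnRegion_Qhat z hz
  exact ContDiffAt.div (by fun_prop) (h4.mul h1)
    (mul_pos (hp.Qhat_pos hz.1 hz.2.1) (hp.deltaThetaOf_pos hz)).ne'

theorem Subextremal.smoothOnRegion_coefR {p : KNdS} (hp : p.Subextremal) :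
    p.SmoothOnRegion p.coefR := fun z hz =>
  contDiffAt_const.div (hp.smoothOnRegion_radialSlope z hz) (hp.radialSlope_pos hz).ne'

theorem Subextremal.smoothOnRegion_angSlope {p : KNdS} (hp : p.Subextremal) {d : ℝ × ℝ → ℝ}
    (hd : p.SmoothOnRegion d) : p.SmoothOnRegion fun z => p.angSlope (d z) z := fun z hz => by
  have h1 := hp.smoothOnRegion_ratio z hz
  have h2 := hd z hz
  exact ContDiffAt.div (by fun_prop) (hp.smoothOnRegion_ratioDen z hz) (hp.ratioDen_pos hz).ne'

theorem SmoothOnRegion.partialFst {p : KNdS} {g : ℝ × ℝ → ℝ} (hg : p.SmoothOnRegion g) :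
    p.SmoothOnRegion (partialFst g) := fun z hz => (hg z hz).partialFst (by simp)

theorem SmoothOnRegion.partialSnd {p : KNdS} {g : ℝ × ℝ → ℝ} (hg : p.SmoothOnRegion g) :
    p.SmoothOnRegion (partialSnd g) := fun z hz => (hg z hz).partialSnd (by simp)

theorem SmoothOnRegion.differentiableAt {p : KNdS} {g : ℝ × ℝ → ℝ} (hg : p.SmoothOnRegion g)
    {z : ℝ × ℝ} (hz : z ∈ p.region) : DifferentiableAt ℝ g z :=
  (hg z hz).differentiableAt (by simp)

theorem Subextremal.smoothOnRegion_coefT {p : KNdS} (hp : p.Subextremal) :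
    p.SmoothOnRegion p.coefT := fun z hz =>
  ((((hp.smoothOnRegion_ampOf z hz).mul (hp.smoothOnRegion_angSlope
    hp.smoothOnRegion_ratio.partialSnd z hz)).mul (hp.smoothOnRegion_coefR z hz)).div
      (hp.smoothOnRegion_deltaThetaOf z hz) (hp.deltaThetaOf_pos hz).ne').neg

/-! ### The angle `θ(r, θ⋆)` -/

theorem Subextremal.cos_ang_pos {p : KNdS} (hp : p.Subextremal) {r y : ℝ}
    (hr : r ∈ Icc p.rm p.rp) (hy : y ∈ Ioo 0 (Real.pi / 2)) : 0 < Real.cos (p.ang r y) :=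
  cos_pos_of_mem ⟨(hp.ang_mem' hr hy).1.le, (hp.ang_mem' hr hy).2⟩

theorem Subextremal.sin_sq_ang {p : KNdS} (hp : p.Subextremal) {r y : ℝ}
    (hr : r ∈ Icc p.rm p.rp) (hy : y ∈ Ioo 0 (Real.pi / 2)) :
    Real.sin (p.ang r y) ^ 2 = p.sinSqTheta (r, Real.sin y ^ 2) := by
  rw [sinSqTheta, eq_div_iff (hp.ratioDen_pos (mk_mem_region hr hy)).ne']
  exact sin_sq_of_tan_eq (hp.cos_ang_pos hr hy).ne' (cos_pos_of_mem ⟨hy.1.le, hy.2⟩).ne'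
    (p.tan_ang r y)

theorem Subextremal.deltaTheta_ang {p : KNdS} (hp : p.Subextremal) {r y : ℝ}
    (hr : r ∈ Icc p.rm p.rp) (hy : y ∈ Ioo 0 (Real.pi / 2)) :
    p.deltaTheta (p.ang r y) = p.deltaThetaOf (r, Real.sin y ^ 2) := by
  have h := cos_sq_of_tan_eq (hp.cos_ang_pos hr hy).ne' (cos_pos_of_mem ⟨hy.1.le, hy.2⟩).ne'
    (p.tan_ang r y)
  have hw := (hp.ratioDen_pos (mk_mem_region hr hy)).ne'
  have e : Real.cos (p.ang r y) ^ 2 =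
      (1 - Real.sin y ^ 2) / p.ratioDen (r, Real.sin y ^ 2) := by
    rw [eq_div_iff hw, ← Real.cos_sq']
    exact h
  rw [deltaTheta, deltaThetaOf, e, kap]

theorem Subextremal.Phat_ang {p : KNdS} (hp : p.Subextremal) {r y : ℝ}
    (hr : r ∈ Icc p.rm p.rp) (hy : y ∈ Ioo 0 (Real.pi / 2)) :
    p.Phat (p.ang r y) (Real.sin y ^ 2) =
      Real.sin (2 * y) * p.ampOf (r, Real.sin y ^ 2) :=
  Phat_eq_amp p (hp.cos_ang_pos hr hy).ne' hy (p.tan_ang r y)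
    (hp.ratio_mem_kerDom (mk_mem_region hr hy))

theorem hasDerivAt_sin_sq (y : ℝ) :
    HasDerivAt (fun y => Real.sin y ^ 2) (Real.sin (2 * y)) y := by
  refine ((Real.hasDerivAt_sin y).pow 2).congr_deriv ?_
  rw [Real.sin_two_mul]; simp

/-- The derivative of `arctan (τ tan y)` along a curve on which `τ` varies with slope
`sin (2 y) * d`. -/
theorem hasDerivAt_arctan_mul_tan {τ : ℝ → ℝ} {d y : ℝ} (hy : y ∈ Ioo 0 (Real.pi / 2))
    (hτ : HasDerivAt τ (Real.sin (2 * y) * d) y) :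
    HasDerivAt (fun s => Real.arctan (τ s * Real.tan s))
      ((2 * Real.sin y ^ 2 * (1 - Real.sin y ^ 2) * d + τ y) /
        (1 - Real.sin y ^ 2 + Real.sin y ^ 2 * τ y ^ 2)) y := by
  have hc := (cos_pos_of_mem ⟨hy.1.le, hy.2⟩)
  have h := (hτ.mul (Real.hasDerivAt_tan hc.ne')).arctan
  refine h.congr_deriv ?_
  have e : 1 - Real.sin y ^ 2 = Real.cos y ^ 2 := (Real.cos_sq' y).symm
  rw [e]
  simp only [Pi.mul_apply]
  rw [Real.tan_eq_sin_div_cos, Real.sin_two_mul]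
  have h2 : 1 + (τ y * (Real.sin y / Real.cos y)) ^ 2 =
      (Real.cos y ^ 2 + Real.sin y ^ 2 * τ y ^ 2) / Real.cos y ^ 2 := by
    field_simp
  rw [h2]
  field_simp

theorem Subextremal.hasDerivAt_ratio_snd {p : KNdS} (hp : p.Subextremal) {r y : ℝ}
    (hr : r ∈ Icc p.rm p.rp) (hy : y ∈ Ioo 0 (Real.pi / 2)) :
    HasDerivAt (fun y => p.ratio (r, Real.sin y ^ 2))
      (Real.sin (2 * y) * partialSnd p.ratio (r, Real.sin y ^ 2)) y := by
  have := DifferentiableAt.hasDerivAt_comp₂ (u := fun _ => r) (v := fun y => Real.sin y ^ 2)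
    (hp.smoothOnRegion_ratio.differentiableAt (mk_mem_region hr hy)) (hasDerivAt_const y r)
    (hasDerivAt_sin_sq y)
  refine this.congr_deriv ?_
  ring

theorem Subextremal.hasDerivAt_ang_snd {p : KNdS} (hp : p.Subextremal) {r y : ℝ}
    (hr : r ∈ Icc p.rm p.rp) (hy : y ∈ Ioo 0 (Real.pi / 2)) :
    HasDerivAt (fun y => p.ang r y)
      (p.angSlope (partialSnd p.ratio (r, Real.sin y ^ 2)) (r, Real.sin y ^ 2)) y :=
  hasDerivAt_arctan_mul_tan hy (hp.hasDerivAt_ratio_snd hr hy)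

/-- Differentiate the defining equation of τ in r. -/
theorem Subextremal.partialFst_ratio {p : KNdS} (hp : p.Subextremal) {r l : ℝ}
    (hr : r ∈ Ioo p.rm p.rp) (hl : l ∈ Icc (0 : ℝ) 1) :
    p.ker (p.ratio (r, l), l) * partialFst p.ratio (r, l) = p.a / p.Qhat r l := by
  have hz : (r, l) ∈ p.region := ⟨Ioo_subset_Icc_self hr, hl⟩
  have hρ := hp.ratio_mem hz
  have hd := hp.ratio_mem_kerDom hz
  have h1 : HasDerivAt (fun t => p.ellInt (p.ratio (t, l), l))
      (-p.ker (p.ratio (r, l), l) * partialFst p.ratio (r, l)) r := by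
    have := DifferentiableAt.hasDerivAt_comp₂ (f := p.ellInt) (u := fun t => p.ratio (t, l))
      (v := fun _ => l) ((hp.contDiffAt_ellInt hρ.1.le hd).differentiableAt (by simp))
      (hp.smoothOnRegion_ratio.differentiableAt hz).hasDerivAt_partialFst (hasDerivAt_const r l)
    rw [hp.partialFst_ellInt hρ.1.le hd] at this
    simpa using this
  have h2 : HasDerivAt (fun t => p.a * p.radialInt (t, l)) (p.a * -(1 / p.Qhat r l)) r := by
    have := (hp.smoothOnRegion_radialInt.differentiableAt hz).hasDerivAt_partialFst
    rw [hp.partialFst_radialInt hz] at this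
    exact this.const_mul _
  have he : (fun t => p.ellInt (p.ratio (t, l), l)) =ᶠ[𝓝 r] fun t => p.a * p.radialInt (t, l) := by
    filter_upwards [Ioo_mem_nhds hr.1 hr.2] with t ht
    exact hp.ellInt_ratio (z := (t, l)) ⟨Ioo_subset_Icc_self ht, hl⟩
  have := h1.unique (h2.congr_of_eventuallyEq he)
  linear_combination -this

/-- In terms of P and Q this is ∂θ/∂r = P/Q at fixed θ⋆, as one expects from F = 0; here it is
derived through τ. -/
theorem Subextremal.hasDerivAt_ang_fst {p : KNdS} (hp : p.Subextremal) {r y : ℝ}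
    (hr : r ∈ Ioo p.rm p.rp) (hy : y ∈ Ioo 0 (Real.pi / 2)) :
    HasDerivAt (fun r => p.ang r y)
      (Real.sin (2 * y) * p.ampOf (r, Real.sin y ^ 2) / p.Qhat r (Real.sin y ^ 2)) r := by
  have hr' := Ioo_subset_Icc_self hr
  have hz := mk_mem_region hr' hy
  have hd := hp.ratio_mem_kerDom hz
  have hc := (cos_pos_of_mem ⟨hy.1.le, hy.2⟩)
  have h := ((hp.smoothOnRegion_ratio.differentiableAt hz).hasDerivAt_partialFst.mul_const
    (Real.tan y)).arctan
  refine h.congr_deriv ?_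
  have hQ := hp.Qhat_pos hr' hz.2.1
  have e1 := hp.partialFst_ratio hr hz.2
  have e2 := amp_mul_ker p hd
  have hk := ker_pos hd
  have hA := hp.ampOf_pos hz
  have hw := hp.ratioDen_pos hz
  rw [ampOf] at hA ⊢
  rw [ratioDen] at hw
  dsimp only at e1 e2 hw hA
  set l := Real.sin y ^ 2 with hl
  set τ := p.ratio (r, l)
  have h2 : 1 + (τ * Real.tan y) ^ 2 = (1 - l + l * τ ^ 2) / Real.cos y ^ 2 := by
    rw [Real.tan_eq_sin_div_cos, hl, ← Real.cos_sq']
    field_simp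
  rw [h2, Real.sin_two_mul, Real.tan_eq_sin_div_cos]
  have e3 : p.ker (τ, l) * (partialFst p.ratio (r, l) * p.Qhat r l) =
      p.ker (τ, l) * (2 * p.amp (τ, l) * (1 - l + l * τ ^ 2)) := by
    rw [← mul_assoc, e1, div_mul_cancel₀ _ hQ.ne']
    linear_combination (-2) * e2
  have e4 := mul_left_cancel₀ hk.ne' e3
  field_simp
  linear_combination Real.sin y * e4

/-! ### The function `r⋆(r, θ⋆)` -/

/-- `r⋆` as a function of `(r, θ⋆)`. -/
noncomputable def starR (p : KNdS) (r0 : ℝ) (z : ℝ × ℝ) : ℝ :=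
  p.varrho r0 z.1 (p.ang z.1 z.2) (Real.sin z.2 ^ 2)

/-- `((r² + a²) - Q̂) / Δ_r`, in a form that is smooth across the zeros of `Δ_r`. -/
noncomputable def tailKer (p : KNdS) (z : ℝ × ℝ) : ℝ :=
  p.a ^ 2 * z.2 / (z.1 ^ 2 + p.a ^ 2 + p.Qhat z.1 z.2)

/-- `P̂ / Δ_θ`. -/
noncomputable def angularKer (p : KNdS) (z : ℝ × ℝ) : ℝ := p.Phat z.1 z.2 / p.deltaTheta z.1

theorem Subextremal.contDiffAt_tailKer {p : KNdS} (hp : p.Subextremal) {s l : ℝ}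
    (hs : s ∈ Icc p.rm p.rp) (hl : 0 ≤ l) : ContDiffAt ℝ ∞ p.tailKer (s, l) := by
  have h := hp.contDiffAt_Qhat hs hl
  have h1 := hp.Qhat_pos hs hl
  have ha := hp.2.1
  refine ContDiffAt.div (by fun_prop) (by fun_prop) ?_
  dsimp only
  positivity

theorem Subextremal.hasDerivAt_Qhat_snd {p : KNdS} (hp : p.Subextremal) {s l : ℝ}
    (hs : s ∈ Icc p.rm p.rp) (hl : 0 ≤ l) :
    HasDerivAt (fun l => p.Qhat s l) (-(p.a ^ 2 * p.deltaR s) / (2 * p.Qhat s l)) l := by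
  have h : HasDerivAt (fun l => (s ^ 2 + p.a ^ 2) ^ 2 - p.a ^ 2 * l * p.deltaR s)
      (-(p.a ^ 2 * p.deltaR s)) l := by
    simpa using (((hasDerivAt_id l).const_mul (p.a ^ 2)).mul_const (p.deltaR s)).const_sub
      ((s ^ 2 + p.a ^ 2) ^ 2)
  exact h.sqrt (hp.qArg_pos hs hl).ne'

/-- With `partialSnd_angularKer` and `hasDerivAt_f` this yields ∂ϱ/∂λ = (a²/2) F. The rationalised
kernel keeps the identity valid at the zeros of Δ_r. -/
theorem Subextremal.partialSnd_tailKer {p : KNdS} (hp : p.Subextremal) {s l : ℝ}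
    (hs : s ∈ Icc p.rm p.rp) (hl : 0 ≤ l) :
    partialSnd p.tailKer (s, l) = p.a ^ 2 / 2 * p.invQ (s, l) := by
  have h1 := hp.Qhat_pos hs hl
  have ha := hp.2.1
  have h2 := (((hp.contDiffAt_tailKer hs hl).differentiableAt
    (by simp))).hasDerivAt_partialSnd
  have h3 := ((hasDerivAt_id l).const_mul (p.a ^ 2)).fun_div
    ((hp.hasDerivAt_Qhat_snd hs hl).const_add (s ^ 2 + p.a ^ 2)) (by positivity)
  rw [h2.unique h3, invQ]
  have e := hp.Qhat_sq hs hl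
  dsimp only [id]
  set q := p.Qhat s l
  set u := s ^ 2 + p.a ^ 2 with hu
  have hu0 : 0 < u := by positivity
  field_simp
  linear_combination e

theorem deltaTheta_pos {p : KNdS} (hΛ : 0 < p.Λ) (x : ℝ) : 0 < p.deltaTheta x := by
  unfold deltaTheta; positivity

theorem Subextremal.contDiffAt_angularKer {p : KNdS} (hp : p.Subextremal) {x y : ℝ}
    (hx : x ∈ Icc 0 y) (hy : y ∈ Ioo 0 (Real.pi / 2)) :
    ContDiffAt ℝ ∞ p.angularKer (x, Real.sin y ^ 2) := by
  refine (hp.contDiffAt_Phat hx hy).div ?_ (deltaTheta_pos hp.1 x).ne'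
  unfold deltaTheta
  have h2 : ContDiff ℝ ∞ Real.cos := Real.contDiff_cos
  fun_prop

theorem Subextremal.partialSnd_angularKer {p : KNdS} (hp : p.Subextremal) {x y : ℝ}
    (hx : x ∈ Icc 0 y) (hy : y ∈ Ioo 0 (Real.pi / 2)) :
    partialSnd p.angularKer (x, Real.sin y ^ 2) =
      p.a ^ 2 / 2 * (1 / p.Phat x (Real.sin y ^ 2)) := by
  have ha := hp.2.1
  have hP := hp.Phat_pos hx hy
  have h2 := (((hp.contDiffAt_angularKer hx hy).differentiableAt
    (by simp))).hasDerivAt_partialSnd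
  have h3 : HasDerivAt (fun l => l * p.deltaTheta x - Real.sin x ^ 2) (p.deltaTheta x)
      (Real.sin y ^ 2) := by
    simpa using ((hasDerivAt_id (Real.sin y ^ 2)).mul_const (p.deltaTheta x)).sub_const
      (Real.sin x ^ 2)
  have h4 := (((h3.sqrt (hp.Phat_arg_pos hx hy).ne').const_mul p.a).div_const (p.deltaTheta x))
  rw [h2.unique h4, Phat]
  have h5 := Real.sqrt_pos.2 (hp.Phat_arg_pos hx hy)
  have h6 := deltaTheta_pos hp.1 x
  field_simp

/-- A dummy second variable makes f an instance of `paramIntegral`, so that its regularity lemmas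
apply. The formula for f' is used only at interior points, which suffices under the integral. -/
theorem Subextremal.f_eq {p : KNdS} (hp : p.Subextremal) {l : ℝ} (hl : l ∈ Ioo (0 : ℝ) 1) :
    p.f l = paramIntegral 0 (fun z => p.ellInt (0, z.1) / p.a) (l, 0) := by
  rw [f, paramIntegral, intervalIntegral.integral_symm, ← intervalIntegral.integral_neg]
  refine intervalIntegral.integral_congr_uIoo fun x hx => ?_
  rw [uIoo_of_ge hl.1.le] at hx
  dsimp only
  rw [hp.fPrime_eq ⟨hx.1, hx.2.trans hl.2⟩, neg_neg]

theorem Subextremal.contDiffAt_ellInt_zero {p : KNdS} (hp : p.Subextremal) {l x : ℝ}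
    (hl : l ∈ Ioo (0 : ℝ) 1) (hx : x ∈ uIcc l 0) :
    ContDiffAt ℝ ∞ (fun z : ℝ × ℝ => p.ellInt (0, z.1) / p.a) (x, 0) := by
  rw [uIcc_of_ge hl.1.le] at hx
  exact (ContDiffAt.comp (g := p.ellInt) (f := fun z : ℝ × ℝ => ((0 : ℝ), z.1)) (x, 0)
    (hp.contDiffAt_ellInt le_rfl (hp.zero_mem_kerDom (hx.2.trans_lt hl.2)))
    (by fun_prop)).div_const _

theorem Subextremal.f_eventuallyEq {p : KNdS} (hp : p.Subextremal) {l : ℝ}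
    (hl : l ∈ Ioo (0 : ℝ) 1) :
    p.f =ᶠ[𝓝 l] fun l => paramIntegral 0 (fun z => p.ellInt (0, z.1) / p.a) (l, 0) := by
  filter_upwards [Ioo_mem_nhds hl.1 hl.2] with t ht using hp.f_eq ht

theorem Subextremal.contDiffAt_f {p : KNdS} (hp : p.Subextremal) {l : ℝ}
    (hl : l ∈ Ioo (0 : ℝ) 1) : ContDiffAt ℝ ∞ p.f l := by
  refine ContDiffAt.congr_of_eventuallyEq ?_ (hp.f_eventuallyEq hl)
  exact ContDiffAt.comp (g := paramIntegral 0 (fun z => p.ellInt (0, z.1) / p.a))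
    (f := fun l : ℝ => (l, (0 : ℝ))) l
    (contDiffAt_paramIntegral fun x hx => hp.contDiffAt_ellInt_zero hl hx) (by fun_prop)

theorem Subextremal.hasDerivAt_f {p : KNdS} (hp : p.Subextremal) {l : ℝ}
    (hl : l ∈ Ioo (0 : ℝ) 1) : HasDerivAt p.f (-(p.ellInt (0, l) / p.a)) l := by
  refine HasDerivAt.congr_of_eventuallyEq ?_ (hp.f_eventuallyEq hl)
  refine hasDerivAt_paramIntegral_fst
    (k := fun z : ℝ × ℝ => p.ellInt (0, z.1) / p.a) fun x hx => ?_
  exact ((contDiffAt_infty.1 (hp.contDiffAt_ellInt_zero hl hx) 0).eventually (by simp)).mono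
    fun _ h => h.continuousAt

/-- `(r² + a²) / Δ_r`. -/
noncomputable def tortoiseKer (p : KNdS) (z : ℝ × ℝ) : ℝ := (z.1 ^ 2 + p.a ^ 2) / p.deltaR z.1

theorem Subextremal.contDiffAt_tortoiseKer {p : KNdS} (hp : p.Subextremal) {r0 r x : ℝ}
    (hr0 : r0 ∈ Ioo p.rm p.rp) (hr : r ∈ Ioo p.rm p.rp) (hx : x ∈ uIcc r r0) (l : ℝ) :
    ContDiffAt ℝ ∞ p.tortoiseKer (x, l) := by
  refine ContDiffAt.div (by fun_prop) (p.contDiff_deltaR.comp contDiff_fst).contDiffAt ?_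
  exact (hp.deltaR_neg (ordConnected_Ioo.uIcc_subset hr hr0 hx)).ne

theorem Subextremal.starR_eq {p : KNdS} (hp : p.Subextremal) (r0 : ℝ) {z : ℝ × ℝ}
    (hz : z ∈ Ioo p.rm p.rp ×ˢ Ioo 0 (Real.pi / 2)) :
    p.starR r0 z = -paramIntegral r0 p.tortoiseKer (z.1, 0) +
      paramIntegral p.rp p.tailKer (z.1, Real.sin z.2 ^ 2) -
      paramIntegral 0 p.angularKer (p.ang z.1 z.2, Real.sin z.2 ^ 2) +
      p.a ^ 2 / 2 * p.f (Real.sin z.2 ^ 2) := by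
  obtain ⟨hr, hy⟩ := hz
  have e1 : ∫ s in z.1..p.rp, ((s ^ 2 + p.a ^ 2) - p.Qhat s (Real.sin z.2 ^ 2)) / p.deltaR s =
      paramIntegral p.rp p.tailKer (z.1, Real.sin z.2 ^ 2) := by
    -- The open interval leaves out rp, where Δ_r = 0 and the original quotient is meaningless.
    refine intervalIntegral.integral_congr_Ioo_of_le hr.2.le fun s hs => ?_
    have hs' : s ∈ Ioo p.rm p.rp := ⟨hr.1.trans hs.1, hs.2⟩
    have h1 := hp.deltaR_neg hs'
    have h2 := hp.Qhat_sq (Ioo_subset_Icc_self hs') (sq_nonneg (Real.sin z.2))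
    have h3 := hp.Qhat_pos (Ioo_subset_Icc_self hs') (sq_nonneg (Real.sin z.2))
    have ha := hp.2.1
    dsimp only [tailKer]
    rw [div_eq_div_iff h1.ne (by positivity)]
    linear_combination -h2
  rw [starR, varrho, e1, intervalIntegral.integral_symm, intervalIntegral.integral_symm
    (b := (0 : ℝ))]
  simp only [paramIntegral, tortoiseKer, angularKer]
  ring

theorem Subextremal.contDiffAt_starR {p : KNdS} (hp : p.Subextremal) {r0 : ℝ}
    (hr0 : r0 ∈ Ioo p.rm p.rp) {z : ℝ × ℝ} (hz : z ∈ Ioo p.rm p.rp ×ˢ Ioo 0 (Real.pi / 2)) :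
    ContDiffAt ℝ ∞ (p.starR r0) z := by
  have hU : Ioo p.rm p.rp ×ˢ Ioo 0 (Real.pi / 2) ∈ 𝓝 z :=
    (isOpen_Ioo.prod isOpen_Ioo).mem_nhds hz
  refine ContDiffAt.congr_of_eventuallyEq ?_
    (Filter.eventuallyEq_of_mem hU fun w hw => hp.starR_eq r0 hw)
  obtain ⟨hr, hy⟩ := hz
  have hr' := Ioo_subset_Icc_self hr
  have hm := mk_mem_region hr' hy
  have hsin : ContDiffAt ℝ ∞ (fun z : ℝ × ℝ => Real.sin z.2 ^ 2) z :=
    ((Real.contDiff_sin.comp contDiff_snd).pow 2).contDiffAt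
  have hc := (cos_pos_of_mem ⟨hy.1.le, hy.2⟩)
  have hang : ContDiffAt ℝ ∞ (fun z : ℝ × ℝ => p.ang z.1 z.2) z := by
    have h1 : ContDiffAt ℝ ∞ (fun z : ℝ × ℝ => p.ratio (z.1, Real.sin z.2 ^ 2)) z :=
      ContDiffAt.comp (g := p.ratio) (f := fun z : ℝ × ℝ => (z.1, Real.sin z.2 ^ 2)) z
        (hp.smoothOnRegion_ratio _ hm) (contDiffAt_fst.prodMk hsin)
    have h2 : ContDiffAt ℝ ∞ (fun z : ℝ × ℝ => Real.tan z.2) z :=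
      ContDiffAt.comp (g := Real.tan) z (Real.contDiffAt_tan.2 hc.ne') contDiffAt_snd
    exact Real.contDiff_arctan.contDiffAt.comp z (h1.mul h2)
  refine ((ContDiffAt.add (ContDiffAt.neg ?_) ?_).sub ?_).add (contDiffAt_const.mul ?_)
  · exact ContDiffAt.comp (g := paramIntegral r0 p.tortoiseKer)
      (f := fun z : ℝ × ℝ => (z.1, (0 : ℝ))) z (contDiffAt_paramIntegral fun x hx =>
        hp.contDiffAt_tortoiseKer hr0 hr hx 0) (by fun_prop)
  · exact ContDiffAt.comp (g := paramIntegral p.rp p.tailKer)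
      (f := fun z : ℝ × ℝ => (z.1, Real.sin z.2 ^ 2)) z (contDiffAt_paramIntegral fun x hx =>
        hp.contDiffAt_tailKer (uIcc_subset_of_mem hr' hx) hm.2.1) (contDiffAt_fst.prodMk hsin)
  · refine ContDiffAt.comp (g := paramIntegral 0 p.angularKer)
      (f := fun z : ℝ × ℝ => (p.ang z.1 z.2, Real.sin z.2 ^ 2)) z
      (contDiffAt_paramIntegral fun x hx => hp.contDiffAt_angularKer ?_ hy) (hang.prodMk hsin)
    have := hp.ang_mem hr' hy
    rw [uIcc_of_ge this.1.le] at hx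
    exact ⟨hx.1, hx.2.trans this.2⟩
  · exact ContDiffAt.comp (g := p.f) z (hp.contDiffAt_f (sin_sq_mem_Ioo hy)) hsin

/-- At fixed θ⋆ also λ is fixed, and the derivative is Q̂/Δ_r + P²/(Δ_θ Q̂). On the common
denominator the terms in λ of Q̂² and P² cancel, which leaves the positive numerator of
`radialSlope`. -/
theorem Subextremal.partialFst_starR {p : KNdS} (hp : p.Subextremal) {r0 r y : ℝ}
    (hr0 : r0 ∈ Ioo p.rm p.rp) (hr : r ∈ Ioo p.rm p.rp) (hy : y ∈ Ioo 0 (Real.pi / 2)) :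
    partialFst (p.starR r0) (r, y) = p.radialSlope (r, Real.sin y ^ 2) / p.deltaR r := by
  have hr' := Ioo_subset_Icc_self hr
  have hm := mk_mem_region hr' hy
  have hθ := hp.ang_mem hr' hy
  have hθ' : p.ang r y ∈ Icc 0 y := ⟨hθ.1.le, hθ.2⟩
  have h0 := ((hp.contDiffAt_starR hr0 ⟨hr, hy⟩).differentiableAt (by simp)).hasDerivAt_partialFst
  have h1 := (contDiffAt_paramIntegral fun x hx => hp.contDiffAt_tortoiseKer hr0 hr hx
    0).differentiableAt (by simp) |>.hasDerivAt_partialFst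
  have h2 := (contDiffAt_paramIntegral fun x hx => hp.contDiffAt_tailKer
    (uIcc_subset_of_mem hr' hx) hm.2.1).differentiableAt (by simp) |>.hasDerivAt_partialFst
  have hsub : ∀ x ∈ uIcc (p.ang r y) 0, x ∈ Icc 0 y := fun x hx => by
    rw [uIcc_of_ge hθ.1.le] at hx
    exact ⟨hx.1, hx.2.trans hθ.2⟩
  have h3 := DifferentiableAt.hasDerivAt_comp₂ (u := fun r => p.ang r y)
    (v := fun _ => Real.sin y ^ 2) ((contDiffAt_paramIntegral fun x hx =>
    hp.contDiffAt_angularKer (hsub x hx) hy).differentiableAt (by simp))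
    (hp.hasDerivAt_ang_fst hr hy) (hasDerivAt_const r _)
  have h4 := ((h1.neg.add h2).sub h3).add_const (p.a ^ 2 / 2 * p.f (Real.sin y ^ 2))
  rw [h0.unique (h4.congr_of_eventuallyEq (by
    filter_upwards [Ioo_mem_nhds hr.1 hr.2] with t ht
    exact hp.starR_eq r0 (z := (t, y)) ⟨ht, hy⟩))]
  rw [partialFst_paramIntegral fun x hx => (hp.contDiffAt_tortoiseKer hr0 hr hx 0).of_le (by simp),
    partialFst_paramIntegral fun x hx => (hp.contDiffAt_tailKer
      (uIcc_subset_of_mem hr' hx) hm.2.1).of_le (by simp),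
    partialFst_paramIntegral fun x hx => (hp.contDiffAt_angularKer (hsub x hx) hy).of_le (by simp)]
  simp only [tortoiseKer, tailKer, angularKer, radialSlope]
  rw [← hp.sin_sq_ang hr' hy, ← hp.deltaTheta_ang hr' hy, ← hp.Phat_ang hr' hy]
  have hQ := hp.Qhat_pos hr' hm.2.1
  have hQ2 := hp.Qhat_sq hr' hm.2.1
  have hΔ := hp.deltaR_neg hr
  have hT := deltaTheta_pos hp.1 (p.ang r y)
  have hP2 : p.Phat (p.ang r y) (Real.sin y ^ 2) ^ 2 = p.a ^ 2 *
      (Real.sin y ^ 2 * p.deltaTheta (p.ang r y) - Real.sin (p.ang r y) ^ 2) := by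
    rw [Phat, mul_pow, Real.sq_sqrt (hp.Phat_arg_pos hθ' hy).le]
  have ha := hp.2.1
  have hu : 0 < r ^ 2 + p.a ^ 2 := by positivity
  dsimp only at hQ hQ2 ⊢
  set q := p.Qhat r (Real.sin y ^ 2)
  set P := p.Phat (p.ang r y) (Real.sin y ^ 2)
  set D := p.deltaTheta (p.ang r y)
  have e1 : (r ^ 2 + p.a ^ 2) / p.deltaR r - p.a ^ 2 * Real.sin y ^ 2 / (r ^ 2 + p.a ^ 2 + q) =
      q / p.deltaR r := by
    field_simp [hΔ.ne]
    linear_combination -hQ2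
  have e2 : q / p.deltaR r + P / D * (P / q) =
      ((r ^ 2 + p.a ^ 2) ^ 2 * D - p.a ^ 2 * Real.sin (p.ang r y) ^ 2 * p.deltaR r) / (q * D) /
        p.deltaR r := by
    field_simp [hΔ.ne]
    linear_combination D * hQ2 + p.deltaR r * hP2
  rw [← e2, ← e1]
  ring

/-- The λ-derivatives add up to (a²/2) F = 0, so only the variation of the upper limit θ
contributes: (P/Δ_θ) ∂θ/∂θ⋆. -/
theorem Subextremal.partialSnd_starR {p : KNdS} (hp : p.Subextremal) {r0 r y : ℝ}
    (hr0 : r0 ∈ Ioo p.rm p.rp) (hr : r ∈ Ioo p.rm p.rp) (hy : y ∈ Ioo 0 (Real.pi / 2)) :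
    partialSnd (p.starR r0) (r, y) = Real.sin (2 * y) *
      (p.ampOf (r, Real.sin y ^ 2) / p.deltaThetaOf (r, Real.sin y ^ 2) *
        p.angSlope (partialSnd p.ratio (r, Real.sin y ^ 2)) (r, Real.sin y ^ 2)) := by
  have hr' := Ioo_subset_Icc_self hr
  have hm := mk_mem_region hr' hy
  have hθ := hp.ang_mem hr' hy
  have hθ' : p.ang r y ∈ Icc 0 y := ⟨hθ.1.le, hθ.2⟩
  have h0 := ((hp.contDiffAt_starR hr0 ⟨hr, hy⟩).differentiableAt (by simp)).hasDerivAt_partialSnd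
  have h2 := DifferentiableAt.hasDerivAt_comp₂ (u := fun _ => r)
    (v := fun y => Real.sin y ^ 2) ((contDiffAt_paramIntegral fun x hx => hp.contDiffAt_tailKer
    (uIcc_subset_of_mem hr' hx) hm.2.1).differentiableAt (by simp)) (hasDerivAt_const y r)
    (hasDerivAt_sin_sq y)
  have hsub : ∀ x ∈ uIcc (p.ang r y) 0, x ∈ Icc 0 y := fun x hx => by
    rw [uIcc_of_ge hθ.1.le] at hx
    exact ⟨hx.1, hx.2.trans hθ.2⟩
  have h3 := DifferentiableAt.hasDerivAt_comp₂ (u := fun y => p.ang r y)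
    (v := fun y => Real.sin y ^ 2) ((contDiffAt_paramIntegral fun x hx =>
    hp.contDiffAt_angularKer (hsub x hx) hy).differentiableAt (by simp))
    (hp.hasDerivAt_ang_snd hr' hy) (hasDerivAt_sin_sq y)
  have h4 := (HasDerivAt.comp (h₂ := p.f) y (hp.hasDerivAt_f (sin_sq_mem_Ioo hy))
    (hasDerivAt_sin_sq y)).const_mul (p.a ^ 2 / 2)
  have h5 := ((h2.const_add (-paramIntegral r0 p.tortoiseKer (r, 0))).sub h3).add h4
  rw [h0.unique (h5.congr_of_eventuallyEq (by
    filter_upwards [Ioo_mem_nhds hy.1 hy.2] with t ht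
    exact hp.starR_eq r0 (z := (r, t)) ⟨hr, ht⟩))]
  rw [partialSnd_paramIntegral fun x hx => (hp.contDiffAt_tailKer
      (uIcc_subset_of_mem hr' hx) hm.2.1).of_le (by simp),
    partialFst_paramIntegral fun x hx => (hp.contDiffAt_angularKer (hsub x hx) hy).of_le (by simp),
    partialSnd_paramIntegral fun x hx => (hp.contDiffAt_angularKer (hsub x hx) hy).of_le (by simp)]
  have i1 : paramIntegral p.rp (partialSnd p.tailKer) (r, Real.sin y ^ 2) =
      p.a ^ 2 / 2 * p.radialInt (r, Real.sin y ^ 2) := by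
    rw [radialInt, paramIntegral, paramIntegral, ← intervalIntegral.integral_const_mul]
    exact intervalIntegral.integral_congr fun s hs =>
      hp.partialSnd_tailKer (uIcc_subset_of_mem hr' hs) hm.2.1
  have i2 : paramIntegral 0 (partialSnd p.angularKer) (p.ang r y, Real.sin y ^ 2) =
      p.a ^ 2 / 2 * ∫ s in p.ang r y..0, 1 / p.Phat s (Real.sin y ^ 2) := by
    rw [paramIntegral, ← intervalIntegral.integral_const_mul]
    exact intervalIntegral.integral_congr fun s hs => hp.partialSnd_angularKer (hsub s hs) hy
  -- Once the equation for τ is inserted, this says that the radial integral and the two angular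
  -- integrals cancel, which is F = 0.
  have i3 : (∫ s in (0 : ℝ)..p.ang r y, 1 / p.Phat s (Real.sin y ^ 2)) +
      ∫ s in p.ang r y..y, 1 / p.Phat s (Real.sin y ^ 2) =
      ∫ s in (0 : ℝ)..y, 1 / p.Phat s (Real.sin y ^ 2) := by
    have hc := hp.continuousOn_inv_Phat hy
    have h0y : (0 : ℝ) ∈ Icc 0 y := ⟨le_rfl, hy.1.le⟩
    have hyy : y ∈ Icc 0 y := ⟨hy.1.le, le_rfl⟩
    exact intervalIntegral.integral_add_adjacent_intervals
      (hc.mono (ordConnected_Icc.uIcc_subset h0y hθ')).intervalIntegrable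
      (hc.mono (ordConnected_Icc.uIcc_subset hθ' hyy)).intervalIntegrable
  have ht := Real.tan_pos_of_pos_of_lt_pi_div_two hy.1 hy.2
  have ha := hp.2.1
  rw [hp.integral_inv_Phat hθ' hy, hp.integral_inv_Phat ⟨le_rfl, hy.1.le⟩ hy, p.tan_ang,
    mul_div_cancel_right₀ _ ht.ne', Real.tan_zero, zero_div] at i3
  have i4 := hp.ellInt_ratio hm
  dsimp only at i4
  rw [i4, mul_div_cancel_left₀ _ ha.ne'] at i3
  rw [i1, i2, intervalIntegral.integral_symm, ← i3]
  simp only [angularKer]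
  rw [hp.deltaTheta_ang hr' hy, hp.Phat_ang hr' hy]
  ring

/-! ### Inversion of `r ↦ r⋆` at constant `θ⋆` -/

theorem SmoothOnRegion.continuousOn {p : KNdS} {g : ℝ × ℝ → ℝ} (hg : p.SmoothOnRegion g) :
    ContinuousOn g p.region := fun z hz => (hg z hz).continuousAt.continuousWithinAt

theorem SmoothOnRegion.exists_bound {p : KNdS} {g : ℝ × ℝ → ℝ} (hg : p.SmoothOnRegion g) :
    ∃ C, 0 ≤ C ∧ ∀ z ∈ p.region, |g z| ≤ C := by
  obtain ⟨C, hC⟩ := p.isCompact_region.exists_bound_of_continuousOn hg.continuousOn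
  exact ⟨|C|, abs_nonneg _, fun z hz => (hC z hz).trans (le_abs_self C)⟩

theorem Subextremal.exists_le_radialSlope {p : KNdS} (hp : p.Subextremal) :
    ∃ c, 0 < c ∧ ∀ z ∈ p.region, c ≤ p.radialSlope z := by
  obtain ⟨C, hC0, hC⟩ := hp.smoothOnRegion_coefR.exists_bound
  -- An upper bound C for 1/S is a lower bound for S; adding 1 avoids the possibility C = 0.
  refine ⟨1 / (C + 1), by positivity, fun z hz => ?_⟩
  have h1 := hp.radialSlope_pos hz
  have h2 := (le_abs_self _).trans (hC z hz)
  rw [coefR, div_le_iff₀ h1] at h2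
  rw [div_le_iff₀ (by positivity)]
  linarith

theorem Subextremal.hasDerivAt_starR_fst {p : KNdS} (hp : p.Subextremal) {r0 r y : ℝ}
    (hr0 : r0 ∈ Ioo p.rm p.rp) (hr : r ∈ Ioo p.rm p.rp) (hy : y ∈ Ioo 0 (Real.pi / 2)) :
    HasDerivAt (fun r => p.starR r0 (r, y))
      (p.radialSlope (r, Real.sin y ^ 2) / p.deltaR r) r := by
  rw [← hp.partialFst_starR hr0 hr hy]
  exact ((hp.contDiffAt_starR hr0 ⟨hr, hy⟩).differentiableAt (by simp)).hasDerivAt_partialFst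

theorem Subextremal.strictAntiOn_starR {p : KNdS} (hp : p.Subextremal) {r0 y : ℝ}
    (hr0 : r0 ∈ Ioo p.rm p.rp) (hy : y ∈ Ioo 0 (Real.pi / 2)) :
    StrictAntiOn (fun r => p.starR r0 (r, y)) (Ioo p.rm p.rp) := by
  refine strictAntiOn_of_deriv_neg (convex_Ioo _ _) (fun r hr =>
    (hp.hasDerivAt_starR_fst hr0 hr hy).continuousAt.continuousWithinAt) fun r hr => ?_
  rw [interior_Ioo] at hr
  rw [(hp.hasDerivAt_starR_fst hr0 hr hy).deriv]
  exact div_neg_of_pos_of_neg (hp.radialSlope_pos (mk_mem_region (Ioo_subset_Icc_self hr) hy))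
    (hp.deltaR_neg hr)

/-- With S ≥ c and |Δ_r| ≤ C u, where u is the distance to either horizon, the slope satisfies
∂r⋆/∂r ≤ −(c/C)/u. Monotonicity after adding a logarithm is the integrated form of this bound. -/
theorem Subextremal.exists_antitoneOn_starR_add_log {p : KNdS} (hp : p.Subextremal) {r0 y : ℝ}
    (hr0 : r0 ∈ Ioo p.rm p.rp) (hy : y ∈ Ioo 0 (Real.pi / 2)) : ∃ m, 0 < m ∧
    AntitoneOn (fun r => p.starR r0 (r, y) + m * Real.log (r - p.rm)) (Ioo p.rm p.rp) ∧
    AntitoneOn (fun r => p.starR r0 (r, y) - m * Real.log (p.rp - r)) (Ioo p.rm p.rp) := by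
  obtain ⟨c, hc, hcs⟩ := hp.exists_le_radialSlope
  obtain ⟨C, hC, hCs⟩ := hp.exists_abs_deltaR_le
  have key : ∀ r ∈ Ioo p.rm p.rp, ∀ u : ℝ, 0 < u → |p.deltaR r| ≤ C * u →
      p.radialSlope (r, Real.sin y ^ 2) / p.deltaR r + c / C * (1 / u) ≤ 0 := by
    intro r hr u hu h
    have h1 := hcs _ (mk_mem_region (Ioo_subset_Icc_self hr) hy)
    have h2 := hp.deltaR_neg hr
    rw [abs_of_neg h2] at h
    have h3 : c / C * (1 / u) ≤ c / -p.deltaR r := by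
      rw [div_mul_div_comm, mul_one]
      exact div_le_div_of_nonneg_left hc.le (by linarith) h
    have h4 : c / -p.deltaR r ≤ p.radialSlope (r, Real.sin y ^ 2) / -p.deltaR r :=
      div_le_div_of_nonneg_right h1 (by linarith)
    rw [div_neg] at h4
    linarith
  have d1 : ∀ r ∈ Ioo p.rm p.rp, HasDerivAt
      (fun r => p.starR r0 (r, y) + c / C * Real.log (r - p.rm))
      (p.radialSlope (r, Real.sin y ^ 2) / p.deltaR r + c / C * (1 / (r - p.rm))) r := fun r hr =>
    (hp.hasDerivAt_starR_fst hr0 hr hy).add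
      ((((hasDerivAt_id r).sub_const p.rm).log (sub_pos.2 hr.1).ne').const_mul _)
  have d2 : ∀ r ∈ Ioo p.rm p.rp, HasDerivAt
      (fun r => p.starR r0 (r, y) - c / C * Real.log (p.rp - r))
      (p.radialSlope (r, Real.sin y ^ 2) / p.deltaR r + c / C * (1 / (p.rp - r))) r := fun r hr =>
    ((hp.hasDerivAt_starR_fst hr0 hr hy).sub
      ((((hasDerivAt_id r).const_sub p.rp).log (sub_pos.2 hr.2).ne').const_mul _)).congr_deriv
        (by simp; ring)
  refine ⟨c / C, by positivity, ?_, ?_⟩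
  · refine antitoneOn_of_deriv_nonpos (convex_Ioo _ _)
      (fun r hr => (d1 r hr).continuousAt.continuousWithinAt) (fun r hr => ?_) fun r hr => ?_ <;>
      rw [interior_Ioo] at hr
    · exact (d1 r hr).differentiableAt.differentiableWithinAt
    · rw [(d1 r hr).deriv]
      exact key r hr _ (sub_pos.2 hr.1) (hCs r (Ioo_subset_Icc_self hr)).1
  · refine antitoneOn_of_deriv_nonpos (convex_Ioo _ _)
      (fun r hr => (d2 r hr).continuousAt.continuousWithinAt) (fun r hr => ?_) fun r hr => ?_ <;>
      rw [interior_Ioo] at hr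
    · exact (d2 r hr).differentiableAt.differentiableWithinAt
    · rw [(d2 r hr).deriv]
      exact key r hr _ (sub_pos.2 hr.2) (hCs r (Ioo_subset_Icc_self hr)).2

theorem Subextremal.exists_starR_eq {p : KNdS} (hp : p.Subextremal) {r0 y : ℝ}
    (hr0 : r0 ∈ Ioo p.rm p.rp) (hy : y ∈ Ioo 0 (Real.pi / 2)) (x : ℝ) :
    ∃ r ∈ Ioo p.rm p.rp, p.starR r0 (r, y) = x := by
  obtain ⟨m, hm, hL, hR⟩ := hp.exists_antitoneOn_starR_add_log hr0 hy
  have hmp := hp.2.2.2.1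
  set h := (p.rp - p.rm) / 2 with hh
  have h0 : 0 < h := by rw [hh]; linarith
  set x1 := p.starR r0 (p.rm + h, y) with hx1
  set N := |x - x1| / m with hN
  have hN0 : 0 ≤ N := by positivity
  have hmN : m * N = |x - x1| := by rw [hN]; field_simp
  -- Chosen so that m log(h/ε) = |x − x1|: the logarithmic bounds then put x between the values of
  -- r⋆ at rm + ε and rp − ε.
  set ε := h * Real.exp (-N) with hε
  have hε0 : 0 < ε := by positivity
  have hεh : ε ≤ h := by
    rw [hε]; exact mul_le_of_le_one_right h0.le (Real.exp_le_one_iff.2 (by linarith))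
  have hlog : Real.log ε = Real.log h - N := by
    rw [hε, Real.log_mul h0.ne' (Real.exp_pos _).ne', Real.log_exp]; ring
  have m1 : p.rm + h ∈ Ioo p.rm p.rp := ⟨by linarith, by linarith⟩
  have m0 : p.rm + ε ∈ Ioo p.rm p.rp := ⟨by linarith, by linarith⟩
  have m2 : p.rp - ε ∈ Ioo p.rm p.rp := ⟨by linarith, by linarith⟩
  have e0 := hL m0 m1 (by linarith)
  have e2 := hR m1 m2 (by linarith)
  have a1 : p.rp - (p.rm + h) = h := by rw [hh]; ring
  simp only [add_sub_cancel_left, sub_sub_cancel, hlog, a1] at e0 e2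
  have hab := abs_le.1 (le_refl |x - x1|)
  have hsub : Icc (p.rm + ε) (p.rp - ε) ⊆ Ioo p.rm p.rp := fun r hr =>
    ⟨m0.1.trans_le hr.1, hr.2.trans_lt m2.2⟩
  have hc : ContinuousOn (fun r => p.starR r0 (r, y)) (Icc (p.rm + ε) (p.rp - ε)) := fun r hr =>
    (hp.hasDerivAt_starR_fst hr0 (hsub hr) hy).continuousAt.continuousWithinAt
  obtain ⟨r, hr, e⟩ := intermediate_value_Icc' (by linarith) hc
    (show x ∈ Icc _ _ from ⟨by nlinarith, by nlinarith⟩)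
  exact ⟨r, hsub hr, e⟩

/-! ### The inverse coordinate functions and the first derivatives of r. -/

theorem Subextremal.starMap_ang {p : KNdS} (hp : p.Subextremal) {r0 r y : ℝ}
    (hr : r ∈ Ioo p.rm p.rp) (hy : y ∈ Ioo 0 (Real.pi / 2)) :
    p.starMap r0 (r, p.ang r y) = (p.starR r0 (r, y), y) := by
  have h := hp.thetaStar_ang (Ioo_subset_Icc_self hr) hy
  simp only [starMap, rStar, h, starR]

/-- Surjectivity is enough here: `Function.invFunOn` then returns some preimage, and its
θ⋆-component forces θ to be the angle determined by (r, θ⋆). Uniqueness of r is in `rOf_eq`. -/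
theorem Subextremal.starInv_spec {p : KNdS} (hp : p.Subextremal) {r0 : ℝ}
    (hr0 : r0 ∈ Ioo p.rm p.rp) (x : ℝ) {y : ℝ} (hy : y ∈ Ioo 0 (Real.pi / 2)) :
    p.rOf r0 x y ∈ Ioo p.rm p.rp ∧ p.starR r0 (p.rOf r0 x y, y) = x ∧
      p.thetaOf r0 x y = p.ang (p.rOf r0 x y) y := by
  obtain ⟨r, hr, e⟩ := hp.exists_starR_eq hr0 hy x
  have hex : ∃ z ∈ Ioo p.rm p.rp ×ˢ Ioo 0 (Real.pi / 2), p.starMap r0 z = (x, y) :=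
    ⟨(r, p.ang r y), ⟨hr, hp.ang_mem' (Ioo_subset_Icc_self hr) hy⟩, by
      rw [hp.starMap_ang hr hy, e]⟩
  obtain ⟨h1, h2⟩ := Function.invFunOn_pos hex
  change p.starInv r0 (x, y) ∈ _ at h1
  change p.starMap r0 (p.starInv r0 (x, y)) = _ at h2
  have hy' : p.thetaStar (p.rOf r0 x y) (p.thetaOf r0 x y) = y := congrArg Prod.snd h2
  have hx' : p.rStar r0 (p.rOf r0 x y) (p.thetaOf r0 x y) = x := congrArg Prod.fst h2
  have hr' : p.rOf r0 x y ∈ Ioo p.rm p.rp := h1.1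
  have hθ := (hp.eq_ang_of_thetaStar (Ioo_subset_Icc_self hr') (x := p.thetaOf r0 x y) h1.2).1
  rw [hy'] at hθ
  refine ⟨hr', ?_, hθ⟩
  rw [rStar, hy', hθ] at hx'
  exact hx'

theorem Subextremal.rOf_eq {p : KNdS} (hp : p.Subextremal) {r0 x y r : ℝ}
    (hr0 : r0 ∈ Ioo p.rm p.rp) (hy : y ∈ Ioo 0 (Real.pi / 2)) (hr : r ∈ Ioo p.rm p.rp)
    (h : p.starR r0 (r, y) = x) : p.rOf r0 x y = r := by
  obtain ⟨h1, h2, -⟩ := hp.starInv_spec hr0 x hy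
  exact (hp.strictAntiOn_starR hr0 hy).injOn h1 hr (h2.trans h.symm)

theorem Subextremal.differentiableAt_rOf {p : KNdS} (hp : p.Subextremal) {r0 : ℝ}
    (hr0 : r0 ∈ Ioo p.rm p.rp) (x : ℝ) {y : ℝ} (hy : y ∈ Ioo 0 (Real.pi / 2)) :
    DifferentiableAt ℝ (fun z : ℝ × ℝ => p.rOf r0 z.1 z.2) (x, y) := by
  obtain ⟨h1, h2, -⟩ := hp.starInv_spec hr0 x hy
  refine (contDiffAt_of_implicit (n := ∞) (Φ := p.starR r0) (ψ := Prod.fst) (z := (x, y))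
    (t := p.rOf r0 x y) (by simp) (hp.contDiffAt_starR hr0 (Set.mk_mem_prod h1 hy))
    contDiffAt_fst h2 ?_
    ?_).differentiableAt (by simp)
  · rw [hp.partialFst_starR hr0 h1 hy]
    exact div_ne_zero (hp.radialSlope_pos (mk_mem_region (Ioo_subset_Icc_self h1) hy)).ne'
      (hp.deltaR_neg h1).ne
  · have c1 : ContinuousAt (fun v : (ℝ × ℝ) × ℝ => v.1.2) ((x, y), p.rOf r0 x y) := by fun_prop
    have c2 : ContinuousAt (fun v : (ℝ × ℝ) × ℝ => v.2) ((x, y), p.rOf r0 x y) := by fun_prop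
    filter_upwards [c1.eventually (Ioo_mem_nhds hy.1 hy.2),
      c2.eventually (Ioo_mem_nhds h1.1 h1.2)] with v hv1 hv2 hv
    exact hp.rOf_eq hr0 hv1 hv2 hv

theorem Subextremal.hasDerivAt_rOf_fst {p : KNdS} (hp : p.Subextremal) {r0 : ℝ}
    (hr0 : r0 ∈ Ioo p.rm p.rp) (x : ℝ) {y : ℝ} (hy : y ∈ Ioo 0 (Real.pi / 2)) :
    HasDerivAt (fun t => p.rOf r0 t y)
      (p.deltaR (p.rOf r0 x y) * p.coefR (p.rOf r0 x y, Real.sin y ^ 2)) x := by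
  obtain ⟨h1, h2, -⟩ := hp.starInv_spec hr0 x hy
  have hd := (hp.differentiableAt_rOf hr0 x hy).hasDerivAt_partialFst
  have hs := hp.hasDerivAt_starR_fst hr0 h1 hy
  have hc := hs.comp x hd
  have he := hc.unique ((hasDerivAt_id x).congr_of_eventuallyEq
    (Eventually.of_forall fun t => (hp.starInv_spec hr0 t hy).2.1))
  have hS := hp.radialSlope_pos (mk_mem_region (Ioo_subset_Icc_self h1) hy)
  have hΔ := (hp.deltaR_neg h1).ne
  refine hd.congr_deriv ?_
  rw [coefR]
  field_simp at he ⊢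
  linarith

/-- Differentiate r⋆(r, θ⋆) = x along fixed x. The factor sin 2θ⋆ comes from ∂r⋆/∂θ⋆, and Δ_r from
dividing by ∂r⋆/∂r = S/Δ_r. -/
theorem Subextremal.hasDerivAt_rOf_snd {p : KNdS} (hp : p.Subextremal) {r0 : ℝ}
    (hr0 : r0 ∈ Ioo p.rm p.rp) (x : ℝ) {y : ℝ} (hy : y ∈ Ioo 0 (Real.pi / 2)) :
    HasDerivAt (fun t => p.rOf r0 x t) (Real.sin (2 * y) *
      (p.deltaR (p.rOf r0 x y) * p.coefT (p.rOf r0 x y, Real.sin y ^ 2))) y := by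
  obtain ⟨h1, h2, -⟩ := hp.starInv_spec hr0 x hy
  have hd := (hp.differentiableAt_rOf hr0 x hy).hasDerivAt_partialSnd
  have hc := DifferentiableAt.hasDerivAt_comp₂ (u := fun t => p.rOf r0 x t) (v := fun t => t)
    ((hp.contDiffAt_starR hr0 (Set.mk_mem_prod h1 hy)).differentiableAt (by simp)) hd (hasDerivAt_id y)
  have he := hc.unique ((hasDerivAt_const y x).congr_of_eventuallyEq (by
    filter_upwards [Ioo_mem_nhds hy.1 hy.2] with t ht
    exact (hp.starInv_spec hr0 x ht).2.1))
  rw [hp.partialFst_starR hr0 h1 hy, hp.partialSnd_starR hr0 h1 hy] at he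
  have hS := hp.radialSlope_pos (mk_mem_region (Ioo_subset_Icc_self h1) hy)
  have hΔ := (hp.deltaR_neg h1).ne
  refine hd.congr_deriv ?_
  rw [coefT, coefR]
  set Am := p.ampOf (p.rOf r0 x y, Real.sin y ^ 2)
  set D := p.deltaThetaOf (p.rOf r0 x y, Real.sin y ^ 2)
  set E := p.angSlope (partialSnd p.ratio (p.rOf r0 x y, Real.sin y ^ 2))
    (p.rOf r0 x y, Real.sin y ^ 2)
  set S := p.radialSlope (p.rOf r0 x y, Real.sin y ^ 2)
  have e1 : Real.sin (2 * y) * (p.deltaR (p.rOf r0 x y) * -(Am * E * (1 / S) / D)) =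
      -(Real.sin (2 * y) * (Am / D * E)) * p.deltaR (p.rOf r0 x y) / S := by ring
  rw [e1, eq_div_iff hS.ne']
  have e2 : S / p.deltaR (p.rOf r0 x y) * p.deltaR (p.rOf r0 x y) = S := div_mul_cancel₀ _ hΔ
  linear_combination p.deltaR (p.rOf r0 x y) * he -
    partialSnd (fun z : ℝ × ℝ => p.rOf r0 z.1 z.2) (x, y) * e2

/-! ### Calculus of functions of `(r, sin² θ⋆)` in star coordinates -/

/-- The operator on functions of `(r, sin² θ⋆)` that corresponds to `∂_{r⋆}`. -/
noncomputable def opR (p : KNdS) (g : ℝ × ℝ → ℝ) (z : ℝ × ℝ) : ℝ :=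
  p.deltaR z.1 * (partialFst g z * p.coefR z)

/-- The operator on functions of `(r, sin² θ⋆)` that corresponds to `T`. -/
noncomputable def opT (p : KNdS) (g : ℝ × ℝ → ℝ) (z : ℝ × ℝ) : ℝ :=
  partialSnd g z + p.deltaR z.1 * (partialFst g z * p.coefT z)

theorem SmoothOnRegion.mul {p : KNdS} {g h : ℝ × ℝ → ℝ} (hg : p.SmoothOnRegion g)
    (hh : p.SmoothOnRegion h) : p.SmoothOnRegion fun z => g z * h z :=
  fun z hz => (hg z hz).mul (hh z hz)

theorem SmoothOnRegion.add {p : KNdS} {g h : ℝ × ℝ → ℝ} (hg : p.SmoothOnRegion g)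
    (hh : p.SmoothOnRegion h) : p.SmoothOnRegion fun z => g z + h z :=
  fun z hz => (hg z hz).add (hh z hz)

theorem Subextremal.smoothOnRegion_opR {p : KNdS} (hp : p.Subextremal) {g : ℝ × ℝ → ℝ}
    (hg : p.SmoothOnRegion g) : p.SmoothOnRegion (p.opR g) :=
  p.smoothOnRegion_deltaR.mul (hg.partialFst.mul hp.smoothOnRegion_coefR)

theorem Subextremal.smoothOnRegion_opT {p : KNdS} (hp : p.Subextremal) {g : ℝ × ℝ → ℝ}
    (hg : p.SmoothOnRegion g) : p.SmoothOnRegion (p.opT g) :=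
  hg.partialSnd.add (p.smoothOnRegion_deltaR.mul (hg.partialFst.mul hp.smoothOnRegion_coefT))

theorem Subextremal.smoothOnRegion_opR_iterate {p : KNdS} (hp : p.Subextremal) {g : ℝ × ℝ → ℝ}
    (hg : p.SmoothOnRegion g) (n : ℕ) : p.SmoothOnRegion (p.opR^[n] g) := by
  induction n with
  | zero => exact hg
  | succ n ih => rw [Function.iterate_succ_apply']; exact hp.smoothOnRegion_opR ih

theorem Subextremal.smoothOnRegion_opT_iterate {p : KNdS} (hp : p.Subextremal) {g : ℝ × ℝ → ℝ}
    (hg : p.SmoothOnRegion g) (n : ℕ) : p.SmoothOnRegion (p.opT^[n] g) := by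
  induction n with
  | zero => exact hg
  | succ n ih => rw [Function.iterate_succ_apply']; exact hp.smoothOnRegion_opT ih

/-- On `ℝ × (0, π/2)`, the function `u` of `(r⋆, θ⋆)` is `g(r, sin² θ⋆)`. -/
def Represents (p : KNdS) (r0 : ℝ) (g : ℝ × ℝ → ℝ) (u : ℝ → ℝ → ℝ) : Prop :=
  ∀ x : ℝ, ∀ y ∈ Ioo 0 (Real.pi / 2), u x y = g (p.rOf r0 x y, Real.sin y ^ 2)

theorem Subextremal.rOf_mem_region {p : KNdS} (hp : p.Subextremal) {r0 : ℝ}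
    (hr0 : r0 ∈ Ioo p.rm p.rp) (x : ℝ) {y : ℝ} (hy : y ∈ Ioo 0 (Real.pi / 2)) :
    (p.rOf r0 x y, Real.sin y ^ 2) ∈ p.region :=
  mk_mem_region (Ioo_subset_Icc_self (hp.starInv_spec hr0 x hy).1) hy

theorem Subextremal.hasDerivAt_comp_fst {p : KNdS} (hp : p.Subextremal) {r0 : ℝ}
    (hr0 : r0 ∈ Ioo p.rm p.rp) {g : ℝ × ℝ → ℝ} (hg : p.SmoothOnRegion g) (x : ℝ) {y : ℝ}
    (hy : y ∈ Ioo 0 (Real.pi / 2)) :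
    HasDerivAt (fun t => g (p.rOf r0 t y, Real.sin y ^ 2))
      (p.opR g (p.rOf r0 x y, Real.sin y ^ 2)) x := by
  refine (DifferentiableAt.hasDerivAt_comp₂ (u := fun t => p.rOf r0 t y)
    (v := fun _ => Real.sin y ^ 2) (hg.differentiableAt (hp.rOf_mem_region hr0 x hy))
    (hp.hasDerivAt_rOf_fst hr0 x hy) (hasDerivAt_const x _)).congr_deriv ?_
  rw [opR]; ring

theorem Subextremal.hasDerivAt_comp_snd {p : KNdS} (hp : p.Subextremal) {r0 : ℝ}
    (hr0 : r0 ∈ Ioo p.rm p.rp) {g : ℝ × ℝ → ℝ} (hg : p.SmoothOnRegion g) (x : ℝ) {y : ℝ}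
    (hy : y ∈ Ioo 0 (Real.pi / 2)) :
    HasDerivAt (fun t => g (p.rOf r0 x t, Real.sin t ^ 2))
      (Real.sin (2 * y) * p.opT g (p.rOf r0 x y, Real.sin y ^ 2)) y := by
  refine (DifferentiableAt.hasDerivAt_comp₂ (u := fun t => p.rOf r0 x t)
    (v := fun t => Real.sin t ^ 2) (hg.differentiableAt (hp.rOf_mem_region hr0 x hy))
    (hp.hasDerivAt_rOf_snd hr0 x hy) (hasDerivAt_sin_sq y)).congr_deriv ?_
  rw [opT]; ring

theorem Represents.hasDerivAt_fst {p : KNdS} (hp : p.Subextremal) {r0 : ℝ}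
    (hr0 : r0 ∈ Ioo p.rm p.rp) {g : ℝ × ℝ → ℝ} (hg : p.SmoothOnRegion g) {u : ℝ → ℝ → ℝ}
    (hu : p.Represents r0 g u) (x : ℝ) {y : ℝ} (hy : y ∈ Ioo 0 (Real.pi / 2)) :
    HasDerivAt (fun t => u t y) (p.opR g (p.rOf r0 x y, Real.sin y ^ 2)) x :=
  (hp.hasDerivAt_comp_fst hr0 hg x hy).congr_of_eventuallyEq
    (Eventually.of_forall fun t => hu t y hy)

theorem Represents.hasDerivAt_snd {p : KNdS} (hp : p.Subextremal) {r0 : ℝ}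
    (hr0 : r0 ∈ Ioo p.rm p.rp) {g : ℝ × ℝ → ℝ} (hg : p.SmoothOnRegion g) {u : ℝ → ℝ → ℝ}
    (hu : p.Represents r0 g u) (x : ℝ) {y : ℝ} (hy : y ∈ Ioo 0 (Real.pi / 2)) :
    HasDerivAt (fun t => u x t)
      (Real.sin (2 * y) * p.opT g (p.rOf r0 x y, Real.sin y ^ 2)) y := by
  refine (hp.hasDerivAt_comp_snd hr0 hg x hy).congr_of_eventuallyEq ?_
  filter_upwards [Ioo_mem_nhds hy.1 hy.2] with t ht using hu x t ht

theorem Represents.dR {p : KNdS} (hp : p.Subextremal) {r0 : ℝ}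
    (hr0 : r0 ∈ Ioo p.rm p.rp) {g : ℝ × ℝ → ℝ} (hg : p.SmoothOnRegion g) {u : ℝ → ℝ → ℝ}
    (hu : p.Represents r0 g u) : p.Represents r0 (p.opR g) (dR u) :=
  fun x _ hy => (hu.hasDerivAt_fst hp hr0 hg x hy).deriv

theorem Represents.dT {p : KNdS} (hp : p.Subextremal) {r0 : ℝ}
    (hr0 : r0 ∈ Ioo p.rm p.rp) {g : ℝ × ℝ → ℝ} (hg : p.SmoothOnRegion g) {u : ℝ → ℝ → ℝ}
    (hu : p.Represents r0 g u) : p.Represents r0 (p.opT g) (dT u) := fun x y hy => by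
  have := sin_two_mul_pos hy
  rw [KNdS.dT, (hu.hasDerivAt_snd hp hr0 hg x hy).deriv]
  field_simp

theorem Represents.dR_iterate {p : KNdS} (hp : p.Subextremal) {r0 : ℝ}
    (hr0 : r0 ∈ Ioo p.rm p.rp) {g : ℝ × ℝ → ℝ} (hg : p.SmoothOnRegion g) {u : ℝ → ℝ → ℝ}
    (hu : p.Represents r0 g u) (n : ℕ) : p.Represents r0 (p.opR^[n] g) (KNdS.dR^[n] u) := by
  induction n with
  | zero => exact hu
  | succ n ih =>
    rw [Function.iterate_succ_apply', Function.iterate_succ_apply']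
    exact ih.dR hp hr0 (hp.smoothOnRegion_opR_iterate hg n)

theorem Represents.dT_iterate {p : KNdS} (hp : p.Subextremal) {r0 : ℝ}
    (hr0 : r0 ∈ Ioo p.rm p.rp) {g : ℝ × ℝ → ℝ} (hg : p.SmoothOnRegion g) {u : ℝ → ℝ → ℝ}
    (hu : p.Represents r0 g u) (n : ℕ) : p.Represents r0 (p.opT^[n] g) (KNdS.dT^[n] u) := by
  induction n with
  | zero => exact hu
  | succ n ih =>
    rw [Function.iterate_succ_apply', Function.iterate_succ_apply']
    exact ih.dT hp hr0 (hp.smoothOnRegion_opT_iterate hg n)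

theorem Represents.starDeriv {p : KNdS} (hp : p.Subextremal) {r0 : ℝ}
    (hr0 : r0 ∈ Ioo p.rm p.rp) {g : ℝ × ℝ → ℝ} (hg : p.SmoothOnRegion g) {u : ℝ → ℝ → ℝ}
    (hu : p.Represents r0 g u) (m n : ℕ) :
    p.Represents r0 (p.opR^[m] (p.opT^[n] g)) (KNdS.starDeriv m n u) :=
  (hu.dT_iterate hp hr0 hg n).dR_iterate hp hr0 (hp.smoothOnRegion_opT_iterate hg n) m

/-! ### Continuity up to the boundary -/

theorem smoothOnRegion_fst (p : KNdS) : p.SmoothOnRegion Prod.fst := fun _ _ => contDiffAt_fst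

theorem represents_rOf (p : KNdS) (r0 : ℝ) : p.Represents r0 Prod.fst (p.rOf r0) :=
  fun _ _ _ => rfl

/-- Both partial derivatives are bounded on the strip, which is convex; the Lipschitz bound provides
the continuous extension to θ⋆ = 0 and θ⋆ = π/2. -/
theorem Subextremal.exists_lipschitzOnWith_rOf {p : KNdS} (hp : p.Subextremal) {r0 : ℝ}
    (hr0 : r0 ∈ Ioo p.rm p.rp) : ∃ K, LipschitzOnWith K (fun z : ℝ × ℝ => p.rOf r0 z.1 z.2)
      (univ ×ˢ Ioo 0 (Real.pi / 2)) := by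
  obtain ⟨C₁, hC₁, h1⟩ := (hp.smoothOnRegion_opR p.smoothOnRegion_fst).exists_bound
  obtain ⟨C₂, hC₂, h2⟩ := (hp.smoothOnRegion_opT p.smoothOnRegion_fst).exists_bound
  refine ⟨(C₁ + C₂).toNNReal, LipschitzOnWith.of_dist_le_mul fun z hz w hw => ?_⟩
  rw [Real.coe_toNNReal _ (by positivity), Real.dist_eq]
  have e1 : |p.rOf r0 z.1 z.2 - p.rOf r0 w.1 z.2| ≤ C₁ * |z.1 - w.1| :=
    Convex.norm_image_sub_le_of_norm_hasDerivWithin_le (f := fun t => p.rOf r0 t z.2)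
      (fun x _ => ((p.represents_rOf r0).hasDerivAt_fst hp hr0 p.smoothOnRegion_fst x
        hz.2).hasDerivWithinAt) (fun x _ => h1 _ (hp.rOf_mem_region hr0 x hz.2))
      convex_univ (mem_univ w.1) (mem_univ z.1)
  have e2 : |p.rOf r0 w.1 z.2 - p.rOf r0 w.1 w.2| ≤ C₂ * |z.2 - w.2| := by
    refine Convex.norm_image_sub_le_of_norm_hasDerivWithin_le (f := fun t => p.rOf r0 w.1 t)
      (fun y hy => ((p.represents_rOf r0).hasDerivAt_snd hp hr0 p.smoothOnRegion_fst w.1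
        hy).hasDerivWithinAt) (fun y hy => ?_) (convex_Ioo 0 (Real.pi / 2)) hw.2 hz.2
    rw [Real.norm_eq_abs, abs_mul]
    calc _ ≤ 1 * C₂ := mul_le_mul (Real.abs_sin_le_one _)
          (h2 _ (hp.rOf_mem_region hr0 w.1 hy)) (abs_nonneg _) zero_le_one
      _ = C₂ := one_mul _
  have e3 : |z.1 - w.1| ≤ dist z w := le_max_left _ _
  have e4 : |z.2 - w.2| ≤ dist z w := le_max_right _ _
  calc |p.rOf r0 z.1 z.2 - p.rOf r0 w.1 w.2|
      ≤ |p.rOf r0 z.1 z.2 - p.rOf r0 w.1 z.2| + |p.rOf r0 w.1 z.2 - p.rOf r0 w.1 w.2| :=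
        abs_sub_le _ _ _
    _ ≤ C₁ * dist z w + C₂ * dist z w :=
        add_le_add (e1.trans (mul_le_mul_of_nonneg_left e3 hC₁))
          (e2.trans (mul_le_mul_of_nonneg_left e4 hC₂))
    _ = (C₁ + C₂) * dist z w := by ring

theorem Represents.continuousUpToBoundary {p : KNdS} (hp : p.Subextremal) {r0 : ℝ}
    (hr0 : r0 ∈ Ioo p.rm p.rp) {g : ℝ × ℝ → ℝ} (hg : p.SmoothOnRegion g) {u : ℝ → ℝ → ℝ}
    (hu : p.Represents r0 g u) : ContinuousUpToBoundary u := by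
  obtain ⟨K, hK⟩ := hp.exists_lipschitzOnWith_rOf hr0
  obtain ⟨R, hR, hRe⟩ := hK.extend_real
  have hmp := hp.2.2.2.1
  -- The Lipschitz extension may leave [rm, rp] outside the strip. Truncating it keeps the argument
  -- of `g` in the rectangle, where `g` is continuous, and changes nothing on the strip.
  refine ⟨fun z => g (max p.rm (min p.rp (R z)), Real.sin z.2 ^ 2), ?_, fun x y hy => ?_⟩
  · refine ContinuousOn.comp (g := g) (t := p.region)
      (f := fun z : ℝ × ℝ => (max p.rm (min p.rp (R z)), Real.sin z.2 ^ 2)) hg.continuousOn ?_ ?_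
    · have := hR.continuous
      exact Continuous.continuousOn (by fun_prop)
    · intro z _
      exact ⟨⟨le_max_left _ _, max_le hmp.le (min_le_left _ _)⟩, sq_nonneg _, Real.sin_sq_le_one _⟩
  · have h1 := (hp.starInv_spec hr0 x hy).1
    have h2 : p.rOf r0 x y = R (x, y) := hRe (Set.mk_mem_prod (mem_univ x) hy)
    rw [hu x y hy]
    dsimp only
    rw [← h2, min_eq_right h1.2.le, max_eq_right h1.1.le]

theorem Represents.isStarC {p : KNdS} (hp : p.Subextremal) {r0 : ℝ} (hr0 : r0 ∈ Ioo p.rm p.rp)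
    (n : ℕ) : ∀ {g : ℝ × ℝ → ℝ} {u : ℝ → ℝ → ℝ}, p.SmoothOnRegion g → p.Represents r0 g u →
      IsStarC n u := by
  induction n with
  | zero => exact fun hg hu => hu.continuousUpToBoundary hp hr0 hg
  | succ n ih =>
    intro g u hg hu
    exact ⟨hu.continuousUpToBoundary hp hr0 hg, fun x y hy =>
      ⟨(hu.hasDerivAt_fst hp hr0 hg x hy).differentiableAt,
        (hu.hasDerivAt_snd hp hr0 hg x hy).differentiableAt⟩,
      ih (hp.smoothOnRegion_opR hg) (hu.dR hp hr0 hg),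
      ih (hp.smoothOnRegion_opT hg) (hu.dT hp hr0 hg)⟩

theorem Represents.isStarSmooth {p : KNdS} (hp : p.Subextremal) {r0 : ℝ}
    (hr0 : r0 ∈ Ioo p.rm p.rp) {g : ℝ × ℝ → ℝ} (hg : p.SmoothOnRegion g) {u : ℝ → ℝ → ℝ}
    (hu : p.Represents r0 g u) : IsStarSmooth u := fun n => Represents.isStarC hp hr0 n hg hu

/-! ### Bounds that are uniform in `r0` and in the star coordinates -/

/-- `|u| ≤ C B` on `ℝ × (0, π/2)` with a constant that does not depend on `r0`. -/
def BoundedBy (p : KNdS) (u B : ℝ → ℝ → ℝ → ℝ) : Prop :=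
  ∃ C, 0 ≤ C ∧ ∀ r0 ∈ Ioo p.rm p.rp, ∀ x : ℝ, ∀ y ∈ Ioo 0 (Real.pi / 2),
    |u r0 x y| ≤ C * B r0 x y

theorem BoundedBy.sum {p : KNdS} {ι : Type*} (s : Finset ι) {u : ι → ℝ → ℝ → ℝ → ℝ}
    {B : ℝ → ℝ → ℝ → ℝ} (h : ∀ j ∈ s, p.BoundedBy (u j) B) :
    ∃ C, 0 ≤ C ∧ ∀ r0 ∈ Ioo p.rm p.rp, ∀ x : ℝ, ∀ y ∈ Ioo 0 (Real.pi / 2),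
      ∑ j ∈ s, |u j r0 x y| ≤ C * B r0 x y := by
  choose! C hC0 hC using h
  refine ⟨∑ j ∈ s, C j, Finset.sum_nonneg hC0, fun r0 hr0 x y hy => ?_⟩
  rw [Finset.sum_mul]
  exact Finset.sum_le_sum fun j hj => hC j hj r0 hr0 x y hy

theorem Subextremal.boundedBy_one {p : KNdS} (hp : p.Subextremal) {g : ℝ × ℝ → ℝ}
    (hg : p.SmoothOnRegion g) {u : ℝ → ℝ → ℝ → ℝ}
    (hu : ∀ r0 ∈ Ioo p.rm p.rp, p.Represents r0 g (u r0)) :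
    p.BoundedBy u fun _ _ _ => 1 := by
  obtain ⟨C, hC0, hC⟩ := hg.exists_bound
  refine ⟨C, hC0, fun r0 hr0 x y hy => ?_⟩
  rw [hu r0 hr0 x y hy, mul_one]
  exact hC _ (hp.rOf_mem_region hr0 x hy)

theorem Subextremal.boundedBy_deltaR {p : KNdS} (hp : p.Subextremal) {g : ℝ × ℝ → ℝ}
    (hg : p.SmoothOnRegion g) {u : ℝ → ℝ → ℝ → ℝ}
    (hu : ∀ r0 ∈ Ioo p.rm p.rp, p.Represents r0 (fun z => p.deltaR z.1 * g z) (u r0)) :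
    p.BoundedBy u fun r0 x y => |p.deltaR (p.rOf r0 x y)| := by
  obtain ⟨C, hC0, hC⟩ := hg.exists_bound
  refine ⟨C, hC0, fun r0 hr0 x y hy => ?_⟩
  rw [hu r0 hr0 x y hy, abs_mul, mul_comm]
  exact mul_le_mul_of_nonneg_right (hC _ (hp.rOf_mem_region hr0 x hy)) (abs_nonneg _)

theorem Subextremal.boundedBy_starDeriv_snd {p : KNdS} (hp : p.Subextremal) {g : ℝ × ℝ → ℝ}
    (hg : p.SmoothOnRegion g) {u : ℝ → ℝ → ℝ → ℝ}
    (hu : ∀ r0 ∈ Ioo p.rm p.rp, p.Represents r0 g (u r0)) (n : ℕ) :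
    p.BoundedBy (fun r0 => KNdS.starDeriv 0 n (u r0)) fun _ _ _ => 1 :=
  hp.boundedBy_one (hp.smoothOnRegion_opT_iterate hg n) fun r0 hr0 =>
    (hu r0 hr0).starDeriv hp hr0 hg 0 n

/-- The outermost ∂_{r⋆} acts as `opR`, which multiplies by Δ_r; the other factor is smooth on a
compact set. -/
theorem Subextremal.boundedBy_starDeriv_fst {p : KNdS} (hp : p.Subextremal) {g : ℝ × ℝ → ℝ}
    (hg : p.SmoothOnRegion g) {u : ℝ → ℝ → ℝ → ℝ}
    (hu : ∀ r0 ∈ Ioo p.rm p.rp, p.Represents r0 g (u r0)) {m : ℕ} (hm : 1 ≤ m) (n : ℕ) :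
    p.BoundedBy (fun r0 => KNdS.starDeriv m n (u r0))
      fun r0 x y => |p.deltaR (p.rOf r0 x y)| := by
  obtain ⟨m, rfl⟩ := Nat.exists_eq_add_of_le' hm
  have h := hp.smoothOnRegion_opR_iterate (hp.smoothOnRegion_opT_iterate hg n) m
  refine hp.boundedBy_deltaR (h.partialFst.mul hp.smoothOnRegion_coefR) fun r0 hr0 => ?_
  have := (hu r0 hr0).starDeriv hp hr0 hg (m + 1) n
  rwa [Function.iterate_succ_apply'] at this

theorem partialFst_mul {g h : ℝ × ℝ → ℝ} {z : ℝ × ℝ} (hg : DifferentiableAt ℝ g z)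
    (hh : DifferentiableAt ℝ h z) :
    partialFst (fun z => g z * h z) z = g z * partialFst h z + h z * partialFst g z := by
  simp [partialFst, fderiv_fun_mul hg hh]

theorem partialSnd_mul {g h : ℝ × ℝ → ℝ} {z : ℝ × ℝ} (hg : DifferentiableAt ℝ g z)
    (hh : DifferentiableAt ℝ h z) :
    partialSnd (fun z => g z * h z) z = g z * partialSnd h z + h z * partialSnd g z := by
  simp [partialSnd, fderiv_fun_mul hg hh]

/-- The first T kills the ∂₂ term, since r does not depend on l, and produces Δ_r. Later ones keep
the factor, because ∂₂Δ_r = 0 and the other term of `opT` has Δ_r explicitly. -/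
theorem Subextremal.exists_represents_dT_iterate_rOf {p : KNdS} (hp : p.Subextremal) (n : ℕ) :
    ∃ H, p.SmoothOnRegion H ∧ ∀ r0 ∈ Ioo p.rm p.rp,
      p.Represents r0 (fun z => p.deltaR z.1 * H z) (KNdS.dT^[n + 1] (p.rOf r0)) := by
  induction n with
  | zero =>
    refine ⟨fun z => partialFst Prod.fst z * p.coefT z,
      p.smoothOnRegion_fst.partialFst.mul hp.smoothOnRegion_coefT, fun r0 hr0 x y hy => ?_⟩
    have := (p.represents_rOf r0).dT hp hr0 p.smoothOnRegion_fst x y hy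
    rw [Function.iterate_succ_apply', Function.iterate_zero_apply, this, opT]
    simp [partialSnd, fderiv_fst]
  | succ n ih =>
    obtain ⟨H, hH, hr⟩ := ih
    have hΔ := p.smoothOnRegion_deltaR
    refine ⟨fun z => partialSnd H z + (p.deltaR z.1 * partialFst H z +
        H z * partialFst (fun z => p.deltaR z.1) z) * p.coefT z,
      hH.partialSnd.add (((hΔ.mul hH.partialFst).add (hH.mul hΔ.partialFst)).mul
        hp.smoothOnRegion_coefT), fun r0 hr0 x y hy => ?_⟩
    rw [Function.iterate_succ_apply', (hr r0 hr0).dT hp hr0 (hΔ.mul hH) x y hy, opT]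
    have hz := hp.rOf_mem_region hr0 x hy
    rw [partialFst_mul (hΔ.differentiableAt hz) (hH.differentiableAt hz),
      partialSnd_mul (hΔ.differentiableAt hz) (hH.differentiableAt hz)]
    have h0 : partialSnd (fun z => p.deltaR z.1) (p.rOf r0 x y, Real.sin y ^ 2) = 0 :=
      (hΔ.differentiableAt hz).hasDerivAt_partialSnd.unique
        (hasDerivAt_const _ (p.deltaR (p.rOf r0 x y)))
    rw [h0]
    ring

theorem Subextremal.boundedBy_starDeriv_rOf {p : KNdS} (hp : p.Subextremal) {m n : ℕ}
    (h : 1 ≤ m + n) : p.BoundedBy (fun r0 => KNdS.starDeriv m n (p.rOf r0))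
      fun r0 x y => |p.deltaR (p.rOf r0 x y)| := by
  rcases Nat.eq_zero_or_pos m with rfl | hm
  · obtain ⟨n, rfl⟩ := Nat.exists_eq_add_of_le' (show 1 ≤ n by omega)
    obtain ⟨H, hH, hr⟩ := hp.exists_represents_dT_iterate_rOf n
    exact hp.boundedBy_deltaR hH hr
  · exact hp.boundedBy_starDeriv_fst p.smoothOnRegion_fst (fun r0 _ => p.represents_rOf r0) hm n

/-! ### The function `θ` -/

/-- `∂θ/∂r⋆ / (sin 2θ⋆ Δ_r)`. -/
noncomputable def thetaCoef (p : KNdS) (z : ℝ × ℝ) : ℝ :=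
  p.ampOf z / p.Qhat z.1 z.2 * p.coefR z

theorem Subextremal.smoothOnRegion_thetaCoef {p : KNdS} (hp : p.Subextremal) :
    p.SmoothOnRegion p.thetaCoef := fun z hz =>
  ((hp.smoothOnRegion_ampOf z hz).div (hp.smoothOnRegion_Qhat z hz)
    (hp.Qhat_pos hz.1 hz.2.1).ne').mul (hp.smoothOnRegion_coefR z hz)

theorem Subextremal.hasDerivAt_thetaOf_fst {p : KNdS} (hp : p.Subextremal) {r0 : ℝ}
    (hr0 : r0 ∈ Ioo p.rm p.rp) (x : ℝ) {y : ℝ} (hy : y ∈ Ioo 0 (Real.pi / 2)) :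
    HasDerivAt (fun t => p.thetaOf r0 t y) (Real.sin (2 * y) *
      (p.deltaR (p.rOf r0 x y) * p.thetaCoef (p.rOf r0 x y, Real.sin y ^ 2))) x := by
  have h := (hp.hasDerivAt_ang_fst (hp.starInv_spec hr0 x hy).1 hy).comp x
    (hp.hasDerivAt_rOf_fst hr0 x hy)
  refine (h.congr_of_eventuallyEq (Eventually.of_forall fun t =>
    (hp.starInv_spec hr0 t hy).2.2)).congr_deriv ?_
  rw [thetaCoef]
  ring

/-- The calculus of `Represents` is not applied to θ = arctan(τ tan θ⋆) directly. Its r⋆-derivative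
is sin 2θ⋆ times a represented function, and sin 2θ⋆ is constant for further ∂_{r⋆}. -/
theorem Subextremal.dR_iterate_thetaOf {p : KNdS} (hp : p.Subextremal) {r0 : ℝ}
    (hr0 : r0 ∈ Ioo p.rm p.rp) (n : ℕ) (x : ℝ) {y : ℝ} (hy : y ∈ Ioo 0 (Real.pi / 2)) :
    KNdS.dR^[n + 1] (p.thetaOf r0) x y = Real.sin (2 * y) *
      p.opR^[n] (fun z => p.deltaR z.1 * p.thetaCoef z) (p.rOf r0 x y, Real.sin y ^ 2) := by
  have hs := p.smoothOnRegion_deltaR.mul hp.smoothOnRegion_thetaCoef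
  induction n generalizing x with
  | zero =>
    rw [Function.iterate_succ_apply']
    exact (hp.hasDerivAt_thetaOf_fst hr0 x hy).deriv
  | succ n ih =>
    rw [Function.iterate_succ_apply', KNdS.dR]
    simp only [ih]
    rw [Function.iterate_succ_apply']
    exact ((hp.hasDerivAt_comp_fst hr0 (hp.smoothOnRegion_opR_iterate hs n) x hy).const_mul
      _).deriv

theorem Subextremal.differentiableAt_dR_iterate_thetaOf {p : KNdS} (hp : p.Subextremal) {r0 : ℝ}
    (hr0 : r0 ∈ Ioo p.rm p.rp) (n : ℕ) (x : ℝ) {y : ℝ} (hy : y ∈ Ioo 0 (Real.pi / 2)) :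
    DifferentiableAt ℝ (fun t => KNdS.dR^[n] (p.thetaOf r0) t y) x := by
  cases n with
  | zero => exact (hp.hasDerivAt_thetaOf_fst hr0 x hy).differentiableAt
  | succ n =>
    have hs := p.smoothOnRegion_deltaR.mul hp.smoothOnRegion_thetaCoef
    simp only [hp.dR_iterate_thetaOf hr0 n _ hy]
    exact ((hp.hasDerivAt_comp_fst hr0 (hp.smoothOnRegion_opR_iterate hs n) x
      hy).const_mul _).differentiableAt

theorem Subextremal.boundedBy_starDeriv_thetaOf {p : KNdS} (hp : p.Subextremal) {n : ℕ}
    (hn : 1 ≤ n) : p.BoundedBy (fun r0 => KNdS.starDeriv n 0 (p.thetaOf r0))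
      fun r0 x y => |p.deltaR (p.rOf r0 x y)| * Real.sin (2 * y) := by
  obtain ⟨n, rfl⟩ := Nat.exists_eq_add_of_le' hn
  have hs := p.smoothOnRegion_deltaR.mul hp.smoothOnRegion_thetaCoef
  obtain ⟨H, hH, e⟩ : ∃ H, p.SmoothOnRegion H ∧
      p.opR^[n] (fun z => p.deltaR z.1 * p.thetaCoef z) = fun z => p.deltaR z.1 * H z := by
    cases n with
    | zero => exact ⟨_, hp.smoothOnRegion_thetaCoef, rfl⟩
    | succ n =>
      rw [Function.iterate_succ_apply']
      exact ⟨_, (hp.smoothOnRegion_opR_iterate hs n).partialFst.mul hp.smoothOnRegion_coefR, rfl⟩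
  obtain ⟨C, hC0, hC⟩ := hH.exists_bound
  refine ⟨C, hC0, fun r0 hr0 x y hy => ?_⟩
  have h2 := sin_two_mul_pos hy
  change |KNdS.dR^[n + 1] (p.thetaOf r0) x y| ≤ _
  rw [hp.dR_iterate_thetaOf hr0 n x hy, e, abs_mul,
    abs_of_pos h2, abs_mul]
  calc _ = |p.deltaR (p.rOf r0 x y)| * Real.sin (2 * y) *
        |H (p.rOf r0 x y, Real.sin y ^ 2)| := by ring
    _ ≤ |p.deltaR (p.rOf r0 x y)| * Real.sin (2 * y) * C :=
        mul_le_mul_of_nonneg_left (hC _ (hp.rOf_mem_region hr0 x hy)) (by positivity)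
    _ = _ := by ring

/-! ### The function `∂θ/∂θ⋆` -/

/-- Here r⋆, not r, is held fixed, so τ varies with slope sin 2θ⋆ · `opT` τ instead of sin 2θ⋆ ·
∂₂τ. -/
theorem Subextremal.hasDerivAt_thetaOf_snd {p : KNdS} (hp : p.Subextremal) {r0 : ℝ}
    (hr0 : r0 ∈ Ioo p.rm p.rp) (x : ℝ) {y : ℝ} (hy : y ∈ Ioo 0 (Real.pi / 2)) :
    HasDerivAt (fun t => p.thetaOf r0 x t)
      (p.angSlope (p.opT p.ratio (p.rOf r0 x y, Real.sin y ^ 2))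
        (p.rOf r0 x y, Real.sin y ^ 2)) y := by
  refine (hasDerivAt_arctan_mul_tan (τ := fun t => p.ratio (p.rOf r0 x t, Real.sin t ^ 2)) hy
    (hp.hasDerivAt_comp_snd hr0 hp.smoothOnRegion_ratio x hy)).congr_of_eventuallyEq ?_
  filter_upwards [Ioo_mem_nhds hy.1 hy.2] with t ht
  exact (hp.starInv_spec hr0 x ht).2.2

theorem Subextremal.represents_dthetaOf {p : KNdS} (hp : p.Subextremal) {r0 : ℝ}
    (hr0 : r0 ∈ Ioo p.rm p.rp) :
    p.Represents r0 (fun z => p.angSlope (p.opT p.ratio z) z) (p.dthetaOf r0) := fun x _ hy =>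
  (hp.hasDerivAt_thetaOf_snd hr0 x hy).deriv

/-! ### The function `L` -/

/-- `L` as a function of `(r, sin² θ⋆)`. -/
noncomputable def lFun (p : KNdS) (z : ℝ × ℝ) : ℝ :=
  p.Qhat z.1 z.2 * p.ampOf z *
    (1 / p.a * (2 * p.ker (p.ratio z, z.2) * p.ratio z +
      4 * z.2 * (1 - z.2) * partialSnd p.ellInt (p.ratio z, z.2)) -
      4 * z.2 * (1 - z.2) * partialSnd p.radialInt z)

theorem Subextremal.smoothOnRegion_lFun {p : KNdS} (hp : p.Subextremal) :
    p.SmoothOnRegion p.lFun := fun z hz => by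
  have h1 := hp.smoothOnRegion_ratio z hz
  have h2 := hp.smoothOnRegion_Qhat z hz
  have h3 := hp.smoothOnRegion_ampOf z hz
  have hc : ContDiffAt ℝ ∞ (fun z => (p.ratio z, z.2)) z := h1.prodMk contDiffAt_snd
  have hd := hp.ratio_mem_kerDom hz
  have h4 : ContDiffAt ℝ ∞ (fun z => p.ker (p.ratio z, z.2)) z :=
    ContDiffAt.comp (g := p.ker) (f := fun z => (p.ratio z, z.2)) z (contDiffAt_ker hd) hc
  have h5 : ContDiffAt ℝ ∞ (fun z => partialSnd p.ellInt (p.ratio z, z.2)) z :=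
    ContDiffAt.comp (g := partialSnd p.ellInt) (f := fun z => (p.ratio z, z.2)) z
      ((hp.contDiffAt_ellInt (hp.ratio_mem hz).1.le hd).partialSnd (m := ∞) (by simp)) hc
  have h6 := hp.smoothOnRegion_radialInt.partialSnd z hz
  unfold lFun
  fun_prop

theorem Subextremal.ratio_lt_one {p : KNdS} (hp : p.Subextremal) {r l : ℝ}
    (hr : r ∈ Ioo p.rm p.rp) (hl : l ∈ Icc (0 : ℝ) 1) : p.ratio (r, l) < 1 := by
  have hz : (r, l) ∈ p.region := ⟨Ioo_subset_Icc_self hr, hl⟩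
  refine lt_of_le_of_ne (hp.ratio_mem hz).2 fun h => ?_
  have h1 := hp.ellInt_ratio hz
  dsimp only at h1
  rw [h, ellInt_one] at h1
  exact (mul_pos hp.2.1 (hp.radialInt_pos ⟨hr.1.le, hr.2⟩ hl.1)).ne h1

/-- Strictness leaves room on both sides of θ⋆ for `F_eq`, so that F can be differentiated in θ⋆
there. -/
theorem Subextremal.ang_lt {p : KNdS} (hp : p.Subextremal) {r y : ℝ}
    (hr : r ∈ Ioo p.rm p.rp) (hy : y ∈ Ioo 0 (Real.pi / 2)) : p.ang r y < y := by
  have ht := Real.tan_pos_of_pos_of_lt_pi_div_two hy.1 hy.2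
  calc p.ang r y < Real.arctan (Real.tan y) := Real.arctan_strictMono
        (mul_lt_of_lt_one_left ht (hp.ratio_lt_one hr (mk_mem_region (Ioo_subset_Icc_self hr) hy).2))
    _ = y := Real.arctan_tan (by linarith [hy.1, Real.pi_pos]) hy.2

/-- Differentiate `F_eq` in θ⋆ with r and θ fixed. The lower limit tan θ / tan θ⋆ contributes the
only singular term, of order 1/(sin θ⋆ cos θ⋆). -/
theorem Subextremal.G_ang {p : KNdS} (hp : p.Subextremal) {r y : ℝ}
    (hr : r ∈ Ioo p.rm p.rp) (hy : y ∈ Ioo 0 (Real.pi / 2)) :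
    p.G r (p.ang r y) y = Real.sin (2 * y) * partialSnd p.radialInt (r, Real.sin y ^ 2) -
      (p.ker (p.ratio (r, Real.sin y ^ 2), Real.sin y ^ 2) *
        (p.ratio (r, Real.sin y ^ 2) / (Real.sin y * Real.cos y)) +
        Real.sin (2 * y) *
          partialSnd p.ellInt (p.ratio (r, Real.sin y ^ 2), Real.sin y ^ 2)) / p.a := by
  have hr' := Ioo_subset_Icc_self hr
  have hz := mk_mem_region hr' hy
  have hθ := hp.ang_mem hr' hy
  have hlt := hp.ang_lt hr hy
  have ht := Real.tan_pos_of_pos_of_lt_pi_div_two hy.1 hy.2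
  have hs := sin_pos_of_mem hy
  have hc := (cos_pos_of_mem ⟨hy.1.le, hy.2⟩)
  have hρ := hp.ratio_mem hz
  have hd := hp.ratio_mem_kerDom hz
  have eρ : Real.tan (p.ang r y) / Real.tan y = p.ratio (r, Real.sin y ^ 2) := by
    rw [p.tan_ang, mul_div_cancel_right₀ _ ht.ne']
  have d1 : HasDerivAt (fun t => Real.tan (p.ang r y) / Real.tan t)
      (-(p.ratio (r, Real.sin y ^ 2) / (Real.sin y * Real.cos y))) y := by
    refine ((hasDerivAt_const y (Real.tan (p.ang r y))).fun_div
      (Real.hasDerivAt_tan hc.ne') ht.ne').congr_deriv ?_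
    rw [p.tan_ang, Real.tan_eq_sin_div_cos]
    field_simp
    ring
  have h1 : DifferentiableAt ℝ p.ellInt (Real.tan (p.ang r y) / Real.tan y, Real.sin y ^ 2) := by
    rw [eρ]
    exact (hp.contDiffAt_ellInt hρ.1.le hd).differentiableAt (by simp)
  have d2 := DifferentiableAt.hasDerivAt_comp₂ (u := fun t => Real.tan (p.ang r y) / Real.tan t)
    (v := fun t => Real.sin t ^ 2) h1 d1 (hasDerivAt_sin_sq y)
  have d3 := DifferentiableAt.hasDerivAt_comp₂ (u := fun _ => r)
    (v := fun t => Real.sin t ^ 2) (hp.smoothOnRegion_radialInt.differentiableAt hz)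
    (hasDerivAt_const y r) (hasDerivAt_sin_sq y)
  have d4 := (d3.sub (d2.div_const p.a)).congr_of_eventuallyEq
    (f₁ := fun t => p.F r (p.ang r y) t) (by
      filter_upwards [Ioo_mem_nhds hlt hy.2] with t ht
      exact hp.F_eq r ⟨hθ.1.le, ht.1.le⟩ ⟨hθ.1.trans ht.1, ht.2⟩)
  rw [G, d4.deriv]
  simp only [eρ]
  have e := hp.partialFst_ellInt hρ.1.le hd
  dsimp only at e
  rw [e]
  ring

/-- The factor sin 2θ⋆ of P removes the singular term of G and turns the remaining factors sin 2θ⋆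
into sin² 2θ⋆ = 4l(1 − l), so only l is left. -/
theorem Subextremal.represents_LOf {p : KNdS} (hp : p.Subextremal) {r0 : ℝ}
    (hr0 : r0 ∈ Ioo p.rm p.rp) : p.Represents r0 p.lFun (p.LOf r0) := fun x y hy => by
  obtain ⟨hr, -, hθ⟩ := hp.starInv_spec hr0 x hy
  have hr' := Ioo_subset_Icc_self hr
  have hs := sin_pos_of_mem hy
  have hc := (cos_pos_of_mem ⟨hy.1.le, hy.2⟩)
  have ha := hp.2.1
  rw [LOf, L, hθ, hp.G_ang hr hy, P, Q, hp.Phat_ang hr' hy, lFun]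
  dsimp only
  rw [← Real.cos_sq' y, Real.sin_two_mul]
  field_simp
  ring

/-! ### The lemma -/

/-- The constants do not depend on r0: it enters only through the coordinate r⋆, while the functions
of (r, l) that represent the derivatives do not involve it. -/
theorem Subextremal.exists_uniform_bound {p : KNdS} (hp : p.Subextremal) (k : ℕ) :
    ∃ C : ℝ, ∀ r0 ∈ Ioo p.rm p.rp, ∀ x : ℝ, ∀ y ∈ Ioo 0 (Real.pi / 2),
      (∑ j ∈ (Finset.range (k + 1) ×ˢ Finset.range (k + 1)).filter
          (fun j => 1 ≤ j.1 + j.2 ∧ j.1 + j.2 ≤ k),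
        |starDeriv j.1 j.2 (p.rOf r0) x y|) ≤ C * |p.deltaR (p.rOf r0 x y)| ∧
      (∑ j ∈ Finset.Icc 1 k, |starDeriv j 0 (p.thetaOf r0) x y|)
        ≤ C * (|p.deltaR (p.rOf r0 x y)| * Real.sin (2 * y)) ∧
      (∑ j ∈ Finset.Icc 0 (k - 1), |starDeriv 0 j (p.dthetaOf r0) x y|) ≤ C ∧
      (∑ j ∈ (Finset.range k ×ˢ Finset.range k).filter
          (fun j => 1 ≤ j.1 ∧ j.1 + j.2 ≤ k - 1),
        |starDeriv j.1 j.2 (p.dthetaOf r0) x y|) ≤ C * |p.deltaR (p.rOf r0 x y)| ∧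
      (∑ j ∈ Finset.Icc 0 (k - 1), |starDeriv 0 j (p.LOf r0) x y|) ≤ C ∧
      (∑ j ∈ (Finset.range k ×ˢ Finset.range k).filter
          (fun j => 1 ≤ j.1 ∧ j.1 + j.2 ≤ k - 1),
        |starDeriv j.1 j.2 (p.LOf r0) x y|) ≤ C * |p.deltaR (p.rOf r0 x y)| := by
  have hD := hp.smoothOnRegion_angSlope (hp.smoothOnRegion_opT hp.smoothOnRegion_ratio)
  have hL := hp.smoothOnRegion_lFun
  have rD : ∀ r0 ∈ Ioo p.rm p.rp, p.Represents r0 _ (p.dthetaOf r0) := fun r0 h =>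
    hp.represents_dthetaOf h
  have rL : ∀ r0 ∈ Ioo p.rm p.rp, p.Represents r0 _ (p.LOf r0) := fun r0 h =>
    hp.represents_LOf h
  obtain ⟨C₁, n₁, h₁⟩ := BoundedBy.sum ((Finset.range (k + 1) ×ˢ Finset.range (k + 1)).filter
    (fun j => 1 ≤ j.1 + j.2 ∧ j.1 + j.2 ≤ k)) fun j hj =>
    hp.boundedBy_starDeriv_rOf (m := j.1) (n := j.2) (Finset.mem_filter.1 hj).2.1
  obtain ⟨C₂, n₂, h₂⟩ := BoundedBy.sum (Finset.Icc 1 k) fun j hj =>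
    hp.boundedBy_starDeriv_thetaOf (n := j) (Finset.mem_Icc.1 hj).1
  obtain ⟨C₃, n₃, h₃⟩ := BoundedBy.sum (Finset.Icc 0 (k - 1)) fun j _ =>
    hp.boundedBy_starDeriv_snd hD rD j
  obtain ⟨C₄, n₄, h₄⟩ := BoundedBy.sum ((Finset.range k ×ˢ Finset.range k).filter
    (fun j => 1 ≤ j.1 ∧ j.1 + j.2 ≤ k - 1)) fun j hj =>
    hp.boundedBy_starDeriv_fst hD rD (Finset.mem_filter.1 hj).2.1 j.2
  obtain ⟨C₅, n₅, h₅⟩ := BoundedBy.sum (Finset.Icc 0 (k - 1)) fun j _ =>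
    hp.boundedBy_starDeriv_snd hL rL j
  obtain ⟨C₆, n₆, h₆⟩ := BoundedBy.sum ((Finset.range k ×ˢ Finset.range k).filter
    (fun j => 1 ≤ j.1 ∧ j.1 + j.2 ≤ k - 1)) fun j hj =>
    hp.boundedBy_starDeriv_fst hL rL (Finset.mem_filter.1 hj).2.1 j.2
  refine ⟨C₁ + C₂ + C₃ + C₄ + C₅ + C₆, fun r0 hr0 x y hy => ?_⟩
  have hs := (sin_two_mul_pos hy).le
  have hΔ := abs_nonneg (p.deltaR (p.rOf r0 x y))
  refine ⟨(h₁ r0 hr0 x y hy).trans ?_, (h₂ r0 hr0 x y hy).trans ?_, (h₃ r0 hr0 x y hy).trans ?_,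
    (h₄ r0 hr0 x y hy).trans ?_, (h₅ r0 hr0 x y hy).trans ?_, (h₆ r0 hr0 x y hy).trans ?_⟩
  · exact mul_le_mul_of_nonneg_right (by linarith) hΔ
  · exact mul_le_mul_of_nonneg_right (by linarith) (mul_nonneg hΔ hs)
  · linarith
  · exact mul_le_mul_of_nonneg_right (by linarith) hΔ
  · linarith
  · exact mul_le_mul_of_nonneg_right (by linarith) hΔ

end KNdS

end

theorem lemmaA6 (p : KNdS) (hp : p.Subextremal) :
    -- regularity
    (∀ r0 ∈ Set.Ioo p.rm p.rp,
      KNdS.IsStarSmooth (p.rOf r0) ∧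
      KNdS.IsStarSmooth (p.dthetaOf r0) ∧
      KNdS.IsStarSmooth (p.LOf r0) ∧
      -- the derivatives of `θ` that occur below exist
      (∀ x : ℝ, ∀ y ∈ Set.Ioo 0 (Real.pi / 2),
        DifferentiableAt ℝ (fun t => p.thetaOf r0 x t) y ∧
        ∀ n : ℕ, DifferentiableAt ℝ (fun t => KNdS.starDeriv n 0 (p.thetaOf r0) t y) x)) ∧
    -- bounds
    ∀ k : ℕ, 2 ≤ k → ∃ C : ℝ, ∀ r0 ∈ Set.Ioo p.rm p.rp,
      ∀ x : ℝ, ∀ y ∈ Set.Ioo 0 (Real.pi / 2),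
        (∑ j ∈ (Finset.range (k + 1) ×ˢ Finset.range (k + 1)).filter
            (fun j => 1 ≤ j.1 + j.2 ∧ j.1 + j.2 ≤ k),
          |KNdS.starDeriv j.1 j.2 (p.rOf r0) x y|) ≤ C * |p.deltaR (p.rOf r0 x y)| ∧
        (∑ j ∈ Finset.Icc 1 k, |KNdS.starDeriv j 0 (p.thetaOf r0) x y|)
          ≤ C * (|p.deltaR (p.rOf r0 x y)| * Real.sin (2 * y)) ∧
        (∑ j ∈ Finset.Icc 0 (k - 1), |KNdS.starDeriv 0 j (p.dthetaOf r0) x y|) ≤ C ∧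
        (∑ j ∈ (Finset.range k ×ˢ Finset.range k).filter
            (fun j => 1 ≤ j.1 ∧ j.1 + j.2 ≤ k - 1),
          |KNdS.starDeriv j.1 j.2 (p.dthetaOf r0) x y|) ≤ C * |p.deltaR (p.rOf r0 x y)| ∧
        (∑ j ∈ Finset.Icc 0 (k - 1), |KNdS.starDeriv 0 j (p.LOf r0) x y|) ≤ C ∧
        (∑ j ∈ (Finset.range k ×ˢ Finset.range k).filter
            (fun j => 1 ≤ j.1 ∧ j.1 + j.2 ≤ k - 1),
          |KNdS.starDeriv j.1 j.2 (p.LOf r0) x y|) ≤ C * |p.deltaR (p.rOf r0 x y)| := by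
  refine ⟨fun r0 hr0 => ⟨?_, ?_, ?_, fun x y hy => ⟨?_, fun n => ?_⟩⟩,
    fun k _ => hp.exists_uniform_bound k⟩
  · exact (p.represents_rOf r0).isStarSmooth hp hr0 p.smoothOnRegion_fst
  · exact (hp.represents_dthetaOf hr0).isStarSmooth hp hr0
      (hp.smoothOnRegion_angSlope (hp.smoothOnRegion_opT hp.smoothOnRegion_ratio))
  · exact (hp.represents_LOf hr0).isStarSmooth hp hr0 hp.smoothOnRegion_lFun
  · exact (hp.hasDerivAt_thetaOf_snd hr0 x hy).differentiableAt
  · exact hp.differentiableAt_dR_iterate_thetaOf hr0 n x hy
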